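/- Let $K$ be a field. Let $\mathsf{ZX}$ be the prop presented by grey spiders and white spiders with any numbers of inputs and outputs and phase $(a,b)\in K^2$ ($a$ the affine, $b$ the symplectic phase) and by boxes labelled by $c\in K$, modulo flexsymmetry of the generators (the compact structure being given by the phase-free grey spiders) and the axioms: spider fusion (of grey spiders along one or more wires, of white spiders along a phase-free white spider $1\to1$; phases add); the phase-free grey spider $1\to1$ and the composite of the boxes $1$ and $-1$ are identities; grey and white spiders form a bialgebra; affine white states are copied and deleted by grey spiders; the scalars given by grey spiders of phase $(0,0)$ and of phase $(a,z)$, $z\ne 0$, are trivial; in the presence of the scalar given by a white spider of phase $(z,0)$, $z\neq0$, a wire may be cut; the box $c$ is the composite of a grey spider of phase $(0,c)$, a phase-free white spider $1\to 2$ whose second output is closed by a grey spider of phase $(0,-c)$, and a grey spider of phase $(0,c)$; boxes satisfy the product rule (the boxes $c$, $-1$, $d$ in sequence compose to the box $cd$) and the sum rule (boxes $c$ and $d$ in parallel between two phase-free grey spiders form the box $c+d$); and colour change: for $z\ne0$, a grey spider of phase $(a,b)$ with a box $z$ on every leg is the white spider of phase $(-a/z,b/z^2)$. These axioms are sound for the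 interpretation in which a wire carries a pair $(z,x)\in K^2$, the grey spider of phase $(a,b)$ means that all $x$-values are equal to one $x$ and $\sum z_{\mathrm{in}}-\sum z_{\mathrm{out}}+bx=a$, the white spider of phase $(a,b)$ means that all input $z$-values equal one $z$, all output $z$-values equal $-z$, and $\sum x_{\mathrm{in}}+\sum x_{\mathrm{out}}-bz=a$, and the box $c$ means $z_{\mathrm{out}}=-c\,x_{\mathrm{in}}$, $z_{\mathrm{in}}=c\,x_{\mathrm{out}}$. A *thick grey spider* of phase $(\vec x,X)$, with $\vec x\in K^m$ and $X\in K^{m\times m}$ symmetric, is the diagram of $m$ grey spiders (vertices), the $i$-th one of phase $(x_i,X_{ii})$, in which the $i$-th and $j$-th, $i\neq j$, are joined through a box labelled $-X_{ij}$; we say that they are joined by an edge of weight $X_{ij}$. (With this sign, such a spider on $m$ wires means $\sum \vec z_{\mathrm{in}}-\sum\vec z_{\mathrm{out}}+X\vec v=\vec x$, where $\vec v$ is the vector of the common $x$-values of the vertices.) For $\vec y\in K^n$ and a symmetric $Y\in K^{n\times n}$, let $G(\vec y,Y):0\to n$ be the graph state of phase $(\vec y,Y)$, in which each of the $n$ vertices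 has one output. A vertex without an input or output is *internal*. The following equations hold in $\mathsf{ZX}$. 1. (Elimination) Let $m,n\in\mathbb N$, $X\in K^{m\times m}$ symmetric and *invertible*, $Y\in K^{n\times n}$ symmetric, $E\in K^{m\times n}$, $\vec x\in K^m$, $\vec y\in K^n$. The diagram $0\to n$ that consists of $m$ internal vertices forming a thick grey spider of phase $(\vec x,X)$ and $n$ vertices with one output each forming a thick grey spider of phase $(\vec y,Y)$, where the $i$-th internal vertex is joined to the $j$-th vertex of the second group through a box labelled $E_{ij}$ for all $i,j$, equals $$G\bigl(\vec y+E^{T}X^{-1}\vec x,\; Y-E^{T}X^{-1}E\bigr).$$ 2. (Local complementation) Let $z\in K\setminus\{0\}$, $a\in K$, $\vec z,E\in K^k$ and $Z\in K^{k\times k}$ symmetric. The diagram obtained from $G(\vec z,Z)$ by adding one internal vertex of phase $(a,z)$, joined to the $i$-th vertex through a box labelled $E_i$ for all $i$, equals the graph state whose $i$-th vertex has phase $(\gamma_i,\delta_i)$ and whose edge $\{i,j\}$ has weight $g_{i,j}$, where $$\gamma_i=z_i+E_iaz^{-1},\qquad \delta_i=Z_{i,i}-z^{-1}E_i^2,\qquad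 g_{i,j}=Z_{i,j}-z^{-1}E_iE_j .$$ 3. (Pivoting) Let $\epsilon\in K\setminus\{0\}$, $a,b\in K$, $\vec z,E_1,E_2\in K^k$ and $Z\in K^{k\times k}$ symmetric. The diagram obtained from $G(\vec z,Z)$ by adding two internal vertices of phases $(a,0)$ and $(b,0)$, joined to each other by an edge of weight $\epsilon$ and joined to the $i$-th vertex through boxes labelled $E_{1,i}$ and $E_{2,i}$ respectively, for all $i$, equals the graph state whose $i$-th vertex has phase $(\gamma_i,\delta_i)$ and whose edge $\{i,j\}$ has weight $g_{i,j}$, where $$\gamma_i=z_i+\epsilon^{-1}(aE_{2,i}+bE_{1,i}),\quad \delta_i=Z_{i,i}-2\epsilon^{-1}E_{1,i}E_{2,i},\quad g_{i,j}=Z_{i,j}-\epsilon^{-1}(E_{1,i}E_{2,j}+E_{1,j}E_{2,i}).$$ -/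

import Mathlib

universe u

namespace ZX

/-!
The graphical language `ZX` over a field `K`, in its flexsymmetric presentation: a symmetric
monoidal category (prop) presented by grey spiders, white spiders and boxes, modulo equations.

Instead of numbering the wires of an object `n`, the wires are labelled by a finite type with `n`
elements, so that the symmetric structure is given by bijections of labels.  The arrows `n → m` of
the prop are the diagrams `Diag K (Fin n) (Fin m)` modulo `Eqv`.
-/

/-- String diagrams over the signature of `ZX`, with inputs labelled by the first type and outputs
labelled by the second.  A diagram with finitely many inputs runs through finite types only.
`wire e` only permutes (relabels) wires, `comp f g` is `f` followed by
`g`, and `tensor f g` is juxtaposition. In a spider, `a` is the affine and `b` the symplectic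
phase. -/
inductive Diag (K : Type u) : Type → Type → Type (max u 1)
  | wire {A B : Type} (e : A ≃ B) : Diag K A B
  | comp {A B C : Type} (f : Diag K A B) (g : Diag K B C) : Diag K A C
  | tensor {A B C D : Type} (f : Diag K A B) (g : Diag K C D) : Diag K (A ⊕ C) (B ⊕ D)
  | grey (A B : Type) [Finite A] [Finite B] (a b : K) : Diag K A B
  | white (A B : Type) [Finite A] [Finite B] (a b : K) : Diag K A B
  | box (a : K) : Diag K Unit Unit

open Diag

section
variable {K : Type u}

/-- The identity diagram. -/
def idn (A : Type) : Diag K A A := wire (Equiv.refl A)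

/-- Splitting a `(k+1)`-fold bundle of copies of `A` into its first copy and the rest. -/
def splitFirst (k : ℕ) (A : Type) : Fin (k + 1) × A ≃ A ⊕ (Fin k × A) where
  toFun p := Fin.cases (motive := fun _ => A ⊕ (Fin k × A)) (Sum.inl p.2)
    (fun i => Sum.inr (i, p.2)) p.1
  invFun := Sum.elim (fun a => (0, a)) (fun q => (q.1.succ, q.2))
  left_inv := by
    rintro ⟨i, a⟩
    refine Fin.cases ?_ (fun j => ?_) i <;> rfl
  right_inv := by
    rintro (a | ⟨i, a⟩) <;> rfl

/-- The juxtaposition of the diagrams `f 0, …, f (k-1)`. -/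
def parallel {A B : Type} : (k : ℕ) → (Fin k → Diag K A B) → Diag K (Fin k × A) (Fin k × B)
  | 0, _ => wire (Equiv.equivOfIsEmpty _ _)
  | k + 1, f =>
      comp (wire (splitFirst k A))
        (comp (tensor (f 0) (parallel k (fun i => f i.succ))) (wire (splitFirst k B).symm))

/-- Boxes labelled `c 0, …, c (k-1)` next to each other. -/
def boxes (k : ℕ) (c : Fin k → K) : Diag K (Fin k) (Fin k) :=
  comp (wire (Equiv.prodPUnit (Fin k)).symm)
    (comp (parallel k (fun i => box (c i))) (wire (Equiv.prodPUnit (Fin k))))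

end

section
variable {K : Type u} [Field K]

/-- The cup of the compact structure: the phase-free grey spider with two outputs. -/
def cup : Diag K Empty (Unit ⊕ Unit) := grey Empty (Unit ⊕ Unit) 0 0

/-- Bending the last input wire of a diagram into a last output wire. -/
def bend {A B : Type} (f : Diag K (A ⊕ Unit) B) : Diag K A (B ⊕ Unit) :=
  comp (wire (Equiv.sumEmpty A Empty).symm)
    (comp (tensor (idn A) cup)
      (comp (wire (Equiv.sumAssoc A Unit Unit).symm) (tensor f (idn Unit))))

/-- The antipode: the phase-free white spider with one input and one output. -/
def antipode : Diag K Unit Unit := white Unit Unit 0 0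

/-- Equality of diagrams in `ZX`: the congruence generated by the laws of symmetric monoidal
categories, flexsymmetry of the generators, and the axioms of the calculus. -/
inductive Eqv : {A B : Type} → Diag K A B → Diag K A B → Prop
  | refl {A B : Type} (f : Diag K A B) : Eqv f f
  | symm {A B : Type} {f g : Diag K A B} : Eqv f g → Eqv g f
  | trans {A B : Type} {f g h : Diag K A B} : Eqv f g → Eqv g h → Eqv f h
  | comp_congr {A B C : Type} {f f' : Diag K A B} {g g' : Diag K B C} :
      Eqv f f' → Eqv g g' → Eqv (comp f g) (comp f' g')
  | tensor_congr {A B C D : Type} {f f' : Diag K A B} {g g' : Diag K C D} :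
      Eqv f f' → Eqv g g' → Eqv (tensor f g) (tensor f' g')
  -- laws of symmetric monoidal categories
  | comp_assoc {A B C D : Type} (f : Diag K A B) (g : Diag K B C) (h : Diag K C D) :
      Eqv (comp (comp f g) h) (comp f (comp g h))
  | id_comp {A B : Type} (f : Diag K A B) : Eqv (comp (idn A) f) f
  | comp_id {A B : Type} (f : Diag K A B) : Eqv (comp f (idn B)) f
  | wire_comp {A B C : Type} (e : A ≃ B) (e' : B ≃ C) :
      Eqv (comp (wire e) (wire e')) (wire (e.trans e'))
  | wire_tensor {A B C D : Type} (e : A ≃ B) (e' : C ≃ D) :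
      Eqv (tensor (wire e) (wire e')) (wire (Equiv.sumCongr e e'))
  | tensor_comp {A B C A' B' C' : Type} (f : Diag K A B) (g : Diag K B C)
      (f' : Diag K A' B') (g' : Diag K B' C') :
      Eqv (tensor (comp f g) (comp f' g')) (comp (tensor f f') (tensor g g'))
  | tensor_assoc {A B C A' B' C' : Type} (f : Diag K A A') (g : Diag K B B') (h : Diag K C C') :
      Eqv (comp (tensor (tensor f g) h) (wire (Equiv.sumAssoc A' B' C')))
        (comp (wire (Equiv.sumAssoc A B C)) (tensor f (tensor g h)))
  | tensor_unit {A B : Type} (f : Diag K A B) :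
      Eqv (comp (tensor f (idn Empty)) (wire (Equiv.sumEmpty B Empty)))
        (comp (wire (Equiv.sumEmpty A Empty)) f)
  | tensor_symm {A B C D : Type} (f : Diag K A B) (g : Diag K C D) :
      Eqv (comp (tensor f g) (wire (Equiv.sumComm B D)))
        (comp (wire (Equiv.sumComm A C)) (tensor g f))
  -- flexsymmetry: spiders are invariant under permuting and bending legs, boxes under transposing
  | grey_wire {A B A' B' : Type} [Finite A] [Finite B] [Finite A'] [Finite B']
      (e : A' ≃ A) (e' : B ≃ B') (a b : K) :
      Eqv (comp (wire e) (comp (grey A B a b) (wire e'))) (grey A' B' a b)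
  | white_wire {A B A' B' : Type} [Finite A] [Finite B] [Finite A'] [Finite B']
      (e : A' ≃ A) (e' : B ≃ B') (a b : K) :
      Eqv (comp (wire e) (comp (white A B a b) (wire e'))) (white A' B' a b)
  | grey_bend {A B : Type} [Finite A] [Finite B] (a b : K) :
      Eqv (bend (grey (A ⊕ Unit) B a b)) (grey A (B ⊕ Unit) a b)
  | white_bend {A B : Type} [Finite A] [Finite B] (a b : K) :
      Eqv (bend (white (A ⊕ Unit) B a b)) (white A (B ⊕ Unit) a b)
  | box_bend (a : K) :
      Eqv (comp cup (comp (tensor (box a) (idn Unit)) (wire (Equiv.sumComm Unit Unit))))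
        (comp cup (tensor (box a) (idn Unit)))
  -- spiders fuse: grey ones along at least one plain wire, white ones along an antipode
  | grey_fusion {A B C D F : Type} [Finite A] [Finite B] [Finite C] [Finite D] [Finite F]
      [Nonempty C] (a b c d : K) :
      Eqv (comp (tensor (grey A (B ⊕ C) a b) (idn D))
          (comp (wire (Equiv.sumAssoc B C D)) (tensor (idn B) (grey (C ⊕ D) F c d))))
        (grey (A ⊕ D) (B ⊕ F) (a + c) (b + d))
  | white_fusion {A B D F : Type} [Finite A] [Finite B] [Finite D] [Finite F] (a b c d : K) :
      Eqv (comp (tensor (comp (white A (B ⊕ Unit) a b) (tensor (idn B) antipode)) (idn D))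
          (comp (wire (Equiv.sumAssoc B Unit D)) (tensor (idn B) (white (Unit ⊕ D) F c d))))
        (white (A ⊕ D) (B ⊕ F) (a + c) (b + d))
  -- identities
  | grey_id : Eqv (grey Unit Unit 0 0) (idn Unit)
  | box_inverse : Eqv (comp (box 1) (box (-1))) (idn Unit)
  -- grey and white spiders form a bialgebra
  | bigebra :
      Eqv (comp (white (Unit ⊕ Unit) Unit 0 0) (grey Unit (Unit ⊕ Unit) 0 0))
        (comp (tensor (grey Unit (Unit ⊕ Unit) 0 0) (grey Unit (Unit ⊕ Unit) 0 0))
          (comp (wire (Equiv.sumSumSumComm Unit Unit Unit Unit))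
            (tensor (white (Unit ⊕ Unit) Unit 0 0) (white (Unit ⊕ Unit) Unit 0 0))))
  -- grey spiders copy and delete affine white states
  | copy (a : K) :
      Eqv (comp (white Empty Unit a 0) (grey Unit (Unit ⊕ Unit) 0 0))
        (comp (wire (Equiv.sumEmpty Empty Empty).symm)
          (tensor (white Empty Unit a 0) (white Empty Unit a 0)))
  | delete (a : K) :
      Eqv (comp (white Empty Unit a 0) (grey Unit Empty 0 0)) (idn Empty)
  -- scalars
  | one : Eqv (grey Empty Empty 0 0) (idn Empty)
  | one_phase (a z : K) : z ≠ 0 → Eqv (grey Empty Empty a z) (idn Empty)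
  | zero (z : K) : z ≠ 0 →
      Eqv (tensor (white Empty Empty z 0) (idn Unit))
        (tensor (white Empty Empty z 0) (comp (grey Unit Empty 0 0) (grey Empty Unit 0 0)))
  -- boxes: decomposition into spiders, product, sum, and change of colour
  | box_spiders (a : K) :
      Eqv (comp (grey Unit Unit 0 a)
          (comp (white Unit (Unit ⊕ Unit) 0 0)
            (comp (tensor (grey Unit Unit 0 a) (grey Unit Empty 0 (-a)))
              (wire (Equiv.sumEmpty Unit Empty)))))
        (box a)
  | times (a b : K) : Eqv (comp (box a) (comp (box (-1)) (box b))) (box (a * b))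
  | plus (a b : K) :
      Eqv (comp (grey Unit (Unit ⊕ Unit) 0 0)
          (comp (tensor (box a) (box b)) (grey (Unit ⊕ Unit) Unit 0 0)))
        (box (a + b))
  | colour (m n : ℕ) (a b z : K) : z ≠ 0 →
      Eqv (comp (boxes m (fun _ => z))
          (comp (grey (Fin m) (Fin n) a b) (boxes n (fun _ => z))))
        (white (Fin m) (Fin n) (-(a / z)) (b / z ^ 2))

/-- The interpretation of diagrams as relations between phase spaces; a wire carries a pair
`(z, x)`.  (For `c ≠ 0` the relation of `box c` is the graph of `(z, x) ↦ (-c x, z / c)`; for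
`c = 0` it is `{((0, x), (0, x'))}`.) -/
def interp : {A B : Type} → Diag K A B → (A → K × K) → (B → K × K) → Prop
  | _, _, .wire e => fun s t => ∀ i, s i = t (e i)
  | _, _, .comp f g => fun s t => ∃ r, interp f s r ∧ interp g r t
  | _, _, .tensor f g => fun s t =>
      interp f (s ∘ Sum.inl) (t ∘ Sum.inl) ∧ interp g (s ∘ Sum.inr) (t ∘ Sum.inr)
  | _, _, @Diag.grey _ _ _ _ _ a b => fun s t => ∃ x : K, (∀ i, (s i).2 = x) ∧ (∀ j, (t j).2 = x) ∧
      (∑ᶠ i, (s i).1) - (∑ᶠ j, (t j).1) + b * x = a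
  | _, _, @Diag.white _ _ _ _ _ a b => fun s t => ∃ z : K, (∀ i, (s i).1 = z) ∧ (∀ j, (t j).1 = -z) ∧
      (∑ᶠ i, (s i).2) + (∑ᶠ j, (t j).2) - b * z = a
  | _, _, .box c => fun s t => (t ()).1 = -(c * (s ()).2) ∧ (s ()).1 = c * (t ()).2

theorem interp_wire {A B : Type} (e : A ≃ B) (s : A → K × K) (t : B → K × K) :
    interp (wire e) s t ↔ t = s ∘ e.symm := by
  simp only [interp]
  constructor
  · intro h; funext j; simp [h]
  · rintro rfl i; simp

theorem interp_idn {A : Type} (s t : A → K × K) : interp (idn A) s t ↔ t = s := by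
  simp [idn, interp_wire]

theorem interp_wire_comp {A B C : Type} (e : A ≃ B) (f : Diag K B C) (s t) :
    interp (comp (wire e) f) s t ↔ interp f (s ∘ e.symm) t := by
  simp [interp]
  constructor
  · rintro ⟨r, h, h'⟩
    have : r = s ∘ e.symm := by funext j; simp [h]
    exact this ▸ h'
  · intro h; exact ⟨_, by simp, h⟩

theorem interp_comp_wire {A B C : Type} (e : B ≃ C) (f : Diag K A B) (s t) :
    interp (comp f (wire e)) s t ↔ interp f s (t ∘ e) := by
  simp only [interp]
  constructor
  · rintro ⟨r, h, h'⟩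
    have : r = t ∘ e := by funext j; simp [h']
    exact this ▸ h
  · intro h; exact ⟨_, h, by simp⟩

theorem interp_grey {A B : Type} [Fintype A] [Fintype B] (a b : K) (s : A → K × K) (t : B → K × K) :
    interp (grey A B a b) s t ↔ ∃ x : K, (∀ i, (s i).2 = x) ∧ (∀ j, (t j).2 = x) ∧
      (∑ i, (s i).1) - (∑ j, (t j).1) + b * x = a := by
  simp [interp, finsum_eq_sum_of_fintype]

theorem interp_white {A B : Type} [Fintype A] [Fintype B] (a b : K) (s : A → K × K) (t : B → K × K) :
    interp (white A B a b) s t ↔ ∃ z : K, (∀ i, (s i).1 = z) ∧ (∀ j, (t j).1 = -z) ∧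
      (∑ i, (s i).2) + (∑ j, (t j).2) - b * z = a := by
  simp [interp, finsum_eq_sum_of_fintype]

theorem interp_parallel {A B : Type} : ∀ (k : ℕ) (f : Fin k → Diag K A B) (s t),
    interp (parallel k f) s t ↔ ∀ i, interp (f i) (fun a => s (i, a)) (fun b => t (i, b))
  | 0, f, s, t => by simp [parallel, interp]
  | k + 1, f, s, t => by
    rw [parallel, interp_wire_comp, interp_comp_wire]
    simp only [interp]
    rw [interp_parallel k, Fin.forall_fin_succ]
    rfl

theorem interp_boxes (k : ℕ) (c : Fin k → K) (s t) :
    interp (boxes k c) s t ↔ ∀ i, (t i).1 = -(c i * (s i).2) ∧ (s i).1 = c i * (t i).2 := by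
  rw [boxes, interp_wire_comp, interp_comp_wire, interp_parallel]
  rfl

theorem interp_comp {A B C : Type} (f : Diag K A B) (g : Diag K B C) (s t) :
    interp (comp f g) s t ↔ ∃ r, interp f s r ∧ interp g r t := Iff.rfl
theorem interp_tensor {A B C D : Type} (f : Diag K A B) (g : Diag K C D) (s t) :
    interp (tensor f g) s t ↔
      interp f (s ∘ Sum.inl) (t ∘ Sum.inl) ∧ interp g (s ∘ Sum.inr) (t ∘ Sum.inr) := Iff.rfl
theorem interp_box (c : K) (s t) :
    interp (box c) s t ↔ (t ()).1 = -(c * (s ()).2) ∧ (s ()).1 = c * (t ()).2 := Iff.rfl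

theorem ex_sum {A B X : Type*} {P : (A ⊕ B → X) → Prop} :
    (∃ r, P r) ↔ ∃ p q, P (Sum.elim p q) := by
  constructor
  · rintro ⟨r, h⟩; exact ⟨r ∘ Sum.inl, r ∘ Sum.inr, by simpa using h⟩
  · rintro ⟨p, q, h⟩; exact ⟨_, h⟩

theorem ex_unit {X : Type*} {P : (Unit → X) → Prop} :
    (∃ r, P r) ↔ ∃ x, P (fun _ => x) := by
  constructor
  · rintro ⟨r, h⟩; exact ⟨r (), h⟩
  · rintro ⟨p, h⟩; exact ⟨_, h⟩

theorem fun_unit {X : Type*} (s t : Unit → X) : s = t ↔ s () = t () := by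
  constructor
  · rintro rfl; rfl
  · intro h; funext; exact h

theorem interp_bend {A B : Type} (f : Diag K (A ⊕ Unit) B) (s t) :
    interp (bend f) s t ↔
      interp f (Sum.elim s (fun _ => (-(t (Sum.inr ())).1, (t (Sum.inr ())).2))) (t ∘ Sum.inl) := by
  rw [bend, interp_wire_comp, interp_comp]
  simp only [interp_wire_comp, interp_tensor, interp_idn, cup, interp_grey]
  constructor
  · rintro ⟨r, ⟨h0, x, -, h1, h2⟩, h3, h4⟩
    convert h3 using 1
    funext i
    have e4 := congrFun h4 ()
    rcases i with i | ⟨⟩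
    · exact (congrFun h0 i).symm
    · have a1 := h1 (Sum.inl ()); have a2 := h1 (Sum.inr ())
      simp at a1 a2 h2 e4 ⊢
      ext
      · simp [e4]; linear_combination h2
      · simp [e4]; rw [a1, a2]
  · intro h
    refine ⟨Sum.elim s (Sum.elim (fun _ => (-(t (Sum.inr ())).1, (t (Sum.inr ())).2))
      (fun _ => t (Sum.inr ()))), ⟨?_, (t (Sum.inr ())).2, by simp, by simp, by simp⟩, ?_, ?_⟩
    · funext i; simp
    · convert h using 1; funext i; rcases i with i | i <;> rfl
    · funext i; simp

/-- The equations of `ZX` hold in the relational interpretation, which is therefore well defined on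
arrows of `ZX`. -/
theorem Eqv.sound {A B : Type} {f g : Diag K A B} (h : Eqv f g) :
    ∀ s t, interp f s t ↔ interp g s t := by
  induction h with
  | refl f => intros; rfl
  | symm _ ih => intro s t; exact (ih s t).symm
  | trans _ _ ih ih' => intro s t; exact (ih s t).trans (ih' s t)
  | comp_congr _ _ ih ih' => intro s t; simp only [interp, ih, ih']
  | tensor_congr _ _ ih ih' => intro s t; simp only [interp, ih, ih']
  | comp_assoc f g h =>
    intro s t; simp only [interp]
    constructor
    · rintro ⟨r, ⟨q, h1, h2⟩, h3⟩; exact ⟨q, h1, r, h2, h3⟩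
    · rintro ⟨q, h1, r, h2, h3⟩; exact ⟨r, ⟨q, h1, h2⟩, h3⟩
  | id_comp f => intro s t; rw [idn, interp_wire_comp]; rfl
  | comp_id f => intro s t; rw [idn, interp_comp_wire]; rfl
  | wire_comp e e' => intro s t; rw [interp_wire_comp]; simp [interp_wire, Function.comp_assoc]
  | wire_tensor e e' =>
    intro s t; rw [interp_tensor]; simp only [interp, Sum.forall]; rfl
  | tensor_comp f g f' g' =>
    intro s t; simp only [interp]
    constructor
    · rintro ⟨⟨r, h1, h2⟩, q, h3, h4⟩; exact ⟨Sum.elim r q, ⟨h1, h3⟩, h2, h4⟩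
    · rintro ⟨r, ⟨h1, h3⟩, h2, h4⟩; exact ⟨⟨_, h1, h2⟩, _, h3, h4⟩
  | tensor_assoc f g h =>
    intro s t; rw [interp_comp_wire, interp_wire_comp]; simp only [interp, and_assoc]; rfl
  | tensor_unit f =>
    intro s t; rw [interp_comp_wire, interp_wire_comp]; simp only [interp, interp_idn]
    constructor
    · exact fun h => h.1
    · exact fun h => ⟨h, Subsingleton.elim _ _⟩
  | tensor_symm f g =>
    intro s t; rw [interp_comp_wire, interp_wire_comp]; simp only [interp]
    exact and_comm
  | @grey_wire A B A' B' _ _ _ _ e e' a b =>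
    intro s t
    have := Fintype.ofFinite A; have := Fintype.ofFinite B
    have := Fintype.ofFinite A'; have := Fintype.ofFinite B'
    rw [interp_wire_comp, interp_comp_wire, interp_grey, interp_grey]
    simp only [Function.comp, e.symm.forall_congr_left, e'.forall_congr_left,
      Equiv.sum_comp e.symm (fun i => (s i).1), Equiv.sum_comp e' (fun i => (t i).1)]
    simp
  | @white_wire A B A' B' _ _ _ _ e e' a b =>
    intro s t
    have := Fintype.ofFinite A; have := Fintype.ofFinite B
    have := Fintype.ofFinite A'; have := Fintype.ofFinite B'
    rw [interp_wire_comp, interp_comp_wire, interp_white, interp_white]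
    simp only [Function.comp, e.symm.forall_congr_left, e'.forall_congr_left,
      Equiv.sum_comp e.symm (fun i => (s i).2), Equiv.sum_comp e' (fun i => (t i).2)]
    simp
  | @grey_bend A B _ _ a b =>
    intro s t
    have := Fintype.ofFinite A; have := Fintype.ofFinite B
    rw [interp_bend, interp_grey, interp_grey]
    simp only [Fintype.sum_sum_type, Sum.forall]
    apply exists_congr; intro x
    simp
    grind
  | @white_bend A B _ _ a b =>
    intro s t
    have := Fintype.ofFinite A; have := Fintype.ofFinite B
    rw [interp_bend, interp_white, interp_white]
    simp only [Fintype.sum_sum_type, Sum.forall]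
    apply exists_congr; intro x
    simp
    grind
  | box_bend a =>
    intro s t
    have key : ∀ t : Unit ⊕ Unit → K × K, interp (comp cup (tensor (box a) (idn Unit))) s t ↔
        (t (Sum.inl ())).1 = -(a * (t (Sum.inr ())).2) ∧
        (t (Sum.inr ())).1 = -(a * (t (Sum.inl ())).2) := by
      intro t
      simp only [interp_comp, interp_tensor, interp_box, interp_idn, cup, interp_grey]
      constructor
      · rintro ⟨r, ⟨x, -, h1, h2⟩, h3, h4⟩
        have e4 := congrFun h4 ()
        have a1 := h1 (Sum.inl ()); have a2 := h1 (Sum.inr ())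
        simp at h2 h3 e4
        grind
      · rintro ⟨h1, h2⟩
        refine ⟨Sum.elim (fun _ => (-(t (Sum.inr ())).1, (t (Sum.inr ())).2))
          (fun _ => t (Sum.inr ())), ⟨(t (Sum.inr ())).2, by simp, by simp, by simp⟩, ?_, ?_⟩
        · simp; grind
        · funext i; simp
    have : interp (comp cup (comp (tensor (box a) (idn Unit)) (wire (Equiv.sumComm Unit Unit)))) s t
       ↔ interp (comp cup (tensor (box a) (idn Unit))) s (t ∘ Equiv.sumComm Unit Unit) := by
      simp only [interp_comp cup, interp_comp_wire]
    rw [this, key, key]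
    simp
    exact and_comm
  | @grey_fusion A B C D F _ _ _ _ _ _ a b c d =>
    intro s t
    have := Fintype.ofFinite A; have := Fintype.ofFinite B
    have := Fintype.ofFinite C; have := Fintype.ofFinite D
    have := Fintype.ofFinite F
    rw [interp_comp]
    simp only [interp_wire_comp, interp_tensor, interp_idn, interp_grey]
    simp only [Fintype.sum_sum_type, Sum.forall]
    constructor
    · rintro ⟨r, ⟨⟨x, h1, ⟨h2, h3⟩, h4⟩, h5⟩, h6, ⟨x', ⟨h7, h8⟩, h9, h10⟩⟩
      simp at *
      obtain ⟨c0⟩ := ‹Nonempty C›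
      have hx : x' = x := by rw [← h7 c0, h3]
      subst hx
      have q1 : ∀ i, r (Sum.inl (Sum.inl i)) = t (Sum.inl i) := fun i => (congrFun h6 i).symm
      have q2 : ∀ i, r (Sum.inr i) = s (Sum.inr i) := fun i => congrFun h5 i
      simp only [q1, q2] at *
      refine ⟨x', ⟨h1, h8⟩, ⟨h2, h9⟩, ?_⟩
      linear_combination h4 + h10
    · rintro ⟨x, ⟨h1, h2⟩, ⟨h3, h4⟩, h5⟩
      obtain ⟨c0⟩ := ‹Nonempty C›
      classical
      let w := ∑ i, (s (Sum.inl i)).1 - ∑ i, (t (Sum.inl i)).1 + b * x - a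
      refine ⟨Sum.elim (Sum.elim (t ∘ Sum.inl) (fun i => (if i = c0 then w else 0, x))) (s ∘ Sum.inr),
        ⟨⟨x, h1, ⟨by simpa using h3, by simp⟩, ?_⟩, by funext; rfl⟩, by funext i; rfl,
        ⟨x, ⟨by simp, by simpa using h2⟩, h4, ?_⟩⟩
      · simp [w]; ring
      · simp [w]; linear_combination h5
  | @white_fusion A B D F _ _ _ _ a b c d =>
    intro s t
    have := Fintype.ofFinite A; have := Fintype.ofFinite B
    have := Fintype.ofFinite D
    have := Fintype.ofFinite F
    rw [interp_comp]
    simp only [interp_wire_comp, interp_tensor, interp_idn, antipode, interp_comp (white _ _ _ _),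
      interp_white]
    simp only [Fintype.sum_sum_type, Sum.forall]
    constructor
    · rintro ⟨r, ⟨⟨u, ⟨x, h1, ⟨h2, h3⟩, h4⟩, g1, g2, g3, g4, g5⟩, h5⟩, h6, ⟨x', ⟨h7, h8⟩, h9, h10⟩⟩
      have q1 : ∀ i, u (Sum.inl i) = t (Sum.inl i) := fun i => by
        have a1 := congrFun g1 i; have a2 := congrFun h6 i
        simp at a1 a2; rw [a2, a1]
      have q2 : ∀ i, r (Sum.inr i) = s (Sum.inr i) := fun i => congrFun h5 i
      have g3 := g3 (); have g4 := g4 (); have h3 := h3 (); have h7 := h7 ()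
      simp at *
      simp only [q1, q2] at *
      have hx : x' = x := by rw [← h7, g4, ← g3, h3, neg_neg]
      subst hx
      refine ⟨x', ⟨h1, h8⟩, ⟨h2, h9⟩, ?_⟩
      linear_combination h4 + h10 - g5
    · rintro ⟨x, ⟨h1, h2⟩, ⟨h3, h4⟩, h5⟩
      let w := a + b * x - ∑ i, (s (Sum.inl i)).2 - ∑ i, (t (Sum.inl i)).2
      refine ⟨Sum.elim (Sum.elim (t ∘ Sum.inl) (fun i => (x, -w))) (s ∘ Sum.inr),
        ⟨⟨Sum.elim (t ∘ Sum.inl) (fun i => (-x, w)), ⟨x, h1, ⟨by simpa using h3, by simp⟩, ?_⟩,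
          by funext; rfl, -x, by simp, by simp, by simp⟩, by funext; rfl⟩, by funext i; rfl,
        ⟨x, ⟨by simp, by simpa using h2⟩, h4, ?_⟩⟩
      · simp [w]
      · simp [w]; linear_combination h5
  | grey_id =>
    intro s t
    simp only [interp_grey, interp_idn, fun_unit, Prod.ext_iff]
    simp [sub_eq_zero]
    constructor
    · rintro ⟨x, h1, h2, h3⟩; exact ⟨h3.symm, (h2 ()).trans (h1 ()).symm⟩
    · rintro ⟨h1, h2⟩; exact ⟨_, fun _ => rfl, fun _ => h2, h1.symm⟩
  | box_inverse =>
    intro s t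
    simp only [interp, ex_unit, interp_idn, fun_unit, Prod.ext_iff,  Prod.exists]
    simp
    grind
  | bigebra =>
    intro s t
    rw [interp_comp, interp_comp]
    simp only [interp_wire_comp, interp_tensor, interp_grey, interp_white, ex_unit, Prod.exists]
    constructor
    · rintro ⟨p, q, ⟨z, h1, h2, h3⟩, x, h4, h5, h6⟩
      have a1 := h1 (Sum.inl ()); have a2 := h1 (Sum.inr ())
      have b1 := h5 (Sum.inl ()); have b2 := h5 (Sum.inr ())
      have c1 := h2 (); have c2 := h4 ()
      simp at h3 h6 c1 c2 a1 a2 b1 b2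
      refine ⟨Sum.elim (Sum.elim (fun _ => (-(t (Sum.inl ())).1, (s (Sum.inl ())).2))
          (fun _ => (-(t (Sum.inr ())).1, (s (Sum.inl ())).2)))
        (Sum.elim (fun _ => (-(t (Sum.inl ())).1, (s (Sum.inr ())).2))
          (fun _ => (-(t (Sum.inr ())).1, (s (Sum.inr ())).2))), ?_, ?_⟩
      · simp; grind
      · simp [Equiv.sumSumSumComm]; grind
    · rintro ⟨r, ⟨⟨x, h1, h2, h3⟩, ⟨x', h1', h2', h3'⟩⟩, ⟨z, k1, k2, k3⟩, ⟨z', k1', k2', k3'⟩⟩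
      have a1 := h1 (); have a2 := h2 (Sum.inl ()); have a3 := h2 (Sum.inr ())
      have a1' := h1' (); have a2' := h2' (Sum.inl ()); have a3' := h2' (Sum.inr ())
      have b1 := k2 (); have b2 := k1 (Sum.inl ()); have b3 := k1 (Sum.inr ())
      have b1' := k2' (); have b2' := k1' (Sum.inl ()); have b3' := k1' (Sum.inr ())
      simp [Equiv.sumSumSumComm] at *
      refine ⟨(t (Sum.inl ())).2, (s (Sum.inl ())).1, ?_, ?_⟩ <;> grind
  | copy a =>
    intro s t
    rw [interp_wire_comp]
    simp only [interp_comp, interp_tensor, interp_grey, interp_white, ex_unit, Prod.exists]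
    simp
    constructor
    · rintro ⟨⟨h1, h2⟩, x, h3⟩
      exact ⟨⟨⟨-(t (Sum.inl ())).1, by simp⟩, h1 ()⟩, ⟨-(t (Sum.inr ())).1, by simp⟩, h2 ()⟩
    · rintro ⟨⟨-, h1⟩, -, h2⟩
      exact ⟨⟨fun _ => h1, fun _ => h2⟩, -((t (Sum.inl ())).1 + (t (Sum.inr ())).1), by simp⟩
  | delete a =>
    intro s t
    simp only [interp_comp, interp_tensor, interp_grey, interp_white,  ex_unit, interp_idn, Prod.exists]
    simp
    exact Subsingleton.elim _ _
  | one =>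
    intro s t
    simp only [interp_grey, interp_idn]
    simp
    exact Subsingleton.elim _ _
  | one_phase a z hz =>
    intro s t
    simp only [interp_grey, interp_idn]
    simp
    exact ⟨fun _ => Subsingleton.elim _ _, fun _ => ⟨a / z, by field_simp⟩⟩
  | zero z hz =>
    intro s t
    simp only [interp_tensor, interp_white]
    simp [hz.symm]
  | box_spiders a =>
    intro s t
    rw [interp_comp]
    simp only [interp_comp (white _ _ _ _), interp_comp_wire, interp_tensor, interp_grey,
      interp_white, interp_box, ex_unit, Prod.exists]
    constructor
    · rintro ⟨p, q, ⟨x, h1, h2, h3⟩, r, ⟨z, h4, h5, h6⟩, ⟨x', k1, k2, k3⟩, x'', k4, k5, k6⟩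
      have h1 := h1 (); have h2 := h2 (); have h4 := h4 (); have k1 := k1 ()
      have k2 := k2 (); have k4 := k4 ()
      have e1 := h5 (Sum.inl ()); have e2 := h5 (Sum.inr ())
      simp at *
      grind
    · rintro ⟨h1, h2⟩
      refine ⟨(s ()).1 + a * (s ()).2, (s ()).2, ⟨(s ()).2, by simp, by simp, by simp⟩,
        Sum.elim (fun _ => (-((s ()).1 + a * (s ()).2), (t ()).2))
          (fun _ => (-((s ()).1 + a * (s ()).2), -((s ()).2 + (t ()).2))),
        ⟨(s ()).1 + a * (s ()).2, by simp, by simp, by simp⟩, ⟨(t ()).2, by simp, by simp, ?_⟩,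
        ⟨-((s ()).2 + (t ()).2), by simp, by simp, ?_⟩⟩
      · simp at *; grind
      · simp at *; grind
  | times a b =>
    intro s t
    simp only [interp, ex_unit, Prod.exists]
    simp
    grind
  | plus a b =>
    intro s t
    simp only [interp_comp, interp_tensor, interp_box, interp_grey, ex_sum, ex_unit, Prod.exists]
    simp
    constructor
    · rintro ⟨x, x', ⟨h1, h2⟩, h3, h4⟩
      have h1 := h1 (); have h3 := h3 ()
      constructor <;> grind
    · rintro ⟨h1, h2⟩
      refine ⟨(s ()).2, (t ()).2, ⟨fun _ => rfl, ?_⟩, fun _ => rfl, ?_⟩ <;> grind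
  | colour m n a b z hz =>
    intro s t
    simp only [interp_comp, interp_white]
    simp only [interp_boxes, interp_grey]
    constructor
    · rintro ⟨p, hp, q, ⟨x, h1, h2, h3⟩, hq⟩
      have e1 : ∀ i, (s i).1 = z * x := fun i => by rw [(hp i).2, h1]
      have e2 : ∀ i, (t i).1 = -(z * x) := fun i => by rw [(hq i).1, h2]
      refine ⟨z * x, e1, e2, ?_⟩
      have e3 : ∑ i, (p i).1 = -(z * ∑ i, (s i).2) := by
        rw [Finset.mul_sum, ← Finset.sum_neg_distrib]; exact Finset.sum_congr rfl fun i _ => (hp i).1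
      have e4 : ∑ i, (q i).1 = z * ∑ i, (t i).2 := by
        rw [Finset.mul_sum]; exact Finset.sum_congr rfl fun i _ => (hq i).2
      rw [e3, e4] at h3
      field_simp
      rw [← h3]; ring
    · rintro ⟨y, h1, h2, h3⟩
      refine ⟨fun i => (-(z * (s i).2), y / z), fun i => ⟨rfl, ?_⟩,
        fun i => (z * (t i).2, y / z), ⟨y / z, fun _ => rfl, fun _ => rfl, ?_⟩, fun i => ⟨?_, rfl⟩⟩
      · rw [h1]; field_simp
      · simp only [Finset.sum_neg_distrib, ← Finset.mul_sum]
        field_simp at h3 ⊢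
        linear_combination -h3
      · rw [h2]; field_simp

/-- The grey spider on a thick wire of colour `k`, with legs `A` and `B` and phase `(x, X)`, `X`
symmetric: the graph-like diagram of `k` thin grey spiders, the `i`-th one with phase
`(x i, X i i)` and legs `A` and `B`, in which the `i`-th and the `j`-th spider, `i < j`, are joined
through a box labelled `-X i j`.  With this sign its interpretation on `k` wires is
`∑ zᵢₙ - ∑ zₒᵤₜ + X x = a` for the phase `(a, X)`, so that `X` adds up under fusion
and transforms as a quadratic form. -/
def thickGrey : (k : ℕ) → (A B : Type) → [Finite A] → [Finite B] →
    (Fin k → K) → Matrix (Fin k) (Fin k) K → Diag K (Fin k × A) (Fin k × B)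
  | 0, _, _, _, _, _, _ => wire (Equiv.equivOfIsEmpty _ _)
  | k + 1, A, B, _, _, x, X =>
      comp (wire (splitFirst k A))
      (comp
        (tensor
          (comp (grey A (B ⊕ Fin k) (x 0) (X 0 0))
            (tensor (idn B) (boxes k (fun j => -X 0 j.succ))))
          (idn (Fin k × A)))
      (comp (wire (Equiv.sumAssoc B (Fin k) (Fin k × A)))
      (comp
        (tensor (idn B)
          (comp
            (wire ((Equiv.sumCongr (Equiv.prodPUnit (Fin k)).symm (Equiv.refl (Fin k × A))).trans
              (Equiv.prodSumDistrib (Fin k) Unit A).symm))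
            (thickGrey k (Unit ⊕ A) B (fun i => x i.succ) (X.submatrix Fin.succ Fin.succ))))
        (wire (splitFirst k B).symm))))

/-- The graph state with phase `(y, Y)`: a thick grey spider without inputs and with one thick
output, so each of its `n` vertices has one output. -/
def graphState (n : ℕ) (y : Fin n → K) (Y : Matrix (Fin n) (Fin n) K) : Diag K Empty (Fin n) :=
  comp (wire (Equiv.equivOfIsEmpty Empty (Fin n × Empty)))
    (comp (thickGrey n Empty Unit y Y) (wire (Equiv.prodPUnit (Fin n))))

/-- A scalable graph-like diagram with `m` internal vertices, forming a thick grey spider of phase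
`(x, X)`, and `n` boundary vertices, forming a thick grey spider of phase `(y, Y)` with one output
each; the internal vertex `i` and the boundary vertex `j` are joined through a box `E i j`. -/
def blockDiagram (m n : ℕ) (x : Fin m → K) (X : Matrix (Fin m) (Fin m) K)
    (E : Matrix (Fin m) (Fin n) K) (y : Fin n → K) (Y : Matrix (Fin n) (Fin n) K) :
    Diag K Empty (Fin n) :=
  comp (wire (Equiv.equivOfIsEmpty Empty (Fin m × Empty)))
    (comp (thickGrey m Empty (Fin n) x X)
    (comp (parallel m (fun i => boxes n (E i)))
    (comp (wire (Equiv.prodComm (Fin m) (Fin n)))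
    (comp (thickGrey n (Fin m) Unit y Y) (wire (Equiv.prodPUnit (Fin n)))))))

/-- One internal vertex of phase `(a, z)`, joined through boxes `E i` to the vertices of a graph
with `k` boundary vertices and phase `(y, Y)`. -/
def vertexDiagram (k : ℕ) (a z : K) (E : Fin k → K) (y : Fin k → K)
    (Y : Matrix (Fin k) (Fin k) K) : Diag K Empty (Fin k) :=
  comp (grey Empty (Fin k) a z)
    (comp (boxes k E)
    (comp (wire (Equiv.prodPUnit (Fin k)).symm)
    (comp (thickGrey k Unit Unit y Y) (wire (Equiv.prodPUnit (Fin k))))))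

/-- Two internal vertices of phases `(a, 0)` and `(b, 0)`, joined by an edge of weight `ε` in the
sense of thick spiders (so through a box `-ε`), and joined respectively through boxes `E₁ i` and
`E₂ i` to the vertices of a graph with `k` boundary vertices and phase `(y, Y)`. -/
def edgeDiagram (k : ℕ) (a b ε : K) (E₁ E₂ : Fin k → K) (y : Fin k → K)
    (Y : Matrix (Fin k) (Fin k) K) : Diag K Empty (Fin k) :=
  comp (grey Empty (Fin k ⊕ Unit) a 0)
    (comp (tensor (idn (Fin k)) (comp (box (-ε)) (grey Unit (Fin k) b 0)))
    (comp (tensor (boxes k E₁) (boxes k E₂))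
    (comp (wire ((Equiv.sumCongr (Equiv.prodPUnit (Fin k)).symm (Equiv.prodPUnit (Fin k)).symm).trans
        (Equiv.prodSumDistrib (Fin k) Unit Unit).symm))
    (comp (thickGrey k (Unit ⊕ Unit) Unit y Y) (wire (Equiv.prodPUnit (Fin k)))))))

end

end ZX

/-!
A diagram is read as a formula whose variables are names of wires. Arrows `0 → V` of `ZX`, with
wires labelled by a finite type `V`, form a commutative monoid `T K V`: the product of two formulas
joins wires of the same name by grey spiders. Phase-free grey spiders also provide a renaming
`map φ : T K V → T K W` for every map `φ : V → W`, and a quantifier `Ex : T K (V ⊕ B) → T K V`,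
which deletes the wires `B`. That renaming is functorial and that the quantifier obeys Frobenius
reciprocity and commutes with renaming follows from fusion of grey spiders alone (`N_comp`,
`map_Ex`, `Ex_mul_map_inl`, `Ex_map_injective`). As wires can be bent (`zigzag_eq_id`), each diagram
`f` has a formula `den f α β` for names `α`, `β` of its inputs and outputs, and composition becomes
a product with quantified middle wires (`den_comp`). In this language a grey spider is a phase
`ph a b v` at a quantified variable `v` that is equal to all its legs (`sp_eq_Ex`), a box is a binary
formula `edge c u v`, and white spiders are eliminated by change of colour (`wh_eq_Ex`).

The axioms show that certain formulas describe functions: the white spider with three legs says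
that a variable is minus the sum of two others (`tri_mul_eqv`, by the bialgebra axiom), and two boxes
in sequence say that a variable is a multiple of another one (`lin_mul_eqv`, by comparing colour
changes with different boxes). Such a formula can be substituted for a variable, and the
substitution is a homomorphism of monoids (`Copyable.Ex_mul`, `subst`). Composing substitutions gives
the change of variables `x ↦ x + c j`, which is invertible and thus does not affect a quantified
variable `x` (`Ex_shear`), and which transforms phases and boxes like a quadratic form (`shear_ph`,
`shear_edge`).

A formula that is a product of phases and boxes is determined by the affine phases at its variables
and by a symmetric matrix (`IsQuad.unique`), since boxes between the same variables add up and a box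
that joins a variable to itself is a phase (`edge_self`). A quantified variable of nonzero symplectic
phase is eliminated by completing the square (`isQuad_Ex_vertex`), a pair of quantified variables
that are joined by a box and have no symplectic phase is eliminated because each of them imposes a
linear equation on the other one (`Ex_pivot`). A nonsingular symmetric matrix has a nonzero diagonal
entry or a nonsingular principal submatrix with zero diagonal on two indices, and the Schur
complement of this entry or submatrix is nonsingular again. Induction on the size therefore
eliminates any block of variables on which the matrix is nonsingular, by the formula for Schur
complements (`eliminates_of_isUnit`). Finally, the formulas of thick grey spiders are computed
(`exists_den_thickGrey`); local complementation and pivoting are the blocks of size one and two.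
-/

/-! ### Arrows of the calculus -/

namespace ZX

section Quotient

/-- The setoid of equality of diagrams in `ZX`. -/
def eqvSetoid (K : Type u) [Field K] (A B : Type) : Setoid (Diag K A B) :=
  ⟨Eqv, ⟨Eqv.refl, Eqv.symm, Eqv.trans⟩⟩

/-- The arrows of `ZX`: diagrams modulo equality. -/
def Hom (K : Type u) [Field K] (A B : Type) : Type (max u 1) := Quotient (eqvSetoid K A B)

namespace Hom
variable {K : Type u} [Field K]

/-- The arrow represented by a diagram. -/
def mk {A B : Type} (f : Diag K A B) : Hom K A B := Quotient.mk (eqvSetoid K A B) f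

theorem mk_eq_mk {A B : Type} {f g : Diag K A B} : mk f = mk g ↔ Eqv f g :=
  ⟨fun h => Quotient.exact (s := eqvSetoid K A B) h,
    fun h => Quotient.sound (s := eqvSetoid K A B) h⟩

/-- Composition of arrows, in diagrammatic order. -/
def comp {A B C : Type} : Hom K A B → Hom K B C → Hom K A C :=
  Quotient.map₂ Diag.comp fun _ _ h _ _ h' => Eqv.comp_congr h h'

/-- Juxtaposition of arrows. -/
def tens {A B C D : Type} : Hom K A B → Hom K C D → Hom K (A ⊕ C) (B ⊕ D) :=
  Quotient.map₂ Diag.tensor fun _ _ h _ _ h' => Eqv.tensor_congr h h'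

/-- The arrow that relabels wires. -/
def wire {A B : Type} (e : A ≃ B) : Hom K A B := mk (Diag.wire e)

/-- The identity arrow. -/
def idh (A : Type) : Hom K A A := wire (Equiv.refl A)

/-- The grey spider as an arrow. -/
def grey (A B : Type) [Finite A] [Finite B] (a b : K) : Hom K A B := mk (Diag.grey A B a b)

/-- The white spider as an arrow. -/
def white (A B : Type) [Finite A] [Finite B] (a b : K) : Hom K A B := mk (Diag.white A B a b)

/-- The box as an arrow. -/
def box (c : K) : Hom K Unit Unit := mk (Diag.box c)

end Hom

infixr:80 " ⨾ " => Hom.comp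
infixr:85 " ⊠ " => Hom.tens

namespace Hom
variable {K : Type u} [Field K] {A B C D A' B' C' D' A'' B'' : Type}

theorem mk_comp (f : Diag K A B) (g : Diag K B C) : mk (f.comp g) = mk f ⨾ mk g := rfl
theorem mk_tensor (f : Diag K A B) (g : Diag K C D) : mk (f.tensor g) = mk f ⊠ mk g := rfl
theorem mk_wire (e : A ≃ B) : mk (K := K) (Diag.wire e) = wire e := rfl
theorem mk_idn : mk (K := K) (idn A) = idh A := rfl
theorem mk_grey [Finite A] [Finite B] (a b : K) : mk (Diag.grey A B a b) = grey A B a b := rfl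
theorem mk_box (c : K) : mk (Diag.box c) = box c := rfl

theorem ind {P : Hom K A B → Prop} (h : ∀ f, P (mk f)) (f : Hom K A B) : P f :=
  Quotient.ind h f

@[simp] theorem comp_assoc (f : Hom K A B) (g : Hom K B C) (h : Hom K C D) :
    (f ⨾ g) ⨾ h = f ⨾ g ⨾ h := by
  induction f using ind; induction g using ind; induction h using ind
  exact mk_eq_mk.2 (Eqv.comp_assoc _ _ _)

@[simp] theorem id_comp (f : Hom K A B) : idh A ⨾ f = f := by
  induction f using ind; exact mk_eq_mk.2 (Eqv.id_comp _)

@[simp] theorem comp_id (f : Hom K A B) : f ⨾ idh B = f := by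
  induction f using ind; exact mk_eq_mk.2 (Eqv.comp_id _)

@[simp] theorem wire_refl : wire (K := K) (Equiv.refl A) = idh A := rfl

@[simp] theorem wire_wire (e : A ≃ B) (e' : B ≃ C) :
    wire (K := K) e ⨾ wire e' = wire (e.trans e') :=
  mk_eq_mk.2 (Eqv.wire_comp _ _)

@[simp] theorem wire_wire_assoc (e : A ≃ B) (e' : B ≃ C) (f : Hom K C D) :
    wire e ⨾ wire e' ⨾ f = wire (e.trans e') ⨾ f := by
  rw [← comp_assoc, wire_wire]

@[simp] theorem wire_tens_wire (e : A ≃ B) (e' : C ≃ D) :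
    wire (K := K) e ⊠ wire e' = wire (Equiv.sumCongr e e') :=
  mk_eq_mk.2 (Eqv.wire_tensor _ _)

@[simp] theorem idh_tens_idh : idh (K := K) A ⊠ idh B = idh (A ⊕ B) := by
  unfold idh; rw [wire_tens_wire, Equiv.sumCongr_refl]

theorem comp_tens_comp (f : Hom K A B) (g : Hom K B C) (f' : Hom K A' B') (g' : Hom K B' C') :
    (f ⨾ g) ⊠ (f' ⨾ g') = (f ⊠ f') ⨾ (g ⊠ g') := by
  induction f using ind; induction g using ind; induction f' using ind; induction g' using ind
  exact mk_eq_mk.2 (Eqv.tensor_comp _ _ _ _)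

theorem tens_assoc_wire (f : Hom K A A') (g : Hom K B B') (h : Hom K C C') :
    ((f ⊠ g) ⊠ h) ⨾ wire (Equiv.sumAssoc A' B' C') =
      wire (Equiv.sumAssoc A B C) ⨾ (f ⊠ g ⊠ h) := by
  induction f using ind; induction g using ind; induction h using ind
  exact mk_eq_mk.2 (Eqv.tensor_assoc _ _ _)

theorem tens_unit_wire (f : Hom K A B) :
    (f ⊠ idh Empty) ⨾ wire (Equiv.sumEmpty B Empty) = wire (Equiv.sumEmpty A Empty) ⨾ f := by
  induction f using ind
  exact mk_eq_mk.2 (Eqv.tensor_unit _)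

theorem tens_symm_wire (f : Hom K A B) (g : Hom K C D) :
    (f ⊠ g) ⨾ wire (Equiv.sumComm B D) = wire (Equiv.sumComm A C) ⨾ (g ⊠ f) := by
  induction f using ind; induction g using ind
  exact mk_eq_mk.2 (Eqv.tensor_symm _ _)

theorem wire_congr {e e' : A ≃ B} (h : ∀ x, e x = e' x) : wire (K := K) e = wire e' :=
  congrArg _ (Equiv.ext h)

theorem wire_eq_id {e : A ≃ A} (h : ∀ x, e x = x) : wire (K := K) e = idh A :=
  wire_congr h

theorem comp_wire_inj {f g : Hom K A B} (e : B ≃ C) (h : f ⨾ wire e = g ⨾ wire e) : f = g := by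
  have := congrArg (· ⨾ wire e.symm) h
  simpa using this

theorem wire_comp_inj {f g : Hom K B C} (e : A ≃ B) (h : wire e ⨾ f = wire e ⨾ g) : f = g := by
  have := congrArg (wire e.symm ⨾ ·) h
  simpa using this

/-! ### Normal forms of shuffled juxtapositions -/

theorem tens_assoc (f : Hom K A A') (g : Hom K B B') (h : Hom K C C') :
    (f ⊠ g) ⊠ h =
      wire (Equiv.sumAssoc A B C) ⨾ (f ⊠ g ⊠ h) ⨾ wire (Equiv.sumAssoc A' B' C').symm := by
  rw [← comp_assoc, ← tens_assoc_wire]; simp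

theorem tens_comm (f : Hom K A B) (g : Hom K C D) :
    f ⊠ g = wire (Equiv.sumComm A C) ⨾ (g ⊠ f) ⨾ wire (Equiv.sumComm D B) := by
  rw [← comp_assoc, ← tens_symm_wire, comp_assoc, wire_wire, wire_eq_id, comp_id]
  rintro (x | x) <;> rfl

theorem tens_empty (f : Hom K A B) :
    f ⊠ idh Empty = wire (Equiv.sumEmpty A Empty) ⨾ f ⨾ wire (Equiv.sumEmpty B Empty).symm := by
  rw [← comp_assoc, ← tens_unit_wire]; simp

theorem empty_tens (f : Hom K A B) :
    idh Empty ⊠ f = wire (Equiv.emptySum Empty A) ⨾ f ⨾ wire (Equiv.emptySum Empty B).symm := by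
  rw [tens_comm, tens_empty]
  simp only [comp_assoc, wire_wire, wire_wire_assoc]
  congr 1

/-- Wires attached to the factors of a juxtaposition can be collected. -/
theorem tens_wires (a : A ≃ A') (f : Hom K A' B') (b : B' ≃ B) (c : C ≃ C') (g : Hom K C' D')
    (d : D' ≃ D) :
    (wire a ⨾ f ⨾ wire b) ⊠ (wire c ⨾ g ⨾ wire d) =
      wire (Equiv.sumCongr a c) ⨾ (f ⊠ g) ⨾ wire (Equiv.sumCongr b d) := by
  simp only [comp_tens_comp, wire_tens_wire]

theorem tens_wires_right (f : Hom K A B) (c : C ≃ C') (g : Hom K C' D') (d : D' ≃ D) :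
    f ⊠ (wire c ⨾ g ⨾ wire d) =
      wire (Equiv.sumCongr (Equiv.refl A) c) ⨾ (f ⊠ g) ⨾
        wire (Equiv.sumCongr (Equiv.refl B) d) := by
  rw [← tens_wires]; simp

theorem tens_wires_left (c : C ≃ C') (g : Hom K C' D') (d : D' ≃ D) (f : Hom K A B) :
    (wire c ⨾ g ⨾ wire d) ⊠ f =
      wire (Equiv.sumCongr c (Equiv.refl A)) ⨾ (g ⊠ f) ⨾
        wire (Equiv.sumCongr d (Equiv.refl B)) := by
  rw [← tens_wires]; simp

/-- The bijection that exchanges the first two of three summands. -/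
def sumLeftComm (A B C : Type) : A ⊕ B ⊕ C ≃ B ⊕ A ⊕ C :=
  (Equiv.sumAssoc A B C).symm.trans
    ((Equiv.sumCongr (Equiv.sumComm A B) (Equiv.refl C)).trans (Equiv.sumAssoc B A C))

@[simp] theorem sumLeftComm_inl (a : A) : sumLeftComm A B C (.inl a) = .inr (.inl a) := rfl
@[simp] theorem sumLeftComm_inr_inl (b : B) : sumLeftComm A B C (.inr (.inl b)) = .inl b := rfl
@[simp] theorem sumLeftComm_inr_inr (c : C) : sumLeftComm A B C (.inr (.inr c)) = .inr (.inr c) :=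
  rfl

theorem tens_left_comm (f : Hom K A A') (g : Hom K B B') (h : Hom K C C') :
    f ⊠ g ⊠ h = wire (sumLeftComm A B C) ⨾ (g ⊠ f ⊠ h) ⨾ wire (sumLeftComm B' A' C') := by
  have h1 : f ⊠ g ⊠ h = wire (Equiv.sumAssoc A B C).symm ⨾ ((f ⊠ g) ⊠ h) ⨾
      wire (Equiv.sumAssoc A' B' C') := by rw [tens_assoc_wire]; simp
  rw [h1, tens_comm f g, tens_wires_left, tens_assoc]
  simp only [comp_assoc, wire_wire, wire_wire_assoc]
  congr 1

theorem tens_tens_comm (f : Hom K A A') (g : Hom K B B') (h : Hom K C C') (k : Hom K D D') :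
    (f ⊠ g) ⊠ (h ⊠ k) = wire (Equiv.sumSumSumComm A B C D) ⨾ ((f ⊠ h) ⊠ (g ⊠ k)) ⨾
      wire (Equiv.sumSumSumComm A' C' B' D') := by
  rw [tens_assoc, tens_left_comm g h k, tens_wires_right, tens_assoc f h]
  simp only [comp_assoc, wire_wire, wire_wire_assoc]
  congr 1
  · apply wire_congr; rintro ((x | x) | (x | x)) <;> rfl
  · congr 1
    apply wire_congr; rintro (x | x | x | x) <;> rfl

theorem grey_wire [Finite A] [Finite B] [Finite A'] [Finite B'] (e : A' ≃ A) (e' : B ≃ B')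
    (a b : K) : wire e ⨾ grey A B a b ⨾ wire e' = grey A' B' a b :=
  mk_eq_mk.2 (Eqv.grey_wire e e' a b)

theorem white_wire [Finite A] [Finite B] [Finite A'] [Finite B'] (e : A' ≃ A) (e' : B ≃ B')
    (a b : K) : wire e ⨾ white A B a b ⨾ wire e' = white A' B' a b :=
  mk_eq_mk.2 (Eqv.white_wire e e' a b)

theorem grey_empty : grey Empty Empty (0 : K) 0 = idh Empty := mk_eq_mk.2 Eqv.one
theorem grey_unit : grey Unit Unit (0 : K) 0 = idh Unit := mk_eq_mk.2 Eqv.grey_id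

theorem grey_fusion [Finite A] [Finite B] [Finite C] [Finite D] [Finite A'] [Nonempty C]
    (a b c d : K) :
    (grey A (B ⊕ C) a b ⊠ idh D) ⨾ wire (Equiv.sumAssoc B C D) ⨾
      (idh B ⊠ grey (C ⊕ D) A' c d) = grey (A ⊕ D) (B ⊕ A') (a + c) (b + d) :=
  mk_eq_mk.2 (Eqv.grey_fusion a b c d)

/-- Fusion of a grey spider into the first leg of another one. -/
theorem grey_tens_comp_grey [Finite A] [Finite D] [Finite A'] (a b c d : K) :
    (grey A Unit a b ⊠ idh D) ⨾ grey (Unit ⊕ D) A' c d = grey (A ⊕ D) A' (a + c) (b + d) := by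
  have h := grey_fusion (A := A) (B := Empty) (C := Unit) (D := D) (A' := A') a b c d
  have h1 : grey A (Empty ⊕ Unit) a b =
      wire (Equiv.refl A) ⨾ grey A Unit a b ⨾ wire (Equiv.emptySum Empty Unit).symm :=
    (grey_wire _ _ _ _).symm
  have h2 := grey_wire (Equiv.refl (A ⊕ D)) (Equiv.emptySum Empty A') (a + c) (b + d)
  rw [← h2, ← h, h1, tens_wires_left, empty_tens]
  simp only [comp_assoc, wire_wire, wire_wire_assoc, wire_refl, id_comp]
  rw [show idh (K := K) D = wire (Equiv.refl D) from rfl]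
  simp only [Equiv.sumCongr_refl, wire_refl, id_comp]
  rw [← wire_wire_assoc]
  rw [wire_eq_id (e := (Equiv.emptySum Empty A').symm.trans _)]
  · simp only [comp_id]
    rw [wire_wire_assoc, wire_eq_id, id_comp]
    rintro (x | x) <;> rfl
  · intro x; rfl

end Hom
end Quotient
/-! ### Grey spiders along cospans -/

section GreyCospans
namespace Hom
variable {K : Type u} [Field K] {A B C D A' B' C' D' A'' B'' : Type}

/-- A bijection of sums that respects the summands is a sum of bijections. -/
theorem exists_eq_sumCongr {A V B U : Type} (e : A ⊕ V ≃ B ⊕ U)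
    (hl : ∀ a, ∃ b, e (.inl a) = .inl b) (hr : ∀ v, ∃ u, e (.inr v) = .inr u) :
    ∃ (e₁ : A ≃ B) (e₂ : V ≃ U), e = Equiv.sumCongr e₁ e₂ := by
  choose f hf using hl
  choose g hg using hr
  have hfb : Function.Bijective f := by
    refine ⟨fun a a' h => ?_, fun b => ?_⟩
    · have : e (.inl a) = e (.inl a') := by rw [hf, hf, h]
      simpa using this
    · obtain ⟨x | x, hx⟩ := e.surjective (.inl b)
      · exact ⟨x, by simpa [hf] using hx⟩
      · simp [hg] at hx
  have hgb : Function.Bijective g := by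
    refine ⟨fun a a' h => ?_, fun b => ?_⟩
    · have : e (.inr a) = e (.inr a') := by rw [hg, hg, h]
      simpa using this
    · obtain ⟨x | x, hx⟩ := e.surjective (.inr b)
      · simp [hf] at hx
      · exact ⟨x, by simpa [hg] using hx⟩
  refine ⟨Equiv.ofBijective f hfb, Equiv.ofBijective g hgb, Equiv.ext ?_⟩
  rintro (x | x) <;> simp [hf, hg]

/-- `IsN φ ψ D` says that `D` juxtaposes, for the points `w` of `W` in some order, phase-free grey
spiders whose inputs are the fibre of `φ` and whose outputs are the fibre of `ψ` over `w`. -/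
inductive IsN : ∀ {V V' W : Type}, (V → W) → (V' → W) → Hom K V V' → Prop
  | nil {V V' W : Type} [IsEmpty V] [IsEmpty V'] [IsEmpty W] (φ : V → W) (ψ : V' → W) :
      IsN φ ψ (wire (Equiv.equivOfIsEmpty V V'))
  | cons {A A' V V' W V₁ V₁' W₁ : Type} [Finite A] [Finite A'] {φ : V → W} {ψ : V' → W}
      {D : Hom K V V'} (h : IsN φ ψ D) (eV : A ⊕ V ≃ V₁) (eV' : A' ⊕ V' ≃ V₁')
      (eW : Unit ⊕ W ≃ W₁) {φ₁ : V₁ → W₁} {ψ₁ : V₁' → W₁}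
      (hφ : ∀ x, φ₁ (eV x) = eW (Sum.map (fun _ => ()) φ x))
      (hψ : ∀ x, ψ₁ (eV' x) = eW (Sum.map (fun _ => ()) ψ x)) :
      IsN φ₁ ψ₁ (wire eV.symm ⨾ (grey A A' 0 0 ⊠ D) ⨾ wire eV')

theorem IsN.relabel {V V' W V₁ V₁' W₁ : Type} {φ : V → W} {ψ : V' → W} {D : Hom K V V'}
    (h : IsN φ ψ D) (e : V₁ ≃ V) (e' : V' ≃ V₁') (σ : W ≃ W₁) {φ₁ : V₁ → W₁} {ψ₁ : V₁' → W₁}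
    (hφ : ∀ x, φ₁ x = σ (φ (e x))) (hψ : ∀ x, ψ₁ (e' x) = σ (ψ x)) :
    IsN φ₁ ψ₁ (wire e ⨾ D ⨾ wire e') := by
  cases h with
  | nil =>
    have := e.isEmpty; have := e'.symm.isEmpty; have := σ.symm.isEmpty
    have h2 : wire (K := K) e ⨾ wire (Equiv.equivOfIsEmpty V V') ⨾ wire e' =
        wire (Equiv.equivOfIsEmpty V₁ V₁') := by
      simp only [wire_wire]; exact wire_congr fun x => isEmptyElim x
    rw [h2]; exact .nil _ _
  | cons h eV eV' eW h1 h2 =>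
    have := IsN.cons h (eV.trans e.symm) (eV'.trans e') (eW.trans σ) (φ₁ := φ₁) (ψ₁ := ψ₁)
      (fun x => by rw [hφ]; simp [h1]) (fun x => by simp [hψ, h2])
    convert this using 1
    simp only [comp_assoc, wire_wire, wire_wire_assoc]
    rfl

/-- Any point can be put first in a juxtaposition of spiders. -/
theorem IsN.extract {V₁ V₁' W₁ : Type} {φ₁ : V₁ → W₁} {ψ₁ : V₁' → W₁} {D₁ : Hom K V₁ V₁'}
    (h : IsN φ₁ ψ₁ D₁) (w : W₁) :
    ∃ (A A' V V' W : Type) (_ : Finite A) (_ : Finite A') (φ : V → W) (ψ : V' → W)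
      (D : Hom K V V') (eV : A ⊕ V ≃ V₁) (eV' : A' ⊕ V' ≃ V₁') (eW : Unit ⊕ W ≃ W₁),
      IsN φ ψ D ∧ (∀ x, φ₁ (eV x) = eW (Sum.map (fun _ => ()) φ x)) ∧
      (∀ x, ψ₁ (eV' x) = eW (Sum.map (fun _ => ()) ψ x)) ∧ eW (.inl ()) = w ∧
      D₁ = wire eV.symm ⨾ (grey A A' 0 0 ⊠ D) ⨾ wire eV' := by
  induction h with
  | nil => exact isEmptyElim w
  | @cons A A' V V' W V₁ V₁' W₁ _ _ φ ψ D h eV eV' eW φ₁ ψ₁ hφ hψ ih =>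
    obtain ⟨u | w', hw⟩ := eW.surjective w
    · exact ⟨A, A', V, V', W, ‹_›, ‹_›, φ, ψ, D, eV, eV', eW, h, hφ, hψ, hw, rfl⟩
    · obtain ⟨B, B', U, U', X, _, _, φ₂, ψ₂, E, eU, eU', eX, h2, hφ₂, hψ₂, hw', rfl⟩ := ih w'
      refine ⟨B, B', A ⊕ U, A' ⊕ U', Unit ⊕ X, ‹_›, ‹_›, Sum.map (fun _ => ()) φ₂,
        Sum.map (fun _ => ()) ψ₂, wire (Equiv.refl _) ⨾ (grey A A' 0 0 ⊠ E) ⨾ wire (Equiv.refl _),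
        (sumLeftComm B A U).trans ((Equiv.sumCongr (Equiv.refl A) eU).trans eV),
        (sumLeftComm B' A' U').trans ((Equiv.sumCongr (Equiv.refl A') eU').trans eV'),
        (sumLeftComm Unit Unit X).trans ((Equiv.sumCongr (Equiv.refl _) eX).trans eW),
        IsN.cons h2 (Equiv.refl _) (Equiv.refl _) (Equiv.refl _) (fun _ => rfl) (fun _ => rfl),
        ?_, ?_, ?_, ?_⟩
      · rintro (x | x | x) <;> simp [hφ, hφ₂]
      · rintro (x | x | x) <;> simp [hψ, hψ₂]
      · simp [hw', hw]
      · rw [tens_wires_right, tens_left_comm]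
        simp only [comp_assoc, wire_wire, wire_wire_assoc, wire_refl, id_comp, comp_id]
        congr 1

/-- The order of the spiders is irrelevant. -/
theorem IsN.unique {V V' W : Type} {φ : V → W} {ψ : V' → W} {D E : Hom K V V'}
    (h : IsN φ ψ D) (h' : IsN φ ψ E) : D = E := by
  induction h with
  | nil =>
    cases h' with
    | nil => rfl
    | cons h eV eV' eW => exact isEmptyElim (eW (.inl ()))
  | @cons A A' V V' W V₁ V₁' W₁ _ _ φ ψ D h eV eV' eW φ₁ ψ₁ hφ hψ ih =>
    obtain ⟨B, B', U, U', X, _, _, φ₂, ψ₂, F, eU, eU', eX, h2, hφ₂, hψ₂, hw, rfl⟩ :=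
      h'.extract (eW (.inl ()))
    have key : ∀ {A V V₁ B U : Type} (eV : A ⊕ V ≃ V₁) (eU : B ⊕ U ≃ V₁) (φ : V → W) (φ₂ : U → X)
        (φ₁ : V₁ → W₁) (_ : ∀ x, φ₁ (eV x) = eW (Sum.map (fun _ => ()) φ x))
        (_ : ∀ x, φ₁ (eU x) = eX (Sum.map (fun _ => ()) φ₂ x)),
        ∃ (e₁ : A ≃ B) (e₂ : V ≃ U), eV.trans eU.symm = Equiv.sumCongr e₁ e₂ := by
      intro A V V₁ B U eV eU φ φ₂ φ₁ hφ hφ₂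
      apply exists_eq_sumCongr
      · intro a
        rcases hb : eU.symm (eV (.inl a)) with b | u
        · exact ⟨b, hb⟩
        · have h3 := hφ₂ (.inr u)
          rw [← hb, Equiv.apply_symm_apply, hφ] at h3
          simp only [Sum.map_inl, ← hw] at h3
          simpa [hb] using eX.injective h3
      · intro a
        rcases hb : eU.symm (eV (.inr a)) with b | u
        · have h3 := hφ₂ (.inl b)
          rw [← hb, Equiv.apply_symm_apply, hφ] at h3
          simp only [hb, Sum.map_inl, hw] at h3
          simpa using eW.injective h3
        · exact ⟨u, hb⟩
    obtain ⟨a, v, hv⟩ := key eV eU φ φ₂ φ₁ hφ hφ₂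
    obtain ⟨a', v', hv'⟩ := key eV' eU' ψ ψ₂ ψ₁ hψ hψ₂
    obtain ⟨u₀, x, hx⟩ := exists_eq_sumCongr (eW.trans eX.symm)
      (fun _ => ⟨(), by simp [← hw]⟩) (fun y => by
        rcases hb : eX.symm (eW (.inr y)) with b | u
        · have := (Equiv.symm_apply_eq _).1 hb
          rw [hw] at this
          simpa using eW.injective this
        · exact ⟨u, hb⟩)
    have c : ∀ y, eW y = eX (Sum.map id x y) := by
      intro y
      have := congrArg (fun f => eX (f y)) hx
      rcases y with y | y <;> simpa using this
    have cV : ∀ y, eV y = eU (Sum.map a v y) := by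
      intro y; simpa using congrArg (fun f => eU (f y)) hv
    have cV' : ∀ y, eV' y = eU' (Sum.map a' v' y) := by
      intro y; simpa using congrArg (fun f => eU' (f y)) hv'
    have hF := ih (h2.relabel v v'.symm x.symm (φ₁ := φ) (ψ₁ := ψ)
      (fun y => by
        have h3 := hφ (.inr y)
        rw [cV] at h3
        simp only [Sum.map_inr] at h3
        rw [hφ₂, c] at h3
        have := eX.injective h3
        simp only [Sum.map_inr, Sum.inr.injEq] at this
        rw [this]; simp)
      (fun y => by
        have h3 := hψ (.inr (v'.symm y))
        rw [cV'] at h3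
        simp only [Sum.map_inr, Equiv.apply_symm_apply] at h3
        rw [hψ₂, c] at h3
        have := eX.injective h3
        simp only [Sum.map_inr, Sum.inr.injEq] at this
        rw [this]; simp))
    rw [hF, ← grey_wire a a'.symm, tens_wires]
    simp only [comp_assoc, wire_wire, wire_wire_assoc]
    congr 1
    · apply wire_congr; intro y
      obtain ⟨z, rfl⟩ := eV.surjective y
      simpa using (congrArg (fun f => f z) hv).symm
    · congr 1
      apply wire_congr; intro y
      simp only [Equiv.trans_apply]
      rw [cV']
      rcases y with y | y <;> simp

theorem IsN.tens {V V' W U U' X : Type} {φ : V → W} {ψ : V' → W} {D : Hom K V V'}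
    {φ₂ : U → X} {ψ₂ : U' → X} {E : Hom K U U'}
    (h : IsN φ ψ D) (h' : IsN φ₂ ψ₂ E) : IsN (Sum.map φ φ₂) (Sum.map ψ ψ₂) (D ⊠ E) := by
  induction h with
  | @nil V V' W =>
    have h1 : wire (Equiv.equivOfIsEmpty V V') ⊠ E =
        wire (Equiv.emptySum V U) ⨾ E ⨾ wire (Equiv.emptySum V' U').symm := by
      have : wire (K := K) (Equiv.equivOfIsEmpty V V') = wire (Equiv.equivOfIsEmpty V Empty) ⨾
          idh Empty ⨾ wire (Equiv.equivOfIsEmpty Empty V') := by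
        simp only [id_comp, wire_wire]; exact wire_congr fun x => isEmptyElim x
      rw [this, tens_wires_left, empty_tens]
      simp only [comp_assoc, wire_wire, wire_wire_assoc]
      congr 1
      · apply wire_congr; rintro (x | x)
        · exact isEmptyElim x
        · rfl
      · congr 1
        apply wire_congr; intro x; rfl
    rw [h1]
    refine h'.relabel _ _ (Equiv.emptySum W X).symm ?_ ?_
    · rintro (x | x)
      · exact isEmptyElim x
      · rfl
    · intro x; rfl
  | @cons A A' V V' W V₁ V₁' W₁ _ _ φ ψ D h eV eV' eW φ₁ ψ₁ hφ hψ ih =>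
    rw [tens_wires_left, Hom.tens_assoc]
    simp only [comp_assoc, wire_wire, wire_wire_assoc]
    have := IsN.cons (A := A) (A' := A') ih
      ((Equiv.sumAssoc A V U).symm.trans (Equiv.sumCongr eV (Equiv.refl U)))
      ((Equiv.sumAssoc A' V' U').symm.trans (Equiv.sumCongr eV' (Equiv.refl U')))
      ((Equiv.sumAssoc Unit W X).symm.trans (Equiv.sumCongr eW (Equiv.refl X)))
      (φ₁ := Sum.map φ₁ φ₂) (ψ₁ := Sum.map ψ₁ ψ₂)
      (by rintro (x | x | x) <;> simp [hφ]) (by rintro (x | x | x) <;> simp [hψ])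
    exact this

theorem IsN.spider (A A' : Type) [Finite A] [Finite A'] :
    IsN (fun _ : A => ()) (fun _ : A' => ()) (grey A A' (0 : K) 0) := by
  have := IsN.cons (A := A) (A' := A') (IsN.nil (K := K) (V := Empty) (V' := Empty) (W := Empty)
    id id) (Equiv.sumEmpty A Empty) (Equiv.sumEmpty A' Empty) (Equiv.sumEmpty Unit Empty)
    (φ₁ := fun _ => ()) (ψ₁ := fun _ => ()) (fun _ => rfl) (fun _ => rfl)
  convert this using 1
  rw [wire_eq_id (fun x => x.elim), tens_empty]
  simp only [comp_assoc, wire_wire, wire_wire_assoc]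
  simp

theorem IsN.exists {W : Type} [Finite W] : ∀ {V V' : Type} [Finite V] [Finite V']
    (φ : V → W) (ψ : V' → W), ∃ D : Hom K V V', IsN φ ψ D := by
  refine Finite.induction_empty_option (P := fun W => ∀ {V V' : Type} [Finite V] [Finite V']
    (φ : V → W) (ψ : V' → W), ∃ D : Hom K V V', IsN φ ψ D) ?_ ?_ ?_ W
  · intro W W₁ e h V V' _ _ φ ψ
    obtain ⟨D, hD⟩ := h (e.symm ∘ φ) (e.symm ∘ ψ)
    exact ⟨_, hD.relabel (Equiv.refl _) (Equiv.refl _) e (by simp) (by simp)⟩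
  · intro V V' _ _ φ ψ
    have := φ.isEmpty; have := ψ.isEmpty
    have : IsEmpty PEmpty := inferInstance
    exact ⟨_, .nil φ ψ⟩
  · intro W _ h V V' _ _ φ ψ
    classical
    have key : ∀ {V : Type} (φ : V → Option W), ∃ (φ' : {v // ¬ φ v = none} → W),
        ∀ x, φ (Equiv.sumCompl (fun v => φ v = none) x) =
          ((Equiv.optionEquivSumPUnit W).trans (Equiv.sumComm _ _)).symm
            (Sum.map (fun _ => ()) φ' x) := by
      intro V φ
      refine ⟨fun v => (φ v).get (Option.isSome_iff_ne_none.2 v.2), ?_⟩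
      rintro (x | x)
      · simpa using x.2
      · simp
    obtain ⟨φ', hφ⟩ := key φ
    obtain ⟨ψ', hψ⟩ := key ψ
    obtain ⟨D, hD⟩ := h φ' ψ'
    exact ⟨_, .cons hD _ _ _ hφ hψ⟩

/-- The phase-free grey diagram of a cospan `V → W ← V'` of finite types: one grey spider for each
point of `W`, with the fibres over it as legs. -/
noncomputable def N {V V' W : Type} [Finite V] [Finite V'] [Finite W] (φ : V → W)
    (ψ : V' → W) : Hom K V V' :=
  (IsN.exists φ ψ).choose

variable {V V' W U U' X V₁ V₁' W₁ : Type} [Finite V] [Finite V'] [Finite W] [Finite U] [Finite U']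
  [Finite X] [Finite V₁] [Finite V₁'] [Finite W₁]

theorem isN_N (φ : V → W) (ψ : V' → W) : IsN φ ψ (N (K := K) φ ψ) := (IsN.exists φ ψ).choose_spec

theorem IsN.eq_N {φ : V → W} {ψ : V' → W} {D : Hom K V V'} (h : IsN φ ψ D) : D = N φ ψ :=
  h.unique (isN_N φ ψ)

theorem N_relabel (φ : V → W) (ψ : V' → W) (e : V₁ ≃ V) (e' : V' ≃ V₁') (σ : W ≃ W₁)
    (φ₁ : V₁ → W₁) (ψ₁ : V₁' → W₁) (hφ : ∀ x, φ₁ x = σ (φ (e x)))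
    (hψ : ∀ x, ψ₁ (e' x) = σ (ψ x)) :
    wire (K := K) e ⨾ N φ ψ ⨾ wire e' = N φ₁ ψ₁ :=
  ((isN_N φ ψ).relabel e e' σ hφ hψ).eq_N

theorem N_tens (φ : V → W) (ψ : V' → W) (φ₂ : U → X) (ψ₂ : U' → X) :
    N (K := K) φ ψ ⊠ N φ₂ ψ₂ = N (Sum.map φ φ₂) (Sum.map ψ ψ₂) :=
  ((isN_N φ ψ).tens (isN_N φ₂ ψ₂)).eq_N

theorem grey_eq_N : grey V V' (0 : K) 0 = N (fun _ => ()) (fun _ => ()) :=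
  (IsN.spider V V').eq_N

theorem N_id_id : N (K := K) (id : V → V) id = idh V := by
  refine Finite.induction_empty_option
    (P := fun V => ∀ [Finite V], N (K := K) (id : V → V) id = idh V) ?_ ?_ ?_ V
  · intro V W e h _
    have := Finite.of_equiv _ e.symm
    rw [← N_relabel id id e.symm e e id id (by simp) (by simp), h]
    simp
  · intro _
    exact ((IsN.nil (K := K) (V := PEmpty) (V' := PEmpty) (W := PEmpty) id id).eq_N.symm).trans
      (wire_eq_id fun x => x.elim)
  · intro V _ h _
    have e := (Equiv.optionEquivSumPUnit.{0, 0} V).symm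
    rw [← N_relabel (Sum.map id id) (Sum.map id id) e.symm e e id id (by simp) (by simp),
      ← N_tens, h]
    have : N (K := K) (id : Unit → Unit) id = idh Unit := by
      rw [← grey_unit, grey_eq_N]
    rw [this]
    simp

theorem wire_eq_N (e : V ≃ W) : wire (K := K) e = N e id := by
  rw [← N_relabel id id e (Equiv.refl W) (Equiv.refl W) e id (by simp) (by simp), N_id_id]
  simp

end Hom
end GreyCospans
/-! ### Composition of grey spiders, and formulas -/

section GreyComposition
namespace Hom
variable {K : Type u} [Field K] {V V' W U U' X V₁ V₁' W₁ : Type}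

theorem wire_comp_grey [Finite V] [Finite W] [Finite V'] (e : V ≃ W) (a b : K) :
    wire e ⨾ grey W V' a b = grey V V' a b := by
  simpa using grey_wire e (Equiv.refl V') a b

theorem grey_comp_wire [Finite V] [Finite W] [Finite V'] (e : V ≃ W) (a b : K) :
    grey V' V a b ⨾ wire e = grey V' W a b := by
  simpa using grey_wire (Equiv.refl V') e a b

theorem white_comp_wire [Finite V] [Finite W] [Finite V'] (e : V ≃ W) (a b : K) :
    white V' V a b ⨾ wire e = white V' W a b := by
  simpa using white_wire (Equiv.refl V') e a b

/-- The domain of a map to a sum is the sum of the fibres over the summands. -/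
theorem exists_fibres {V A A₁ A₂ : Type} [Finite V] (φ : V → A) (e : A₁ ⊕ A₂ ≃ A) :
    ∃ (V₁ V₂ : Type) (_ : Finite V₁) (_ : Finite V₂) (eV : V₁ ⊕ V₂ ≃ V) (φ₁ : V₁ → A₁)
      (φ₂ : V₂ → A₂), ∀ x, φ (eV x) = e (Sum.map φ₁ φ₂ x) := by
  classical
  refine ⟨{v // (e.symm (φ v)).isLeft}, {v // ¬ (e.symm (φ v)).isLeft}, inferInstance,
    inferInstance, Equiv.sumCompl _, fun v => (e.symm (φ v)).getLeft v.2,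
    fun v => (e.symm (φ v)).getRight (by simpa using v.2), ?_⟩
  rintro (x | x) <;> simp

theorem N_split [Finite V] [Finite U] [Finite U'] [Finite W] [Finite V₁] {V₂ : Type}
    [Finite V₂] {φ : V → W}
    (eV : V₁ ⊕ V₂ ≃ V) (e : U ⊕ U' ≃ W) (φ₁ : V₁ → U) (φ₂ : V₂ → U')
    (h : ∀ x, φ (eV x) = e (Sum.map φ₁ φ₂ x)) :
    N (K := K) φ id = wire eV.symm ⨾ (N φ₁ id ⊠ N φ₂ id) ⨾ wire e := by
  rw [N_tens]
  refine (N_relabel _ _ eV.symm e e φ id ?_ ?_).symm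
  · intro x; rw [← h]; simp
  · intro x; simp

/-- Phase-free grey spiders in front of the legs of a grey spider fuse with it. -/
theorem N_comp_grey {A : Type} [Finite A] : ∀ {C V A' : Type} [Finite C] [Finite V] [Finite A']
    (φ : V → A) (a b : K),
    (idh C ⊠ N φ id) ⨾ grey (C ⊕ A) A' a b = grey (C ⊕ V) A' a b := by
  refine Finite.induction_empty_option (P := fun A => ∀ [Finite A] {C V A' : Type} [Finite C]
    [Finite V] [Finite A'] (φ : V → A) (a b : K),
    (idh C ⊠ N φ id) ⨾ grey (C ⊕ A) A' a b = grey (C ⊕ V) A' a b) ?_ ?_ ?_ A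
  · intro A A₁ e h _ C V A' _ _ _ φ a b
    have := Finite.of_equiv _ e.symm
    rw [← N_relabel (e.symm ∘ φ) id (Equiv.refl V) e e φ id (by simp) (by simp),
      tens_wires_right, comp_assoc, comp_assoc, wire_comp_grey, h, wire_comp_grey]
  · intro _ C V A' _ _ _ φ a b
    have := φ.isEmpty
    have h : N (K := K) φ id = wire (Equiv.equivOfIsEmpty V PEmpty) := (IsN.nil _ _).eq_N.symm
    rw [h, show idh (K := K) C = wire (Equiv.refl C) from rfl, wire_tens_wire, wire_comp_grey]
  · intro A _ h _ C V A' _ _ _ φ a b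
    obtain ⟨V₁, V₂, _, _, eV, φ₁, φ₂, hφ⟩ := exists_fibres φ
      ((Equiv.sumComm Unit A).trans (Equiv.optionEquivSumPUnit.{0, 0} A).symm)
    have hN := N_split (K := K) eV _ φ₁ φ₂ hφ
    rw [hN, tens_wires_right, comp_assoc, comp_assoc, wire_comp_grey]
    have h1 : N (K := K) φ₁ id = grey V₁ Unit 0 0 := grey_eq_N.symm
    have h2 : idh (K := K) C ⊠ grey V₁ Unit 0 0 ⊠ N φ₂ id =
        wire (Equiv.sumAssoc C V₁ V₂).symm ⨾ ((idh C ⊠ grey V₁ Unit 0 0) ⊠ idh V₂) ⨾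
          (idh (C ⊕ Unit) ⊠ N φ₂ id) ⨾ wire (Equiv.sumAssoc C Unit A) := by
      rw [← comp_assoc (_ ⊠ _), ← comp_tens_comp, comp_id, id_comp, tens_assoc]
      simp only [comp_assoc, wire_wire, wire_wire_assoc]
      simp
    have h3 : (idh C ⊠ grey V₁ Unit (0 : K) 0) ⊠ idh V₂ =
        wire ((Equiv.sumAssoc C V₁ V₂).trans (sumLeftComm C V₁ V₂)) ⨾
          (grey V₁ Unit 0 0 ⊠ idh (C ⊕ V₂)) ⨾
          wire ((sumLeftComm Unit C V₂).trans (Equiv.sumAssoc C Unit V₂).symm) := by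
      rw [tens_assoc, tens_left_comm]
      simp only [comp_assoc, wire_wire, wire_wire_assoc, idh_tens_idh]
    rw [h1, h2]
    simp only [comp_assoc]
    rw [wire_comp_grey, h, h3]
    simp only [comp_assoc]
    rw [wire_comp_grey, grey_tens_comp_grey, wire_comp_grey, wire_comp_grey, wire_comp_grey]
    simp

theorem IsN.comp {W U V' : Type} {κ : W → U} {ψ : V' → U} {D : Hom K W V'} (h : IsN κ ψ D) :
    ∀ {V : Type} [Finite V] [Finite W] (φ : V → W), IsN (κ ∘ φ) ψ (N φ id ⨾ D) := by
  induction h with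
  | @nil W V' U _ _ _ κ ψ =>
    intro V _ _ φ
    have := φ.isEmpty
    have h1 : N (K := K) φ id = wire (Equiv.equivOfIsEmpty V W) := (IsN.nil _ _).eq_N.symm
    rw [h1, wire_wire, wire_congr (e' := Equiv.equivOfIsEmpty V V') fun x => isEmptyElim x]
    exact .nil _ _
  | @cons A A' W V' U W₁ V₁' U₁ _ _ κ ψ D h eW eV' eU κ₁ ψ₁ hκ hψ ih =>
    intro V _ _ φ
    have := Finite.of_injective (fun x => eW (.inr x))
      (eW.injective.comp Sum.inr_injective)
    obtain ⟨V₁, V₂, _, _, eV, φ₁, φ₂, hφ⟩ := exists_fibres φ eW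
    have hN := N_split (K := K) eV _ φ₁ φ₂ hφ
    rw [hN]
    simp only [comp_assoc, wire_wire_assoc]
    rw [wire_eq_id (e := eW.trans eW.symm) (by simp), id_comp, ← comp_assoc (_ ⊠ _),
      ← comp_tens_comp]
    have h1 : N φ₁ id ⨾ grey A A' (0 : K) 0 = grey V₁ A' 0 0 := by
      have := N_comp_grey (C := Empty) (A' := A') φ₁ (0 : K) 0
      rw [empty_tens, comp_assoc, comp_assoc, wire_comp_grey] at this
      apply wire_comp_inj (Equiv.emptySum Empty V₁)
      rw [this, wire_comp_grey]
    rw [h1]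
    refine .cons (ih φ₂) eV eV' eU ?_ hψ
    intro x
    rw [Function.comp_apply, hφ, hκ]
    rcases x with x | x <;> rfl

variable [Finite V] [Finite V'] [Finite W] [Finite U] [Finite U'] [Finite X] [Finite V₁]
  [Finite V₁'] [Finite W₁]

/-- Grey cospans compose by fusion: spiders with a single output merge with the spider behind. -/
theorem N_comp (φ : V → W) (κ : W → U) (ψ : V' → U) :
    N (K := K) φ id ⨾ N κ ψ = N (κ ∘ φ) ψ :=
  ((isN_N κ ψ).comp φ).eq_N

end Hom
end GreyComposition

section States
variable {K : Type u} [Field K] {V W U X A B C D : Type}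

open Hom

/-- The states with wires `V`, to be thought of as formulas in variables `V`. -/
abbrev T (K : Type u) [Field K] (V : Type) : Type (max u 1) := Hom K Empty V

namespace T

theorem wire_from_empty (e e' : Empty ≃ V) : wire (K := K) e = wire e' :=
  wire_congr fun x => x.elim

theorem wire_empty (e : Empty ≃ Empty) : wire (K := K) e = idh Empty :=
  wire_from_empty _ _

/-- The juxtaposition of two states. -/
def out (f : T K V) (g : T K W) : T K (V ⊕ W) :=
  wire (Equiv.sumEmpty Empty Empty).symm ⨾ (f ⊠ g)

theorem out_comp_tens (f : T K V) (g : T K W) (F : Hom K V A) (G : Hom K W B) :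
    out f g ⨾ (F ⊠ G) = out (f ⨾ F) (g ⨾ G) := by
  simp [out, comp_tens_comp]

theorem out_comm (f : T K V) (g : T K W) : out f g ⨾ wire (Equiv.sumComm V W) = out g f := by
  rw [out, comp_assoc, tens_symm_wire, out, wire_wire_assoc]
  congr 1
  exact wire_from_empty _ _

theorem out_assoc (f : T K V) (g : T K W) (h : T K U) :
    out (out f g) h ⨾ wire (Equiv.sumAssoc V W U) = out f (out g h) := by
  have h1 : out (out f g) h = wire (Equiv.sumEmpty Empty Empty).symm ⨾
      (wire (Equiv.sumEmpty Empty Empty).symm ⊠ idh Empty) ⨾ ((f ⊠ g) ⊠ h) := by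
    rw [← comp_tens_comp, id_comp]; rfl
  have h2 : out f (out g h) = wire (Equiv.sumEmpty Empty Empty).symm ⨾
      (idh Empty ⊠ wire (Equiv.sumEmpty Empty Empty).symm) ⨾ (f ⊠ g ⊠ h) := by
    rw [← comp_tens_comp, id_comp]; rfl
  rw [h1, h2, ← wire_refl, wire_tens_wire, wire_tens_wire]
  simp only [comp_assoc, tens_assoc_wire, wire_wire_assoc]
  congr 1
  exact wire_from_empty _ _

theorem out_empty (f : T K V) : out f (idh Empty) ⨾ wire (Equiv.sumEmpty V Empty) = f := by
  rw [out, comp_assoc, tens_unit_wire, wire_wire_assoc, wire_empty, id_comp]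

variable [Finite V] [Finite W] [Finite U] [Finite X] [Finite A] [Finite B] [Finite C] [Finite D]

/-- Renaming of variables, by grey spiders: distinct variables may become equal. -/
noncomputable def map (φ : V → W) (f : T K V) : T K W := f ⨾ N φ id

theorem map_eq_wire (e : V ≃ W) (f : T K V) : map e f = f ⨾ wire e := by
  rw [map, wire_eq_N]

@[simp] theorem map_map (ψ : W → U) (φ : V → W) (f : T K V) :
    map ψ (map φ f) = map (ψ ∘ φ) f := by
  simp [map, N_comp]

@[simp] theorem map_id (f : T K V) : map id f = f := by
  rw [map, N_id_id, comp_id]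

theorem out_map (φ : V → A) (ψ : W → B) (f : T K V) (g : T K W) :
    out (map φ f) (map ψ g) = map (Sum.map φ ψ) (out f g) := by
  rw [map, map, ← out_comp_tens, N_tens, Sum.map_id_id]; rfl

theorem map_out_comm (f : T K V) (g : T K W) : map Sum.swap (out f g) = out g f :=
  (map_eq_wire (Equiv.sumComm V W) _).trans (out_comm f g)

theorem map_out_assoc (f : T K V) (g : T K W) (h : T K U) :
    map (Equiv.sumAssoc V W U) (out (out f g) h) = out f (out g h) := by
  rw [← out_assoc, ← map_eq_wire]

/-- The empty conjunction: a grey unit on each wire. -/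
noncomputable instance : One (T K V) := ⟨N (Empty.elim : Empty → V) id⟩

/-- The conjunction of formulas: wires of the same name are joined by grey spiders. -/
noncomputable instance : Mul (T K V) := ⟨fun f g => map (Sum.elim id id) (out f g)⟩

theorem one_def : (1 : T K V) = N (Empty.elim : Empty → V) id := rfl
theorem mul_def (f g : T K V) : f * g = map (Sum.elim id id) (out f g) := rfl

@[simp] theorem map_one (φ : V → W) : map φ (1 : T K V) = 1 := by
  rw [one_def, map, N_comp, one_def]
  congr 1
  funext x; exact x.elim

@[simp] theorem map_mul (φ : V → W) (f g : T K V) : map φ (f * g) = map φ f * map φ g := by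
  rw [mul_def, mul_def, out_map, map_map, map_map]
  congr 1
  funext x; rcases x with x | x <;> rfl

theorem mul_one' (f : T K V) : f * 1 = f := by
  have h : (1 : T K V) = map Empty.elim (idh Empty : T K Empty) := by
    rw [map, id_comp, one_def]
  have h2 : map (Equiv.sumEmpty V Empty) (out f (idh Empty)) = f := by
    rw [map_eq_wire, out_empty]
  rw [h, mul_def]
  nth_rw 1 [← map_id f]
  rw [out_map, map_map]
  conv_rhs => rw [← h2]
  congr 1
  funext x
  rcases x with x | x
  · rfl
  · exact x.elim

theorem mul_comm' (f g : T K V) : f * g = g * f := by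
  rw [mul_def, mul_def, ← map_out_comm g f, map_map]
  congr 1
  funext x; rcases x with x | x <;> rfl

theorem mul_assoc' (f g h : T K V) : f * g * h = f * (g * h) := by
  rw [mul_def, mul_def, mul_def, mul_def]
  nth_rw 1 [← map_id h]
  nth_rw 2 [← map_id f]
  rw [out_map, out_map, map_map, map_map, ← map_out_assoc, map_map]
  congr 1
  funext x; rcases x with (x | x) | x <;> rfl

noncomputable instance : CommMonoid (T K V) where
  mul_assoc := mul_assoc'
  one_mul f := by rw [mul_comm', mul_one']
  mul_one := mul_one'
  mul_comm := mul_comm'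

theorem map_inl_mul_map_inr (f : T K V) (g : T K W) :
    map Sum.inl f * map Sum.inr g = out f g := by
  rw [mul_def, out_map, map_map]
  conv_rhs => rw [← map_id (out f g)]
  congr 1
  funext x; rcases x with x | x <;> rfl

theorem map_prod {ι : Type} (φ : V → W) (s : Finset ι) (f : ι → T K V) :
    map φ (∏ i ∈ s, f i) = ∏ i ∈ s, map φ (f i) := by
  classical
  induction s using Finset.induction_on with
  | empty => simp
  | insert i s hi ih => rw [Finset.prod_insert hi, Finset.prod_insert hi, map_mul, ih]

end T
end States
/-! ### Quantification -/

section Quantifier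
open Hom
variable {K : Type u} [Field K] {V W U X A B C D B' V' : Type}

namespace T
/-- The exchange of the outer two of three summands. -/
def sumRev (A B C : Type) : A ⊕ B ⊕ C ≃ C ⊕ B ⊕ A :=
  (Equiv.sumAssoc A B C).symm.trans
    ((Equiv.sumComm _ C).trans (Equiv.sumCongr (Equiv.refl C) (Equiv.sumComm A B)))

theorem sumRev_nat (f : Hom K A V) (g : Hom K B W) (h : Hom K C U) :
    (f ⊠ g ⊠ h) ⨾ wire (sumRev V W U) = wire (sumRev A B C) ⨾ (h ⊠ g ⊠ f) := by
  apply comp_wire_inj (sumRev U W V)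
  rw [tens_comm f, tens_comm g, tens_wires_left, tens_assoc]
  simp only [comp_assoc, wire_wire, wire_wire_assoc]
  congr 1
  · apply wire_congr; rintro (x | x | x) <;> rfl
  · congr 1
    apply wire_congr; rintro (x | x | x) <;> rfl

variable [Finite V] [Finite W] [Finite U] [Finite X] [Finite A] [Finite B] [Finite C] [Finite D]
  [Finite B'] [Finite V']

/-- Deleting a family of wires. -/
noncomputable def del (B : Type) [Finite B] : Hom K B Empty := N id Empty.elim

theorem N_map_inl (φ : W → V) :
    N (K := K) (Sum.map φ (id : B → B)) (Sum.inl : V → V ⊕ B) =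
      (N φ id ⊠ del B) ⨾ wire (Equiv.sumEmpty V Empty) := by
  rw [del, N_tens]
  have := N_relabel (K := K) (Sum.map φ (id : B → B)) (Sum.map id Empty.elim) (Equiv.refl _)
    (Equiv.sumEmpty V Empty) (Equiv.refl _) (Sum.map φ id) Sum.inl (by simp)
    (by rintro (x | x); exacts [rfl, x.elim])
  rw [← this]; simp

theorem N_id_inl :
    N (K := K) (id : V ⊕ B → V ⊕ B) Sum.inl =
      (idh V ⊠ del B) ⨾ wire (Equiv.sumEmpty V Empty) := by
  rw [← N_id_id, ← N_map_inl, Sum.map_id_id]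

/-- Existential quantification over the variables `B`: their wires are deleted. -/
noncomputable def Ex (f : T K (V ⊕ B)) : T K V := f ⨾ N id Sum.inl

theorem Ex_map (φ : W → V ⊕ B) (f : T K W) : Ex (map φ f) = f ⨾ N φ Sum.inl := by
  rw [Ex, map, comp_assoc, N_comp]; rfl

/-- Renaming of free variables commutes with quantification. -/
theorem map_Ex (φ : V → W) (f : T K (V ⊕ B)) : map φ (Ex f) = Ex (map (Sum.map φ id) f) := by
  rw [Ex_map, N_map_inl, Ex, N_id_inl, map, comp_assoc, comp_assoc, ← tens_unit_wire,
    ← comp_assoc (_ ⊠ _), ← comp_tens_comp]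
  simp

/-- Frobenius reciprocity: factors without quantified variables can be taken out. -/
theorem Ex_mul_map_inl (f : T K (V ⊕ B)) (g : T K V) :
    Ex (f * map Sum.inl g) = Ex f * g := by
  let e : (V ⊕ B) ⊕ V ≃ (V ⊕ V) ⊕ B :=
    (Equiv.sumAssoc V B V).trans ((Equiv.sumCongr (Equiv.refl V) (Equiv.sumComm B V)).trans
      (Equiv.sumAssoc V V B).symm)
  have h1 : f * map Sum.inl g = map (Sum.elim id Sum.inl) (out f g) := by
    rw [mul_def]
    nth_rw 1 [← map_id f]
    rw [out_map, map_map]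
    congr 1; funext x; rcases x with x | x <;> rfl
  have h2 : N (K := K) (Sum.elim id Sum.inl : (V ⊕ B) ⊕ V → V ⊕ B) Sum.inl =
      wire e ⨾ N (Sum.map (Sum.elim id id) id) Sum.inl := by
    have := N_relabel (K := K) (Sum.map (Sum.elim (id : V → V) id) (id : B → B))
      (Sum.inl : V → V ⊕ B) e (Equiv.refl _) (Equiv.refl _)
      (Sum.elim id Sum.inl : (V ⊕ B) ⊕ V → V ⊕ B) Sum.inl
      (by rintro ((x | x) | x) <;> rfl) (fun _ => rfl)
    rw [← this]; simp
  have h3 : N (K := K) (id : V ⊕ B → V ⊕ B) Sum.inl ⊠ idh V =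
      wire e ⨾ N (id : (V ⊕ V) ⊕ B → (V ⊕ V) ⊕ B) Sum.inl := by
    rw [← N_id_id, N_tens]
    have := N_relabel (K := K) (id : (V ⊕ V) ⊕ B → _) Sum.inl e (Equiv.refl (V ⊕ V)) e.symm
      (Sum.map id id) (Sum.map Sum.inl id) (by rintro ((x | x) | x) <;> rfl)
      (by rintro (x | x) <;> rfl)
    rw [← this]; simp
  have h4 : Ex f * g = out f g ⨾ ((N id Sum.inl ⊠ idh V) ⨾ N (Sum.elim id id) id) := by
    rw [mul_def, map, Ex]
    nth_rw 1 [← comp_id g]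
    rw [← out_comp_tens, comp_assoc]
  rw [h1, Ex_map, h4, h2, h3, N_map_inl, N_id_inl]
  simp only [comp_assoc]
  rw [← tens_unit_wire, ← comp_assoc (_ ⊠ _), ← comp_tens_comp]
  simp

theorem Ex_map_inl_mul (f : T K (V ⊕ B)) (g : T K V) :
    Ex (map Sum.inl g * f) = g * Ex f := by
  rw [mul_comm, Ex_mul_map_inl, mul_comm]

theorem del_sum :
    del (K := K) (B ⊕ C) = (del B ⊠ del C) ⨾ wire (Equiv.sumEmpty Empty Empty) := by
  rw [del, del, del, N_tens]
  have := N_relabel (K := K) (Sum.map (id : B → B) (id : C → C)) (Sum.map Empty.elim Empty.elim)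
    (Equiv.refl _) (Equiv.sumEmpty Empty Empty) (Equiv.refl _) id Empty.elim (by simp)
    (by rintro (x | x) <;> exact x.elim)
  rw [← this]; simp

theorem Ex_Ex (f : T K ((V ⊕ B) ⊕ C)) :
    Ex (Ex f) = Ex (map (Equiv.sumAssoc V B C) f) := by
  rw [Ex, Ex, Ex, map_eq_wire, N_id_inl, N_id_inl, N_id_inl, del_sum]
  simp only [comp_assoc]
  congr 1
  rw [← comp_assoc (wire _) (_ ⊠ _), ← tens_unit_wire, ← comp_assoc (_ ⊠ _) (_ ⨾ _),
    ← comp_assoc (_ ⊠ _) (_ ⊠ _), ← comp_tens_comp, id_comp, comp_id, tens_assoc,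
    ← comp_id (idh V), comp_tens_comp, comp_id, ← wire_refl]
  simp only [comp_assoc, wire_wire, wire_tens_wire]
  congr 2
  apply wire_congr
  rintro (x | x | x)
  · rfl
  · exact x.elim
  · exact x.elim

/-- Phase-free grey scalars are trivial. -/
theorem N_elim_elim : N (K := K) (Empty.elim : Empty → X) Empty.elim = idh Empty := by
  refine Finite.induction_empty_option (P := fun X => ∀ [Finite X],
    N (K := K) (Empty.elim : Empty → X) Empty.elim = idh Empty) ?_ ?_ ?_ X
  · intro X Y e h _
    have := Finite.of_equiv _ e.symm
    rw [← h, ← N_relabel (K := K) (Empty.elim : Empty → X) Empty.elim (Equiv.refl _)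
      (Equiv.refl _) e Empty.elim Empty.elim (fun x => x.elim) (fun x => x.elim)]
    simp
  · intro _
    rw [← (IsN.nil (K := K) (Empty.elim : Empty → PEmpty) Empty.elim).eq_N, wire_empty]
  · intro X _ h _
    rw [← N_relabel (K := K) (Sum.map (Empty.elim : Empty → X) (Empty.elim : Empty → Unit))
      (Sum.map Empty.elim Empty.elim) (Equiv.sumEmpty Empty Empty).symm
      (Equiv.sumEmpty Empty Empty) (Equiv.optionEquivSumPUnit.{0, 0} X).symm Empty.elim Empty.elim
      (fun x => x.elim) (by rintro (x | x) <;> exact x.elim), ← N_tens, h]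
    have h1 : N (K := K) (Empty.elim : Empty → Unit) Empty.elim = idh Empty := by
      rw [← grey_empty, grey_eq_N, Subsingleton.elim (Empty.elim : Empty → Unit) fun _ => ()]
    rw [h1]
    simp

/-- Unused quantified variables can be dropped: their wires are trivial scalars. -/
theorem Ex_map_injective (f : T K (V ⊕ B)) {ι : B → B'} (hι : Function.Injective ι) :
    Ex (map (Sum.map id ι) f) = Ex f := by
  have h : N (K := K) ι Empty.elim = del B := by
    classical
    let e : B ⊕ ((Set.range ι)ᶜ : Set B') ≃ B' :=
      (Equiv.sumCongr (Equiv.ofInjective ι hι) (Equiv.refl _)).trans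
        (Equiv.Set.sumCompl (Set.range ι))
    rw [← N_relabel (K := K) (Sum.map (id : B → B)
      (Empty.elim : Empty → ((Set.range ι)ᶜ : Set B'))) (Sum.map Empty.elim Empty.elim)
      (Equiv.sumEmpty B Empty).symm (Equiv.sumEmpty Empty Empty) e ι Empty.elim
      (fun x => by simp [e]) (by rintro (x | x) <;> exact x.elim), ← N_tens, N_elim_elim,
      tens_empty]
    simp only [comp_assoc, wire_wire, wire_wire_assoc]
    simp [del]
  have h2 : N (K := K) (Sum.map id ι : V ⊕ B → V ⊕ B') Sum.inl =
      (idh V ⊠ N ι Empty.elim) ⨾ wire (Equiv.sumEmpty V Empty) := by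
    rw [← N_id_id, N_tens]
    have := N_relabel (K := K) (Sum.map (id : V → V) ι) (Sum.map id Empty.elim) (Equiv.refl _)
      (Equiv.sumEmpty V Empty) (Equiv.refl _) (Sum.map id ι) Sum.inl (by simp)
      (by rintro (x | x); exacts [rfl, x.elim])
    rw [← this]; simp
  rw [Ex_map, h2, h, Ex, N_id_inl]

theorem Ex_map_inl (f : T K V) : Ex (map (Sum.inl : V → V ⊕ B) f) = f := by
  have h : f = Ex (map (Equiv.sumEmpty V Empty).symm f) := by
    rw [Ex_map]
    have := N_relabel (K := K) (id : V → V) id (Equiv.refl _) (Equiv.refl _)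
      (Equiv.sumEmpty V Empty).symm (Equiv.sumEmpty V Empty).symm Sum.inl
      (fun x => rfl) (fun x => rfl)
    rw [← this, N_id_id]; simp
  have h2 := Ex_map_injective (B' := B) (map (Equiv.sumEmpty V Empty).symm f) (ι := Empty.elim)
    (fun x => x.elim)
  rw [← h, map_map] at h2
  exact h2

/-! ### Bending of wires -/

/-- A family of bent wires. -/
noncomputable def cup (B : Type) [Finite B] : T K (B ⊕ B) := N Empty.elim (Sum.elim id id)

/-- The mirror image of `cup`. -/
noncomputable def cap (B : Type) [Finite B] : Hom K (B ⊕ B) Empty :=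
  N (Sum.elim id id) Empty.elim

/-- A wire that is bent twice. -/
noncomputable def zigzag (B : Type) [Finite B] : Hom K B B :=
  wire (Equiv.sumEmpty B Empty).symm ⨾ (idh B ⊠ cup B) ⨾ wire (sumRev B B B) ⨾
    (idh B ⊠ cap B) ⨾ wire (Equiv.sumEmpty B Empty)

theorem cup_relabel (e : B ≃ C) : cup (K := K) B ⨾ (wire e ⊠ wire e) = cup C := by
  rw [cup, cup, wire_tens_wire, ← N_relabel (K := K) (Empty.elim : Empty → B)
    (Sum.elim id id) (Equiv.refl _) (Equiv.sumCongr e e) e Empty.elim (Sum.elim id id)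
    (fun x => x.elim) (by rintro (x | x) <;> rfl)]
  simp

theorem cap_relabel (e : B ≃ C) : (wire e ⊠ wire e) ⨾ cap (K := K) C = cap B := by
  rw [cap, cap, wire_tens_wire, ← N_relabel (K := K) (Sum.elim (id : C → C) id)
    Empty.elim (Equiv.sumCongr e e) (Equiv.refl _) e.symm (Sum.elim id id) Empty.elim 
    (by rintro (x | x) <;> simp) (fun x => x.elim)]
  simp

theorem cup_sum : cup (K := K) (B ⊕ C) =
    out (cup B) (cup C) ⨾ wire (Equiv.sumSumSumComm B B C C) := by
  rw [out, cup, cup, cup, N_tens, ← N_relabel (K := K)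
    (Sum.map (Empty.elim : Empty → B) (Empty.elim : Empty → C))
    (Sum.map (Sum.elim id id) (Sum.elim id id)) (Equiv.sumEmpty Empty Empty).symm
    (Equiv.sumSumSumComm B B C C) (Equiv.refl _) Empty.elim (Sum.elim id id)
    (fun x => x.elim) (by rintro ((x | x) | (x | x)) <;> rfl)]
  simp

theorem cap_sum : cap (K := K) (B ⊕ C) = wire (Equiv.sumSumSumComm B C B C) ⨾
    (cap B ⊠ cap C) ⨾ wire (Equiv.sumEmpty Empty Empty) := by
  rw [cap, cap, cap, N_tens, ← N_relabel (K := K)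
    (Sum.map (Sum.elim (id : B → B) id) (Sum.elim (id : C → C) id))
    (Sum.map Empty.elim Empty.elim) (Equiv.sumSumSumComm B C B C) (Equiv.sumEmpty Empty Empty)
    (Equiv.refl _) (Sum.elim id id) Empty.elim
    (by rintro ((x | x) | (x | x)) <;> rfl) (by rintro (x | x) <;> exact x.elim)]

theorem zigzag_sum (hB : zigzag (K := K) B = idh B) (hC : zigzag (K := K) C = idh C) :
    zigzag (K := K) (B ⊕ C) = idh (B ⊕ C) := by
  rw [← idh_tens_idh, ← hB, ← hC, zigzag, zigzag, zigzag, cup_sum, cap_sum, out]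
  simp only [comp_assoc]
  rw [tens_wires_right, tens_wires_right, ← idh_tens_idh, tens_tens_comm (idh B) (idh C) (cup B),
    tens_tens_comm (idh B) (idh C) (cap B)]
  simp only [comp_tens_comp, comp_assoc, wire_wire, wire_wire_assoc, wire_tens_wire]
  congr 1
  · apply wire_congr; rintro (x | x) <;> rfl
  congr 1
  congr 1
  · apply wire_congr; rintro ((x | x | x) | (x | x | x)) <;> rfl
  congr 1
  apply wire_congr
  rintro ((x | x) | (x | x))
  · rfl
  · exact x.elim
  · rfl
  · exact x.elim

/-- The snake equation for a single wire is fusion of grey spiders. -/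
theorem zigzag_unit : zigzag (K := K) Unit = idh Unit := by
  have h := grey_fusion (A := Empty) (B := Unit) (C := Unit) (D := Unit) (A' := Empty) (0 : K) 0 0 0
  have h1 : cup (K := K) Unit = grey Empty (Unit ⊕ Unit) 0 0 := by
    rw [grey_eq_N, cup, Subsingleton.elim (Empty.elim : Empty → Unit) fun _ => ()]
  have h2 : cap (K := K) Unit = grey (Unit ⊕ Unit) Empty 0 0 := by
    rw [grey_eq_N, cap, Subsingleton.elim (Empty.elim : Empty → Unit) fun _ => ()]
  have h3 : grey Empty (Unit ⊕ Unit) (0 : K) 0 ⊠ idh Unit =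
      (grey Empty (Unit ⊕ Unit) 0 0 ⊠ idh Unit) ⨾
        wire (Equiv.sumCongr (Equiv.sumComm Unit Unit) (Equiv.refl Unit)) := by
    rw [← wire_tens_wire, wire_refl, ← comp_tens_comp, grey_comp_wire, comp_id]
  rw [zigzag, h1, h2, tens_comm, h3]
  simp only [comp_assoc, wire_wire, wire_wire_assoc]
  rw [wire_congr (e' := Equiv.sumAssoc Unit Unit Unit), ← comp_assoc _ _ (wire _),
    ← comp_assoc _ (_ ⨾ _) (wire _), h, grey_wire]
  · simpa using grey_unit
  · rintro ((x | x) | x) <;> rfl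

theorem zigzag_relabel (e : B ≃ C) (h : zigzag (K := K) B = idh B) :
    zigzag (K := K) C = idh C := by
  have h1 : zigzag (K := K) C = wire e.symm ⨾ zigzag B ⨾ wire e := by
    have h2 : idh (K := K) C = wire e.symm ⨾ idh B ⨾ wire e := by simp
    have h3 : cup (K := K) C =
        wire (Equiv.refl _) ⨾ cup B ⨾ wire (Equiv.sumCongr e e) := by
      rw [← cup_relabel e]; simp
    have h4 : cap (K := K) C =
        wire (Equiv.sumCongr e.symm e.symm) ⨾ cap B ⨾ wire (Equiv.refl _) := by
      rw [← cap_relabel e.symm]; simp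
    rw [zigzag, zigzag, h3, h4, h2, tens_wires, tens_wires]
    simp only [comp_assoc, wire_wire, wire_wire_assoc]
    congr 1
    · apply wire_congr; intro x; rfl
    congr 1
    congr 1
    · apply wire_congr; rintro (x | x | x) <;> simp [sumRev]
    congr 1
    apply wire_congr
    rintro (x | x)
    · rfl
    · exact x.elim
  rw [h1, h]; simp

theorem zigzag_eq_id : zigzag (K := K) B = idh B := by
  refine Finite.induction_empty_option (P := fun B => ∀ [Finite B],
    zigzag (K := K) B = idh B) ?_ ?_ ?_ B
  · intro B C e h _
    have := Finite.of_equiv _ e.symm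
    exact zigzag_relabel e h
  · intro _
    have h1 : cup (K := K) PEmpty = wire (Equiv.equivOfIsEmpty _ _) := (IsN.nil _ _).eq_N.symm
    have h2 : cap (K := K) PEmpty = wire (Equiv.equivOfIsEmpty _ _) := (IsN.nil _ _).eq_N.symm
    rw [zigzag, h1, h2, ← wire_refl]
    simp only [wire_tens_wire, wire_wire]
    exact wire_congr fun x => x.elim
  · intro B _ h _
    exact zigzag_relabel (Equiv.optionEquivSumPUnit.{0, 0} B).symm (zigzag_sum h zigzag_unit)

end T
end Quantifier
/-! ### The formula of a diagram -/

section Denotation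
open Hom
variable {K : Type u} [Field K] {V W U X A B C D A' B' V' : Type}

namespace T
variable [Finite V] [Finite W] [Finite U] [Finite X] [Finite A] [Finite B] [Finite C] [Finite D]
  [Finite A'] [Finite B'] [Finite V']

/-- The state of a diagram, whose inputs are bent to outputs. -/
noncomputable def name (f : Hom K A B) : T K (A ⊕ B) := cup A ⨾ (idh A ⊠ f)

theorem idh_tens_comp {A B C V : Type} (f : Hom K A B) (g : Hom K B C) :
    idh V ⊠ (f ⨾ g) = (idh V ⊠ f) ⨾ (idh V ⊠ g) := by
  rw [← comp_tens_comp, id_comp]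

theorem idh_tens_wire {A B V : Type} (e : A ≃ B) :
    idh (K := K) V ⊠ wire e = wire (Equiv.sumCongr (Equiv.refl V) e) := by
  rw [← wire_refl, wire_tens_wire]

/-- A diagram is recovered from its state by bending wires back. -/
theorem zigzag_comp {C : Type} (g : Hom K B C) :
    g = wire (Equiv.sumEmpty B Empty).symm ⨾ (idh B ⊠ name g) ⨾ wire (sumRev B B C) ⨾
      (idh C ⊠ cap B) ⨾ wire (Equiv.sumEmpty C Empty) := by
  have h1 : idh B ⊠ name g = (idh B ⊠ cup B) ⨾ (idh B ⊠ idh B ⊠ g) := by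
    rw [← comp_tens_comp, id_comp]; rfl
  have h2 : (g ⊠ idh B ⊠ idh B) ⨾ (idh C ⊠ cap B) = (idh B ⊠ cap B) ⨾ (g ⊠ idh Empty) := by
    rw [← comp_tens_comp, ← comp_tens_comp, idh_tens_idh]; simp
  rw [h1, comp_assoc, ← comp_assoc _ (wire (sumRev B B C)), sumRev_nat, comp_assoc,
    ← comp_assoc (g ⊠ _), h2, comp_assoc, tens_unit_wire]
  conv_lhs => rw [← id_comp g, ← zigzag_eq_id, zigzag]
  simp only [comp_assoc]

/-- Applying a diagram to some of the wires of a state, in terms of products and quantifiers. -/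
theorem apply_eq_Ex (t : T K (V ⊕ B)) (g : Hom K B C) :
    t ⨾ (idh V ⊠ g) = Ex (map (Sum.elim (Sum.inl ∘ Sum.inl) Sum.inr) t *
      map (Sum.elim Sum.inr (Sum.inl ∘ Sum.inr)) (name g)) := by
  let σ : (V ⊕ B) ⊕ (B ⊕ C) ≃ (V ⊕ C) ⊕ (B ⊕ B) :=
    (Equiv.sumAssoc V B (B ⊕ C)).trans ((Equiv.sumCongr (Equiv.refl V) (sumRev B B C)).trans
      (Equiv.sumAssoc V C (B ⊕ B)).symm)
  rw [mul_def, out_map, map_map, Ex_map]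
  have h1 : N (K := K) (Sum.elim id id ∘ Sum.map (Sum.elim (Sum.inl ∘ Sum.inl) Sum.inr)
      (Sum.elim Sum.inr (Sum.inl ∘ Sum.inr)) : (V ⊕ B) ⊕ (B ⊕ C) → (V ⊕ C) ⊕ B) Sum.inl =
      wire σ ⨾ (idh (V ⊕ C) ⊠ cap B) ⨾ wire (Equiv.sumEmpty (V ⊕ C) Empty) := by
    rw [cap, ← N_id_id, N_tens]
    refine (N_relabel _ _ _ _ (Equiv.refl _) _ _ ?_ ?_).symm
    · rintro ((x | x) | (x | x)) <;> rfl
    · rintro (x | x)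
      · rfl
      · exact x.elim
  have h2 : out t (name g) = t ⨾ wire (Equiv.sumEmpty (V ⊕ B) Empty).symm ⨾
      (idh (V ⊕ B) ⊠ name g) := by
    have : t ⊠ name g = (t ⊠ idh Empty) ⨾ (idh (V ⊕ B) ⊠ name g) := by
      rw [← comp_tens_comp]; simp
    rw [out, this, tens_empty]
    simp only [comp_assoc, wire_wire_assoc, wire_empty, id_comp]
  rw [h1, h2, comp_assoc]
  congr 1
  conv_lhs => rw [zigzag_comp g]
  rw [← idh_tens_idh, ← idh_tens_idh, Hom.tens_assoc, Hom.tens_assoc]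
  simp only [idh_tens_comp, idh_tens_wire, comp_assoc, wire_wire_assoc, wire_wire]
  congr 1
  · apply wire_congr; rintro (x | x) <;> rfl
  congr 1
  congr 1
  · apply wire_congr; rintro (x | x | x | x) <;> rfl
  congr 1
  apply wire_congr
  rintro (x | x | x)
  · rfl
  · rfl
  · exact x.elim

/-- The formula of a diagram `f` whose inputs and outputs are given names of variables. -/
noncomputable def den (f : Hom K A B) (α : A → V) (β : B → V) : T K V :=
  map (Sum.elim α β) (name f)

/-- Equality of two families of variables. -/
noncomputable def eqs (α β : A → V) : T K V := map (Sum.elim α β) (cup A)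

theorem map_den (φ : V → W) (f : Hom K A B) (α : A → V) (β : B → V) :
    map φ (den f α β) = den f (φ ∘ α) (φ ∘ β) := by
  rw [den, den, map_map, Sum.comp_elim]

theorem map_eqs (φ : V → W) (α β : A → V) :
    map φ (eqs (K := K) α β) = eqs (φ ∘ α) (φ ∘ β) := by
  rw [eqs, eqs, map_map, Sum.comp_elim]

theorem den_idh (α β : A → V) : den (idh (K := K) A) α β = eqs α β := by
  rw [den, name, idh_tens_idh, comp_id, eqs]

theorem name_eq_den (f : Hom K A B) : name f = den f Sum.inl Sum.inr := by
  rw [den, Sum.elim_inl_inr, map_id]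

theorem den_comp (f : Hom K A B) (g : Hom K B C) (α : A → V) (γ : C → V) :
    den (f ⨾ g) α γ = Ex (den f (Sum.inl ∘ α) (Sum.inr : B → V ⊕ B) *
      den g Sum.inr (Sum.inl ∘ γ)) := by
  have h : name (f ⨾ g) = name f ⨾ (idh A ⊠ g) := by
    rw [name, name, comp_assoc, ← comp_tens_comp, id_comp]
  rw [den, h, apply_eq_Ex, map_Ex, map_mul, map_map, map_map, den, den]
  congr 3
  · funext x; rcases x with x | x <;> rfl
  · funext x; rcases x with x | x <;> rfl

theorem den_tens (f : Hom K A B) (g : Hom K C D) (α : A ⊕ C → V) (β : B ⊕ D → V) :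
    den (f ⊠ g) α β = den f (α ∘ Sum.inl) (β ∘ Sum.inl) * den g (α ∘ Sum.inr) (β ∘ Sum.inr) := by
  have h : name (f ⊠ g) = map (Equiv.sumSumSumComm A B C D) (out (name f) (name g)) := by
    rw [map_eq_wire, name, cup_sum, ← idh_tens_idh, comp_assoc, tens_tens_comm, name, name,
      ← out_comp_tens]
    simp only [comp_assoc, wire_wire_assoc]
    congr 1
    rw [wire_eq_id, id_comp]
    rintro ((x | x) | (x | x)) <;> rfl
  rw [den, h, ← map_inl_mul_map_inr, map_mul, map_mul, map_map, map_map, map_map, map_map,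
    den, den]
  congr 2
  · funext x; rcases x with x | x <;> rfl
  · funext x; rcases x with x | x <;> rfl

theorem den_wire_comp (e : A ≃ B) (f : Hom K B C) (α : A → V) (γ : C → V) :
    den (wire e ⨾ f) α γ = den f (α ∘ e.symm) γ := by
  have h : name (wire e ⨾ f) = map (Sum.map e.symm id) (name f) := by
    have := map_eq_wire (Equiv.sumCongr e.symm (Equiv.refl C)) (name f)
    rw [show Sum.map e.symm id = ⇑(Equiv.sumCongr e.symm (Equiv.refl C)) from rfl, this, name,
      name, ← cup_relabel e]
    simp only [comp_assoc]
    congr 1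
    rw [← wire_tens_wire, wire_refl, ← comp_assoc, ← comp_tens_comp, ← comp_tens_comp]
    simp
  rw [den, h, map_map, den]
  congr 1
  funext x; rcases x with x | x <;> rfl

theorem den_comp_wire (f : Hom K A B) (e : B ≃ C) (α : A → V) (γ : C → V) :
    den (f ⨾ wire e) α γ = den f α (γ ∘ e) := by
  have h : name (f ⨾ wire e) = map (Sum.map id e) (name f) := by
    have := map_eq_wire (Equiv.sumCongr (Equiv.refl A) e) (name f)
    rw [show Sum.map id e = ⇑(Equiv.sumCongr (Equiv.refl A) e) from rfl, this, name,
      name, ← wire_tens_wire, wire_refl, comp_assoc, ← comp_tens_comp]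
    simp
  rw [den, h, map_map, den]
  congr 1
  funext x; rcases x with x | x <;> rfl

theorem den_wire (e : A ≃ B) (α : A → V) (β : B → V) :
    den (wire (K := K) e) α β = eqs α (β ∘ e) := by
  rw [← id_comp (wire e), den_comp_wire, den_idh]

theorem eq_map_den (f : Hom K Empty B) :
    f = map (Equiv.emptySum Empty B) (name f) := by
  have h : cup (K := K) Empty = wire (Equiv.sumEmpty Empty Empty).symm :=
    (IsN.nil (K := K) (V := Empty) (V' := Empty ⊕ Empty) Empty.elim
      (Sum.elim id id)).eq_N.symm.trans (wire_from_empty _ _)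
  rw [map_eq_wire, name, h, empty_tens]
  simp only [comp_assoc, wire_wire_assoc, wire_wire]
  rw [wire_empty, id_comp, wire_eq_id, comp_id]
  simp

theorem den_state (f : T K B) (α : Empty → V) (β : B → V) : den f α β = map β f := by
  conv_rhs => rw [eq_map_den f]
  rw [den, map_map]
  congr 1
  funext x
  rcases x with x | x
  · exact x.elim
  · rfl

/-- Elimination of quantified variables that are equal to others. -/
theorem Ex_mul_eqs (f : T K (V ⊕ B)) (l : B → V) :
    Ex (f * eqs Sum.inr (Sum.inl ∘ l)) = map (Sum.elim id l) f := by
  have h := apply_eq_Ex f (idh B)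
  rw [idh_tens_idh, comp_id, name_eq_den, den_idh, map_eqs] at h
  conv_rhs => rw [h]
  rw [map_Ex, map_mul, map_map, map_eqs]
  conv_lhs => rw [← map_id f]
  congr 3
  funext x; rcases x with x | x <;> rfl

theorem cup_swap : map Sum.swap (cup (K := K) B) = cup B := by
  have h := N_relabel (K := K) (Empty.elim : Empty → B) (Sum.elim id id) (Equiv.refl _)
    (Equiv.sumComm B B) (Equiv.refl _) Empty.elim (Sum.elim id id)
    (fun x => x.elim) (by rintro (x | x) <;> rfl)
  rw [wire_refl, id_comp] at h
  exact (map_eq_wire (Equiv.sumComm B B) _).trans h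

theorem eqs_comm (α β : A → V) : eqs (K := K) α β = eqs β α := by
  rw [eqs, ← cup_swap, map_map, eqs]
  congr 1
  funext x; rcases x with x | x <;> rfl

theorem eqs_mul_Ex (f : T K (V ⊕ B)) (l : B → V) :
    Ex (f * eqs (Sum.inl ∘ l) Sum.inr) = map (Sum.elim id l) f := by
  rw [eqs_comm, Ex_mul_eqs]

theorem eqs_sum (α β : A ⊕ B → V) :
    eqs (K := K) α β = eqs (α ∘ Sum.inl) (β ∘ Sum.inl) * eqs (α ∘ Sum.inr) (β ∘ Sum.inr) := by
  rw [← den_idh, ← idh_tens_idh, den_tens, den_idh, den_idh]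

theorem eqs_equiv (e : A ≃ B) (α β : B → V) : eqs (K := K) (α ∘ e) (β ∘ e) = eqs α β := by
  rw [← den_idh α, ← wire_refl, ← e.symm_trans_self, ← wire_wire, den_wire_comp, den_wire]
  rfl

theorem eqs_empty [IsEmpty A] (α β : A → V) : eqs (K := K) α β = 1 := by
  have h : cup (K := K) A = 1 := by
    have h := N_relabel (K := K) (Empty.elim : Empty → A) (Sum.elim id id) (Equiv.refl _)
      (Equiv.refl (A ⊕ A)) (Equiv.equivOfIsEmpty A (A ⊕ A)) Empty.elim id
      (fun x => x.elim) (fun x => isEmptyElim x)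
    rw [wire_refl, wire_refl, id_comp, comp_id] at h
    exact h
  rw [eqs, h, map_one]

end T
end Denotation
/-! ### The formulas of spiders -/

section Generators
open Hom
variable {K : Type u} [Field K] {V W U X A B C D A' B' V' L L' : Type}

namespace T
variable [Finite V] [Finite W] [Finite U] [Finite X] [Finite A] [Finite B] [Finite C] [Finite D]
  [Finite A'] [Finite B'] [Finite V'] [Finite L] [Finite L']

theorem Ex_sum (F : T K (V ⊕ A ⊕ B)) :
    Ex F = Ex (Ex (map (Equiv.sumAssoc V A B).symm F)) := by
  rw [Ex_Ex, map_map, Equiv.self_comp_symm, map_id]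

theorem Ex_relabel (e : A ≃ B) (F : T K (V ⊕ A)) : Ex (map (Sum.map id e) F) = Ex F :=
  Ex_map_injective F e.injective

theorem Ex_swap (F : T K ((V ⊕ A) ⊕ B)) : Ex (Ex F) =
    Ex (Ex (map (Sum.elim (Sum.map Sum.inl id) (Sum.inl ∘ Sum.inr) :
      (V ⊕ A) ⊕ B → (V ⊕ B) ⊕ A) F)) := by
  rw [Ex_Ex, Ex_Ex, ← Ex_relabel (Equiv.sumComm A B), map_map, map_map]
  congr 2
  funext x; rcases x with (x | x) | x <;> rfl

theorem Ex_eqs_inl (l : A → V) (F : T K (V ⊕ A ⊕ B)) :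
    Ex (eqs (Sum.inl ∘ l) (Sum.inr ∘ Sum.inl) * F) =
      Ex (map (Sum.elim Sum.inl (Sum.elim (Sum.inl ∘ l) Sum.inr)) F) := by
  rw [Ex_sum, Ex_swap, map_mul, map_mul, map_map, map_eqs, map_map, mul_comm]
  have := eqs_mul_Ex (map ((Sum.elim (Sum.map Sum.inl id) (Sum.inl ∘ Sum.inr) :
      (V ⊕ A) ⊕ B → (V ⊕ B) ⊕ A) ∘ (Equiv.sumAssoc V A B).symm) F) (Sum.inl ∘ l)
  rw [map_map] at this
  refine (congrArg Ex (Eq.trans ?_ this)).trans ?_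
  · rfl
  · congr 2
    funext x; rcases x with x | x | x <;> rfl

theorem Ex_eqs_inr (l : B → V) (F : T K (V ⊕ A ⊕ B)) :
    Ex (eqs (Sum.inl ∘ l) (Sum.inr ∘ Sum.inr) * F) =
      Ex (map (Sum.elim Sum.inl (Sum.elim Sum.inr (Sum.inl ∘ l))) F) := by
  rw [← Ex_relabel (Equiv.sumComm A B), map_mul, map_eqs]
  refine Eq.trans ?_ ((Ex_eqs_inl l (map (Sum.map id (Equiv.sumComm A B)) F)).trans ?_)
  · rfl
  · rw [map_map]
    congr 2
    funext x; rcases x with x | x | x <;> rfl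

theorem den_tens_idh_comp (f : Hom K A B) (g : Hom K (B ⊕ C) D) (α : A ⊕ C → V) (γ : D → V) :
    den ((f ⊠ idh C) ⨾ g) α γ = Ex (den f (Sum.inl ∘ α ∘ Sum.inl) Sum.inr *
      den g (Sum.elim Sum.inr (Sum.inl ∘ α ∘ Sum.inr)) (Sum.inl ∘ γ)) := by
  rw [den_comp, den_tens, den_idh, mul_comm (den f _ _), mul_assoc]
  refine (Ex_eqs_inr (α ∘ Sum.inr) _).trans ?_
  rw [map_mul, map_den, map_den]
  rfl

theorem den_idh_tens_comp (f : Hom K A B) (g : Hom K (C ⊕ B) D) (α : C ⊕ A → V) (γ : D → V) :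
    den ((idh C ⊠ f) ⨾ g) α γ = Ex (den f (Sum.inl ∘ α ∘ Sum.inr) Sum.inr *
      den g (Sum.elim (Sum.inl ∘ α ∘ Sum.inl) Sum.inr) (Sum.inl ∘ γ)) := by
  rw [den_comp, den_tens, den_idh, mul_assoc]
  refine (Ex_eqs_inl (α ∘ Sum.inl) _).trans ?_
  rw [map_mul, map_den, map_den]
  rfl

theorem den_comp_tens_idh (f : Hom K A B) (g : Hom K D (A ⊕ C)) (α : D → V) (γ : B ⊕ C → V) :
    den (g ⨾ (f ⊠ idh C)) α γ = Ex (den g (Sum.inl ∘ α) (Sum.elim Sum.inr (Sum.inl ∘ γ ∘ Sum.inr)) *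
      den f Sum.inr (Sum.inl ∘ γ ∘ Sum.inl)) := by
  rw [den_comp, den_tens, den_idh, mul_comm (den f _ _), mul_left_comm, eqs_comm]
  refine (Ex_eqs_inr (γ ∘ Sum.inr) _).trans ?_
  rw [map_mul, map_den, map_den]
  rfl

theorem cup_unit : cup (K := K) Unit = grey Empty (Unit ⊕ Unit) 0 0 := by
  rw [grey_eq_N, cup, Subsingleton.elim (Empty.elim : Empty → Unit) fun _ => ()]

/-- Bending an input of a diagram amounts to regarding it as an output. -/
theorem den_bend (f : Diag K (A ⊕ Unit) B) (α : A → V) (β : B ⊕ Unit → V) :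
    den (mk (bend f)) α β = den (mk f) (Sum.elim α (β ∘ Sum.inr)) (β ∘ Sum.inl) := by
  have h : mk (bend f) = wire (Equiv.sumEmpty A Empty).symm ⨾
      (idh A ⊠ (grey Empty (Unit ⊕ Unit) 0 0 : Hom K _ _)) ⨾
      wire (Equiv.sumAssoc A Unit Unit).symm ⨾ (mk f ⊠ idh Unit) := rfl
  rw [h, den_wire_comp, den_idh_tens_comp, den_state, den_wire_comp, den_tens, den_idh,
    ← mul_assoc, mul_comm _ (eqs _ _), eqs_comm]
  refine (Ex_eqs_inr (A := Unit) (β ∘ Sum.inr) _).trans ?_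
  rw [map_mul, map_map, ← cup_unit, map_den]
  have := eqs_mul_Ex (K := K) (V := V) (B := Unit) (den (mk f)
    (Sum.elim (Sum.inl ∘ α) Sum.inr) (Sum.inl ∘ β ∘ Sum.inl)) (β ∘ Sum.inr)
  rw [map_den, eqs_comm] at this
  refine Eq.trans ?_ (this.trans ?_)
  · rw [mul_comm, eqs]
    congr 3
    funext x; rcases x with x | x <;> rfl
  · congr 1
    funext x; rcases x with x | x <;> rfl

/-- Spiders may be regarded as states, for both colours. -/
theorem den_flexsymmetric (G : ∀ (A B : Type) [Finite A] [Finite B], Diag K A B)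
    (hw : ∀ {A B A' B' : Type} [Finite A] [Finite B] [Finite A'] [Finite B'] (e : A' ≃ A)
      (e' : B ≃ B'), wire e ⨾ mk (G A B) ⨾ wire e' = mk (G A' B'))
    (hb : ∀ (A B : Type) [Finite A] [Finite B], mk (bend (G (A ⊕ Unit) B)) = mk (G A (B ⊕ Unit)))
    (α : A → V) (β : B → V) :
    den (mk (G A B)) α β = map (Sum.elim α β) (mk (G Empty (A ⊕ B))) := by
  have hs : ∀ {L L' V : Type} [Finite V] [Finite L] [Finite L'] (e : L ≃ L') (l : L' → V),
      map (l ∘ e) (mk (G Empty L)) = map l (mk (G Empty L')) := by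
    intro L L' V _ _ _ e l
    rw [← hw (Equiv.refl Empty) e, wire_refl, id_comp, ← map_eq_wire, map_map]
  refine Finite.induction_empty_option (P := fun A => ∀ [Finite A] {B V : Type} [Finite B]
    [Finite V] (α : A → V) (β : B → V), den (mk (G A B)) α β =
      map (Sum.elim α β) (mk (G Empty (A ⊕ B)))) ?_ ?_ ?_ A α β
  · intro A A₁ e h _ B V _ _ α β
    have := Finite.of_equiv _ e.symm
    rw [← hw e.symm (Equiv.refl B), wire_refl, comp_id, den_wire_comp, h,
      ← hs (Equiv.sumCongr e (Equiv.refl B))]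
    congr 1
    funext x; rcases x with x | x <;> rfl
  · intro _ B V _ _ α β
    rw [← hw (Equiv.equivOfIsEmpty PEmpty Empty) (Equiv.refl B), wire_refl, comp_id,
      den_wire_comp, den_state, ← hs (Equiv.emptySum PEmpty B)]
    congr 1
    funext x; rcases x with x | x
    · exact x.elim
    · rfl
  · intro A _ h _ B V _ _ α β
    let e := Equiv.optionEquivSumPUnit.{0, 0} A
    have h1 := hw e (Equiv.refl B)
    rw [wire_refl, comp_id] at h1
    have h2 := den_bend (G (A ⊕ Unit) B) (α ∘ e.symm ∘ Sum.inl)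
      (Sum.elim β (α ∘ e.symm ∘ Sum.inr))
    rw [hb, h] at h2
    rw [← h1, den_wire_comp]
    refine Eq.trans ?_ (h2.symm.trans ?_)
    · congr 1
      funext x; rcases x with x | x <;> rfl
    · rw [← hs ((Equiv.sumCongr e (Equiv.refl B)).trans ((Equiv.sumAssoc A Unit B).trans
        (Equiv.sumCongr (Equiv.refl A) (Equiv.sumComm Unit B))))]
      congr 1
      funext x
      rcases x with (_ | x) | x <;> rfl

/-- The formula of a grey spider. -/
noncomputable def sp (a b : K) (l : L → V) : T K V := map l (grey Empty L a b)

/-- The formula of a white spider. -/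
noncomputable def wh (a b : K) (l : L → V) : T K V := map l (white Empty L a b)

theorem den_grey (a b : K) (α : A → V) (β : B → V) :
    den (grey A B a b) α β = sp a b (Sum.elim α β) :=
  den_flexsymmetric (fun A B _ _ => Diag.grey A B a b) (fun _ _ => grey_wire _ _ _ _)
    (fun _ _ _ _ => mk_eq_mk.2 (Eqv.grey_bend _ _)) α β

theorem den_white (a b : K) (α : A → V) (β : B → V) :
    den (white A B a b) α β = wh a b (Sum.elim α β) :=
  den_flexsymmetric (fun A B _ _ => Diag.white A B a b) (fun _ _ => white_wire _ _ _ _)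
    (fun _ _ _ _ => mk_eq_mk.2 (Eqv.white_bend _ _)) α β

theorem map_sp (φ : V → W) (a b : K) (l : L → V) : map φ (sp a b l) = sp a b (φ ∘ l) := by
  rw [sp, map_map, sp]

theorem map_wh (φ : V → W) (a b : K) (l : L → V) : map φ (wh a b l) = wh a b (φ ∘ l) := by
  rw [wh, map_map, wh]

theorem sp_equiv (a b : K) (e : L ≃ L') (l : L' → V) : sp a b (l ∘ e) = sp a b l := by
  rw [sp, sp, ← grey_comp_wire e, ← map_eq_wire, map_map]

theorem wh_equiv (a b : K) (e : L ≃ L') (l : L' → V) : wh a b (l ∘ e) = wh a b l := by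
  rw [wh, wh, ← white_comp_wire e, ← map_eq_wire, map_map]

/-- The equality of two variables. -/
noncomputable def eqv (x y : V) : T K V := eqs (fun _ : Unit => x) (fun _ => y)

/-- The phase `(a, b)` at a variable. -/
noncomputable def ph (a b : K) (x : V) : T K V := sp a b (fun _ : Unit => x)

/-- A diagram with one input and one output between two variables. -/
noncomputable def el (h : Hom K Unit Unit) (x y : V) : T K V := den h (fun _ => x) (fun _ => y)

@[simp] theorem map_eqv (φ : V → W) (x y : V) : map φ (eqv (K := K) x y) = eqv (φ x) (φ y) :=
  map_eqs _ _ _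
@[simp] theorem map_ph (φ : V → W) (a b : K) (x : V) : map φ (ph a b x) = ph a b (φ x) :=
  map_sp _ _ _ _
@[simp] theorem map_el (φ : V → W) (h : Hom K Unit Unit) (x y : V) :
    map φ (el h x y) = el h (φ x) (φ y) := map_den _ _ _ _

theorem el_idh (x y : V) : el (idh (K := K) Unit) x y = eqv x y := den_idh _ _
theorem eqv_comm (x y : V) : eqv (K := K) x y = eqv y x := eqs_comm _ _

theorem eqv_eq_sp (x y : V) :
    eqv (K := K) x y = sp 0 0 (Sum.elim (fun _ : Unit => x) (fun _ : Unit => y)) := by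
  rw [eqv, eqs, cup_unit, sp]

theorem sp_congr (a b : K) (e : L ≃ L') {l : L → V} {l' : L' → V} (h : ∀ x, l x = l' (e x)) :
    sp a b l = sp a b l' := by
  rw [← sp_equiv a b e, show l = l' ∘ e from funext h]

/-- Fusion of grey spiders along a quantified variable. -/
theorem Ex_sp_mul_sp (a b c d : K) (l : L → V) (l' : L' → V) :
    Ex (sp a b (Sum.elim (Sum.inl ∘ l) (Sum.inr : Unit → V ⊕ Unit)) *
      sp c d (Sum.elim Sum.inr (Sum.inl ∘ l'))) = sp (a + c) (b + d) (Sum.elim l l') := by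
  have h := congrArg (fun f => den f (Sum.elim Empty.elim l') (Sum.elim l Empty.elim))
    (grey_fusion (A := Empty) (B := L) (C := Unit) (D := L') (A' := Empty) a b c d)
  rw [den_tens_idh_comp, den_wire_comp, den_tens, den_idh, den_grey, den_grey, den_grey,
    mul_left_comm, eqs_comm] at h
  have h2 := (Ex_eqs_inl l _).symm.trans h
  rw [map_mul, map_sp, map_sp] at h2
  let e : L ⊕ L' ≃ (Empty ⊕ L') ⊕ (L ⊕ Empty) := (Equiv.sumComm L L').trans
    (Equiv.sumCongr (Equiv.emptySum Empty L').symm (Equiv.sumEmpty L Empty).symm)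
  rw [← sp_equiv _ _ e, ← sp_equiv c d ((Equiv.sumCongr (Equiv.refl Unit)
      (Equiv.sumEmpty L' Empty).symm).trans (Equiv.sumAssoc Unit L' Empty).symm),
    ← sp_equiv a b (Equiv.emptySum Empty (L ⊕ Unit)).symm] at h2
  refine Eq.trans ?_ (h2.trans ?_)
  · congr 2
    all_goals exact congrArg _ (funext fun x => by rcases x with x | x <;> rfl)
  · exact congrArg _ (funext fun x => by rcases x with x | x <;> rfl)

/-- Identifying two variables amounts to joining their wires by a grey spider. -/
theorem map_merge (F : T K (V ⊕ (Unit ⊕ Unit))) :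
    map (Sum.map id (fun _ => ())) F = Ex (map (Sum.map Sum.inl id) F *
      sp 0 0 (Sum.elim Sum.inr (fun _ : Unit => Sum.inl (Sum.inr ())) :
        (Unit ⊕ Unit) ⊕ Unit → (V ⊕ Unit) ⊕ (Unit ⊕ Unit))) := by
  have h := apply_eq_Ex F (grey (Unit ⊕ Unit) Unit 0 0)
  rw [name_eq_den, den_grey, map_sp] at h
  rw [map, ← Sum.map_id_id, ← N_tens, N_id_id, ← grey_eq_N]
  refine h.trans ?_
  congr 3
  congr 1; funext x; rcases x with x | x <;> rfl

/-- Fusion of grey spiders along a variable. -/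
theorem sp_mul_sp (a b c d : K) (x : V) (l : L → V) (l' : L' → V) :
    sp a b (Sum.elim (fun _ : Unit => x) l) * sp c d (Sum.elim (fun _ : Unit => x) l') =
      sp (a + c) (b + d) (Sum.elim (fun _ : Unit => x) (Sum.elim l l')) := by
  have h := map_merge (sp a b (Sum.elim (fun _ : Unit => Sum.inr (Sum.inl ())) (Sum.inl ∘ l)) *
    sp c d (Sum.elim (fun _ : Unit => Sum.inr (Sum.inr ())) (Sum.inl ∘ l')) :
      T K (V ⊕ (Unit ⊕ Unit)))
  have h2 := congrArg (map (Sum.elim id fun _ => x)) h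
  rw [map_Ex, Ex_sum] at h2
  simp only [map_mul, map_sp] at h2
  have h3 : Ex (sp c d (Sum.elim (Sum.inl ∘ Sum.inl ∘ l') (Sum.inr : Unit → (V ⊕ Unit) ⊕ Unit)) *
      sp 0 0 (Sum.elim Sum.inr (Sum.inl ∘ (Sum.elim Sum.inr fun _ => Sum.inl x : Unit ⊕ Unit → _))))
      = sp c d (Sum.elim (Sum.inr : Unit → V ⊕ Unit)
        (Sum.inl ∘ (Sum.elim (fun _ => x) l' : Unit ⊕ L' → V))) := by
    have := Ex_sp_mul_sp c d 0 0 (V := V ⊕ Unit) (Sum.inl ∘ l')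
      (Sum.elim Sum.inr fun _ => Sum.inl x : Unit ⊕ Unit → _)
    rw [this, add_zero, add_zero]
    refine sp_congr _ _ ((Equiv.sumComm L' (Unit ⊕ Unit)).trans (Equiv.sumAssoc Unit Unit L')) ?_
    rintro (x | x | x) <;> rfl
  have h4 : sp a b (Sum.elim (fun _ : Unit => Sum.inl (Sum.inr ())) (Sum.inl ∘ Sum.inl ∘ l)) =
      map (Sum.inl : V ⊕ Unit → (V ⊕ Unit) ⊕ Unit)
        (sp a b (Sum.elim (Sum.inl ∘ l) (Sum.inr : Unit → V ⊕ Unit))) := by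
    rw [map_sp]
    exact sp_congr _ _ (Equiv.sumComm Unit L) (by rintro (x | x) <;> rfl)
  have h5 := Ex_map_inl_mul (B := Unit) (sp c d (Sum.elim (Sum.inl ∘ Sum.inl ∘ l')
    (Sum.inr : Unit → (V ⊕ Unit) ⊕ Unit)) *
      sp 0 0 (Sum.elim Sum.inr (Sum.inl ∘ (Sum.elim Sum.inr fun _ => Sum.inl x : Unit ⊕ Unit → _))))
      (sp a b (Sum.elim (Sum.inl ∘ l) (Sum.inr : Unit → V ⊕ Unit)))
  rw [← h4, h3] at h5
  have h6 := (congrArg Ex h5).trans (Ex_sp_mul_sp a b c d l (Sum.elim (fun _ : Unit => x) l'))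
  refine Eq.trans ?_ (h2.trans (Eq.trans ?_ (h6.trans ?_)))
  · congr 1
    all_goals exact congrArg _ (funext fun y => by rcases y with y | y <;> rfl)
  · rw [← mul_assoc]
    refine congrArg Ex (congrArg Ex (congr (congrArg _ (congr (congrArg _ ?_) ?_)) ?_))
    · exact congrArg _ (funext fun y => by rcases y with y | y <;> rfl)
    · refine sp_congr _ _ (Equiv.sumComm Unit L') ?_
      rintro (y | y) <;> rfl
    · refine sp_congr _ _ ((Equiv.sumCongr (Equiv.sumComm Unit Unit) (Equiv.refl Unit)).trans
        (Equiv.sumAssoc Unit Unit Unit)) ?_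
      rintro ((y | y) | y) <;> rfl
  · refine sp_congr _ _ (sumLeftComm L Unit L') ?_
    rintro (y | y | y) <;> rfl

theorem ph_mul_ph (a b c d : K) (x : V) : ph a b x * ph c d x = ph (a + c) (b + d) x := by
  have h := sp_mul_sp a b c d x (Empty.elim : Empty → V) (Empty.elim : Empty → V)
  rw [← sp_equiv _ _ (Equiv.sumEmpty Unit Empty).symm,
    ← sp_equiv _ _ (Equiv.sumEmpty Unit Empty).symm,
    ← sp_equiv _ _ ((Equiv.sumEmpty Unit Empty).symm.trans (Equiv.sumCongr (Equiv.refl Unit)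
      (Equiv.sumEmpty Empty Empty).symm))] at h
  exact h

theorem ph_zero (x : V) : ph (0 : K) 0 x = 1 := by
  rw [ph, sp, grey_eq_N, ← map_one (K := K) (fun _ : Unit => x), one_def,
    Subsingleton.elim (Empty.elim : Empty → Unit) fun _ => ()]
/-- A grey spider with a leg `x` says that its other legs are equal to `x`. -/
theorem sp_pivot [Fintype L] (a b : K) (x : V) (l : L → V) :
    sp a b (Sum.elim (fun _ : Unit => x) l) = ph a b x * ∏ i, eqv x (l i) := by
  refine Fintype.induction_empty_option (P := fun L _ => ∀ l : L → V,
    sp a b (Sum.elim (fun _ : Unit => x) l) = ph a b x * ∏ i, eqv x (l i)) ?_ ?_ ?_ L l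
  · intro L L' _ e h l
    let _ := Fintype.ofEquiv _ e.symm
    rw [← sp_equiv _ _ (Equiv.sumCongr (Equiv.refl Unit) e), ← Equiv.prod_comp e]
    refine Eq.trans ?_ (h (l ∘ e))
    exact congrArg _ (funext fun y => by rcases y with y | y <;> rfl)
  · intro l
    rw [← sp_equiv _ _ (Equiv.sumEmpty Unit PEmpty).symm]
    simp only [Finset.univ_eq_empty, Finset.prod_empty, mul_one]
    rfl
  · intro L _ h l
    have h1 := sp_mul_sp a b 0 0 x (l ∘ some) (fun _ : Unit => l none)
    rw [h, ← eqv_eq_sp, add_zero, add_zero] at h1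
    rw [Fintype.prod_option, mul_comm (eqv _ _), ← mul_assoc]
    refine Eq.trans ?_ h1.symm
    refine sp_congr _ _ (Equiv.sumCongr (Equiv.refl Unit) (Equiv.optionEquivSumPUnit L)) ?_
    rintro (y | _ | y) <;> rfl

/-- The vertex of a grey spider as a quantified variable. -/
theorem sp_eq_Ex [Fintype L] (a b : K) (l : L → V) :
    sp a b l = Ex (ph a b (Sum.inr () : V ⊕ Unit) * ∏ i, eqv (Sum.inr ()) (Sum.inl (l i))) := by
  rw [← sp_pivot]
  have h := Ex_sp_mul_sp a b 0 0 l (Empty.elim : Empty → V)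
  have h1 : sp (0 : K) 0 (Sum.elim Sum.inr (Sum.inl ∘ (Empty.elim : Empty → V)) :
      Unit ⊕ Empty → V ⊕ Unit) = 1 := by
    rw [← ph_zero (Sum.inr ()), ph]
    exact sp_congr _ _ (Equiv.sumEmpty Unit Empty) (by rintro (x | x); exacts [rfl, x.elim])
  rw [h1, mul_one, add_zero, add_zero] at h
  rw [← sp_equiv a b (Equiv.sumEmpty L Empty)]
  refine Eq.trans ?_ (h.symm.trans ?_)
  · exact sp_congr _ _ (Equiv.refl _) (by rintro (x | x); exacts [rfl, x.elim])
  · congr 1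
    exact sp_congr _ _ (Equiv.sumComm L Unit) (by rintro (x | x) <;> rfl)

end T
end Generators
/-! ### Phases and boxes -/

section Formulas
open Hom
variable {K : Type u} [Field K] {V W U X A B C D A' B' V' L L' : Type}

namespace T
variable [Finite V] [Finite W] [Finite U] [Finite X] [Finite A] [Finite B] [Finite C] [Finite D]
  [Finite A'] [Finite B'] [Finite V'] [Finite L] [Finite L']

theorem eqs_eq_prod [Fintype A] (α β : A → V) : eqs (K := K) α β = ∏ i, eqv (α i) (β i) := by
  refine Fintype.induction_empty_option (P := fun A _ => ∀ α β : A → V,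
    eqs (K := K) α β = ∏ i, eqv (α i) (β i)) ?_ ?_ ?_ A α β
  · intro L L' _ e h α β
    let _ := Fintype.ofEquiv _ e.symm
    rw [← eqs_equiv e, ← Equiv.prod_comp e]
    exact h (α ∘ e) (β ∘ e)
  · intro α β
    rw [eqs_empty]
    simp
  · intro L _ h α β
    rw [Fintype.prod_option, ← eqs_equiv (Equiv.optionEquivSumPUnit.{0, 0} L).symm, eqs_sum,
      mul_comm]
    exact congrArg _ (h _ _)

theorem Ex_of_isEmpty [IsEmpty B] (F : T K (V ⊕ B)) :
    Ex F = map (Sum.elim id isEmptyElim) F := by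
  rw [← Ex_map_inl (B := B) (map _ F), map_map]
  conv_lhs => rw [← map_id F]
  congr 2
  funext x; rcases x with x | x
  · rfl
  · exact isEmptyElim x

theorem Ex_eqv (x : V) (F : T K (V ⊕ Unit)) :
    Ex (eqv (Sum.inl x) (Sum.inr ()) * F) = map (Sum.elim id fun _ => x) F := by
  rw [mul_comm]
  exact eqs_mul_Ex F fun _ => x

theorem Ex_eqv_symm (x : V) (F : T K (V ⊕ Unit)) :
    Ex (eqv (Sum.inr ()) (Sum.inl x) * F) = map (Sum.elim id fun _ => x) F := by
  rw [eqv_comm, Ex_eqv]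

theorem Ex_eq (f : T K V) {F : T K (V ⊕ B)} (h : F = map Sum.inl f) : Ex F = f := by
  rw [h, Ex_map_inl]

theorem Ex_mul_left (f : T K V) {F G : T K (V ⊕ B)} (h : F = map Sum.inl f) :
    Ex (F * G) = f * Ex G := by
  rw [h, Ex_map_inl_mul]

theorem el_comp (h k : Hom K Unit Unit) (x y : V) :
    Ex (el h (Sum.inl x) (Sum.inr ()) * el k (Sum.inr ()) (Sum.inl y)) = el (h ⨾ k) x y :=
  (den_comp h k _ _).symm

theorem den_parallel : ∀ (k : ℕ) (f : Fin k → Diag K A B) (α : Fin k × A → V) (β : Fin k × B → V),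
    den (mk (parallel k f)) α β = ∏ i, den (mk (f i)) (fun a => α (i, a)) fun b => β (i, b)
  | 0, f, α, β => by
    rw [parallel, mk_wire, den_wire, eqs_empty]; simp
  | k + 1, f, α, β => by
    rw [parallel, mk_comp, mk_comp, mk_tensor, mk_wire, mk_wire, den_wire_comp, den_comp_wire,
      den_tens, Fin.prod_univ_succ]
    congr 1
    exact den_parallel k _ _ _

/-- A box labelled `c` between two variables. -/
noncomputable def edge (c : K) (x y : V) : T K V := el (box c) x y

@[simp] theorem map_edge (φ : V → W) (c : K) (x y : V) :
    map φ (edge c x y) = edge c (φ x) (φ y) := map_el _ _ _ _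

theorem den_boxes (k : ℕ) (c : Fin k → K) (α β : Fin k → V) :
    den (mk (boxes k c)) α β = ∏ i, edge (c i) (α i) (β i) := by
  rw [boxes, mk_comp, mk_comp, mk_wire, mk_wire, den_wire_comp, den_comp_wire, den_parallel]
  rfl

theorem edge_comm (c : K) (x y : V) : edge c x y = edge c y x := by
  have h : (grey Empty (Unit ⊕ Unit) 0 0 : Hom K _ _) ⨾ (box c ⊠ idh Unit) ⨾
      wire (Equiv.sumComm Unit Unit) = grey Empty (Unit ⊕ Unit) 0 0 ⨾ (box c ⊠ idh Unit) :=
    mk_eq_mk.2 (Eqv.box_bend c)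
  have h2 := congrArg (fun f => den f Empty.elim (Sum.elim (fun _ => x) (fun _ => y))) h
  rw [← comp_assoc] at h2
  have key : ∀ x y : V, den ((grey Empty (Unit ⊕ Unit) 0 0 : Hom K _ _) ⨾ (box c ⊠ idh Unit))
      Empty.elim (Sum.elim (fun _ => x) (fun _ => y)) = edge c y x := by
    intro x y
    rw [den_comp_tens_idh, den_state, ← cup_unit]
    refine (Ex_eqv_symm y (edge c (Sum.inr ()) (Sum.inl x))).trans ?_
    simp
  rw [key, den_comp_wire] at h2
  exact (h2.symm.trans (Eq.trans (congrArg _ (funext fun z => by rcases z with z | z <;> rfl))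
    (key y x))).symm

theorem sp_eq_eqs (a b : K) (x : V) (l : L → V) :
    sp a b (Sum.elim (fun _ : Unit => x) l) = ph a b x * eqs (fun _ => x) l := by
  have := Fintype.ofFinite L
  rw [sp_pivot, eqs_eq_prod]

theorem den_grey_unit_left (a b : K) (α : Unit → V) (β : L → V) :
    den (grey Unit L a b) α β = ph a b (α ()) * eqs (fun _ => α ()) β := by
  rw [den_grey, ← sp_eq_eqs]

theorem den_grey_unit_right (a b : K) (α : L → V) (β : Unit → V) :
    den (grey L Unit a b) α β = ph a b (β ()) * eqs α (fun _ => β ()) := by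
  rw [den_grey, eqs_comm, ← sp_eq_eqs]
  exact sp_congr _ _ (Equiv.sumComm L Unit) (by rintro (z | z) <;> rfl)

theorem den_grey_unit_comp (a b : K) (g : Hom K L A) (α : Unit → V) (γ : A → V) :
    den (grey Unit L a b ⨾ g) α γ = ph a b (α ()) * den g (fun _ => α ()) γ := by
  rw [den_comp, den_grey_unit_left, mul_assoc, Ex_mul_left (ph a b (α ())) (by simp),
    mul_comm (eqs _ _)]
  refine congrArg _ ((eqs_mul_Ex _ fun _ => α ()).trans ?_)
  rw [map_den]; rfl

theorem den_comp_grey_unit (a b : K) (f : Hom K A L) (α : A → V) (γ : Unit → V) :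
    den (f ⨾ grey L Unit a b) α γ = ph a b (γ ()) * den f α (fun _ => γ ()) := by
  rw [den_comp, den_grey_unit_right, mul_left_comm, Ex_mul_left (ph a b (γ ())) (by simp)]
  refine congrArg _ ((Ex_mul_eqs _ fun _ => γ ()).trans ?_)
  rw [map_den]; rfl

theorem edge_add (c d : K) (x y : V) : edge c x y * edge d x y = edge (c + d) x y := by
  have h : grey Unit (Unit ⊕ Unit) 0 0 ⨾ (box c ⊠ box d) ⨾ grey (Unit ⊕ Unit) Unit 0 0 =
    box (c + d) := mk_eq_mk.2 (Eqv.plus c d)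
  have h2 := congrArg (fun f => el f x y) h
  simp only [el] at h2
  rw [den_grey_unit_comp, den_comp_grey_unit, ph_zero, ph_zero, one_mul, one_mul, den_tens] at h2
  exact h2

/-- The change of colour axiom for states. -/
theorem wh_eq_Ex (a b z : K) (hz : z ≠ 0) {n : ℕ} (l : Fin n → V) :
    wh (-(a / z)) (b / z ^ 2) l =
      Ex (ph a b (Sum.inr ()) * ∏ i, edge z (Sum.inr ()) (Sum.inl (l i))) := by
  have h : mk (boxes 0 fun _ => z) ⨾ grey (Fin 0) (Fin n) a b ⨾ mk (boxes n fun _ => z) =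
    white (Fin 0) (Fin n) (-(a / z)) (b / z ^ 2) := mk_eq_mk.2 (Eqv.colour 0 n a b z hz)
  have h2 := congrArg (fun f => den f Fin.elim0 l) h
  beta_reduce at h2
  rw [den_white, ← wh_equiv _ _ (Equiv.emptySum (Fin 0) (Fin n)).symm] at h2
  refine h2.symm.trans ?_
  rw [den_comp, den_boxes, Finset.univ_eq_empty, Finset.prod_empty, one_mul, Ex_of_isEmpty,
    map_den, den_comp, den_grey, den_boxes, ← sp_equiv _ _ (Equiv.emptySum (Fin 0) (Fin n)).symm]
  have h3 := sp_eq_Ex a b (Sum.inr : Fin n → V ⊕ Fin n)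
  have h4 : (Sum.elim (Sum.inl ∘ (Sum.elim id isEmptyElim) ∘ Sum.inr) Sum.inr ∘
      (Equiv.emptySum (Fin 0) (Fin n)).symm) = (Sum.inr : Fin n → V ⊕ Fin n) := rfl
  rw [h4, h3, ← Ex_mul_map_inl, Ex_swap]
  simp only [map_mul, map_prod, map_ph, map_eqv, map_edge]
  refine congrArg Ex ?_
  rw [mul_assoc, Ex_mul_left (ph a b (Sum.inr ())) (by simp)]
  have h5 := eqs_mul_Ex (∏ i, edge (K := K) z (Sum.inr i) (Sum.inl (Sum.inl (l i))))
    (fun _ : Fin n => (Sum.inr () : V ⊕ Unit))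
  rw [eqs_eq_prod, mul_comm, map_prod] at h5
  simp only [map_edge] at h5
  exact congrArg _ h5

end T
end Formulas
/-! ### Formulas that describe functions -/

section Substitutions
open Hom
variable {K : Type u} [Field K] {V W U X A B C D A' B' V' L L' : Type}

namespace T
variable [Finite V] [Finite W] [Finite U] [Finite X] [Finite A] [Finite B] [Finite C] [Finite D]
  [Finite A'] [Finite B'] [Finite V'] [Finite L] [Finite L']

/-- A diagram is determined by its formula. -/
theorem hom_ext {f g : Hom K A B}
    (h : den f (Sum.inl : A → A ⊕ B) Sum.inr = den g Sum.inl Sum.inr) :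
    f = g := by
  rw [zigzag_comp f, zigzag_comp g, name_eq_den, name_eq_den, h]

theorem el_ext {h k : Hom K Unit Unit}
    (H : el h (Sum.inl () : Unit ⊕ Unit) (Sum.inr ()) = el k (Sum.inl ()) (Sum.inr ())) : h = k :=
  hom_ext H

theorem el_edge (c : K) (x y : V) : el (box c) x y = edge c x y := rfl

theorem Ex_edge_mul_edge (c d : K) (x y : V) :
    Ex (edge c (Sum.inl x) (Sum.inr ()) * edge d (Sum.inr ()) (Sum.inl y)) =
      el (box c ⨾ box d) x y := el_comp _ _ _ _

theorem el_box_comp_box (c d : K) (x y : V) : el (box c ⨾ box d) x y = el (box d ⨾ box c) y x := by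
  rw [← el_comp, ← el_comp, mul_comm, el_edge, el_edge, el_edge, el_edge, edge_comm, edge_comm c]

theorem box_mul (a b : K) : box a ⨾ box (-1) ⨾ box b = box (a * b) := mk_eq_mk.2 (Eqv.times a b)

theorem box_one_comp_neg_one : box (1 : K) ⨾ box (-1) = idh Unit := mk_eq_mk.2 Eqv.box_inverse

theorem box_neg_one_comp_one : box (-1 : K) ⨾ box 1 = idh Unit :=
  el_ext (by rw [el_box_comp_box, box_one_comp_neg_one, el_idh, el_idh, eqv_comm])

theorem box_neg (d : K) : box (-d) = box d ⨾ box (-1) ⨾ box (-1) := by rw [box_mul, mul_neg_one]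

theorem box_neg_comp_one (d : K) : box (-d) ⨾ box 1 = box d ⨾ box (-1) := by
  rw [box_neg, comp_assoc, comp_assoc, box_neg_one_comp_one, comp_id]

theorem box_one_eq : box (1 : K) = box (-1) ⨾ box (-1) ⨾ box (-1) := by
  rw [box_mul, neg_one_mul, neg_neg]

theorem box_one_comp (e : K) : box 1 ⨾ box e = box (-1) ⨾ box (-e) := by
  have h : box (-e) = box (-1) ⨾ box (-1) ⨾ box e := by rw [box_mul, neg_one_mul]
  rw [h, box_one_eq, comp_assoc, comp_assoc]

/-- Both sides are the phase-free white spider with two legs, by change of colour. -/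
theorem box_comp_self {d : K} (hd : d ≠ 0) : box d ⨾ box d = box 1 ⨾ box 1 := by
  have h : ∀ z : K, z ≠ 0 → ∀ x y : Unit ⊕ Unit, el (box z ⨾ box z) x y = wh 0 0 ![x, y] := by
    intro z hz x y
    have := wh_eq_Ex 0 0 z hz ![x, y]
    rw [zero_div, zero_div, neg_zero, ph_zero, one_mul, Fin.prod_univ_two] at this
    rw [this, ← el_comp, el_edge, el_edge, edge_comm]
    rfl
  exact el_ext ((h d hd _ _).trans (h 1 one_ne_zero _ _).symm)

theorem box_comp_neg {d : K} (hd : d ≠ 0) : box d ⨾ box (-d) = idh Unit := by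
  rw [box_neg, ← comp_assoc, box_comp_self hd, comp_assoc, ← comp_assoc (box 1) (box (-1)),
    box_one_comp_neg_one, id_comp, box_one_comp_neg_one]

/-- The property of a formula `Q` with a distinguished variable that this variable is copied: `Q`
says that the variable is a function of the other ones. -/
def Copyable (Q : T K (V ⊕ Unit)) : Prop :=
  map Sum.inl Q * eqv (Sum.inl (Sum.inr ())) (Sum.inr ()) =
    map (Sum.inl : V ⊕ Unit → (V ⊕ Unit) ⊕ Unit) Q * map (Sum.map Sum.inl id) Q

theorem Copyable.Ex_mul {Q : T K (V ⊕ Unit)} (h : Copyable Q) (F G : T K (V ⊕ Unit)) :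
    Ex (Q * (F * G)) = Ex (Q * F) * Ex (Q * G) := by
  rw [← Ex_mul_map_inl, map_Ex, ← Ex_map_inl_mul, map_mul, map_mul]
  have h2 : ∀ a b c d : T K ((V ⊕ Unit) ⊕ Unit), a * b * (c * d) = (a * c) * b * d := by
    intro a b c d; ac_rfl
  rw [h2, ← h, mul_comm (map _ Q), mul_assoc, mul_assoc, Ex_eqv]
  simp only [map_mul, map_map]
  have e1 : (Sum.elim id (fun _ => Sum.inr ()) : (V ⊕ Unit) ⊕ Unit → V ⊕ Unit) ∘ Sum.inl = id := rfl
  have e2 : (Sum.elim id (fun _ => Sum.inr ()) : (V ⊕ Unit) ⊕ Unit → V ⊕ Unit) ∘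
      Sum.map Sum.inl id = id := by
    funext x; rcases x with x | x <;> rfl
  rw [e1, e2, map_id, map_id, map_id]

/-- Substituting for a variable the function of the other variables which a copyable and total
formula describes. -/
noncomputable def subst (Q : T K (V ⊕ Unit)) (h : Copyable Q) (h1 : Ex Q = 1) :
    T K (V ⊕ Unit) →* T K V where
  toFun F := Ex (Q * F)
  map_one' := by rw [mul_one, h1]
  map_mul' := h.Ex_mul

/-- The white state with one leg: its variable has the value `a`. -/
noncomputable def affine (a : K) (x : V) : T K V := wh a 0 (fun _ : Fin 1 => x)

/-- The phase-free white spider with three legs: the values of its variables add up to zero. -/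
noncomputable def tri (x y u : V) : T K V := wh 0 0 ![x, y, u]

@[simp] theorem map_affine (φ : V → W) (a : K) (x : V) : map φ (affine a x) = affine a (φ x) :=
  map_wh _ _ _ _

@[simp] theorem map_tri (φ : V → W) (x y u : V) :
    map φ (tri (K := K) x y u) = tri (φ x) (φ y) (φ u) := by
  rw [tri, map_wh, tri]
  congr 1
  funext i; fin_cases i <;> rfl

theorem affine_eq_Ex (a : K) {z : K} (hz : z ≠ 0) (x : V) :
    affine a x = Ex (ph (-(a * z)) 0 (Sum.inr ()) * edge z (Sum.inr ()) (Sum.inl x)) := by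
  have := wh_eq_Ex (-(a * z)) 0 z hz (fun _ : Fin 1 => x)
  rw [zero_div, neg_div, neg_neg, mul_div_cancel_right₀ _ hz, Fin.prod_univ_one] at this
  exact this

theorem tri_eq_Ex {z : K} (hz : z ≠ 0) (x y u : V) :
    tri x y u = Ex (edge z (Sum.inr ()) (Sum.inl x) * (edge z (Sum.inr ()) (Sum.inl y) *
      edge z (Sum.inr ()) (Sum.inl u))) := by
  have := wh_eq_Ex 0 0 z hz ![x, y, u]
  rw [zero_div, zero_div, neg_zero, ph_zero, one_mul, Fin.prod_univ_three, mul_assoc] at this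
  exact this

theorem tri_rotate (x y u : V) : tri (K := K) x y u = tri y u x := by
  rw [tri_eq_Ex one_ne_zero, tri_eq_Ex one_ne_zero, mul_comm, mul_assoc]

theorem den_white_affine (a : K) (α : Empty → V) (β : Unit → V) :
    den (white Empty Unit a 0) α β = affine a (β ()) := by
  rw [den_white, affine, ← wh_equiv _ _ ((Equiv.emptySum Empty Unit).trans finOneEquiv.symm)]
  congr 1
  funext x; rcases x with x | x
  · exact x.elim
  · rfl

theorem den_white_tri_right (α : Unit ⊕ Unit → V) (β : Unit → V) :
    den (white (K := K) (Unit ⊕ Unit) Unit 0 0) α β =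
      tri (α (Sum.inl ())) (α (Sum.inr ())) (β ()) := by
  let e : (Unit ⊕ Unit) ⊕ Unit ≃ Fin 3 :=
    (Equiv.sumCongr ((Equiv.sumCongr finOneEquiv.symm finOneEquiv.symm).trans finSumFinEquiv)
      finOneEquiv.symm).trans finSumFinEquiv
  rw [den_white, tri, ← wh_equiv _ _ e]
  congr 1
  funext x; rcases x with (x | x) | x <;> rfl

theorem den_white_tri_left (α : Unit → V) (β : Unit ⊕ Unit → V) :
    den (white (K := K) Unit (Unit ⊕ Unit) 0 0) α β =
      tri (α ()) (β (Sum.inl ())) (β (Sum.inr ())) := by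
  let e : Unit ⊕ Unit ⊕ Unit ≃ Fin 3 :=
    (Equiv.sumCongr finOneEquiv.symm ((Equiv.sumCongr finOneEquiv.symm finOneEquiv.symm).trans
      finSumFinEquiv)).trans finSumFinEquiv
  rw [den_white, tri, ← wh_equiv _ _ e]
  congr 1
  funext x; rcases x with x | x | x <;> rfl

theorem eqs_const_sum (x : V) (β : Unit ⊕ Unit → V) : eqs (K := K) (fun _ => x) β =
    eqv x (β (Sum.inl ())) * eqv x (β (Sum.inr ())) := eqs_sum _ _

/-- The axiom that affine white states are copied. -/
theorem affine_mul_eqv (a : K) (x y : V) : affine a x * eqv x y = affine a x * affine a y := by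
  have h : white Empty Unit a 0 ⨾ grey Unit (Unit ⊕ Unit) 0 0 =
      wire (Equiv.sumEmpty Empty Empty).symm ⨾ (white Empty Unit a 0 ⊠ white Empty Unit a 0) :=
    mk_eq_mk.2 (Eqv.copy a)
  have h2 := congrArg (fun f => den f Empty.elim (Sum.elim (fun _ => x) (fun _ => y))) h
  beta_reduce at h2
  rw [den_wire_comp, den_tens, den_comp, den_grey_unit_left, ph_zero, one_mul, eqs_const_sum,
    mul_left_comm, den_white_affine, den_white_affine, den_white_affine] at h2
  refine Eq.trans ?_ h2
  refine Eq.trans ?_ (Ex_eqv_symm x _).symm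
  simp

theorem copyable_affine (a : K) : Copyable (affine a (Sum.inr () : V ⊕ Unit)) := by
  simp only [Copyable, map_affine]
  exact affine_mul_eqv _ _ _

/-- The bialgebra axiom, as a copying law. -/
theorem tri_mul_eqv (x y u v : V) : tri (K := K) x y u * eqv u v = tri x y u * tri x y v := by
  have h : white (K := K) (Unit ⊕ Unit) Unit 0 0 ⨾ grey Unit (Unit ⊕ Unit) 0 0 =
      (grey Unit (Unit ⊕ Unit) 0 0 ⊠ grey Unit (Unit ⊕ Unit) 0 0) ⨾
        wire (Equiv.sumSumSumComm Unit Unit Unit Unit) ⨾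
          (white (Unit ⊕ Unit) Unit 0 0 ⊠ white (Unit ⊕ Unit) Unit 0 0) :=
    mk_eq_mk.2 Eqv.bigebra
  have h2 := congrArg (fun f => den f (Sum.elim (fun _ => x) (fun _ => y))
    (Sum.elim (fun _ => u) (fun _ => v))) h
  beta_reduce at h2
  rw [den_comp, den_grey_unit_left, ph_zero, one_mul, eqs_const_sum, mul_left_comm,
    den_comp, den_tens, den_grey_unit_left, den_grey_unit_left, ph_zero, ph_zero, one_mul, one_mul,
    den_wire_comp, den_tens, den_white_tri_right, den_white_tri_right, den_white_tri_right] at h2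
  refine Eq.trans ?_ (h2.trans ?_)
  · refine Eq.trans ?_ (Ex_eqv_symm u _).symm
    simp
  · have h3 := eqs_mul_Ex (tri (K := K) (Sum.inr (Sum.inl (Sum.inl ())))
      (Sum.inr (Sum.inr (Sum.inl ())))
      (Sum.inl u) * tri (Sum.inr (Sum.inl (Sum.inr ()))) (Sum.inr (Sum.inr (Sum.inr ())))
      (Sum.inl v)) (Sum.elim (fun _ => x) (fun _ => y) : (Unit ⊕ Unit) ⊕ (Unit ⊕ Unit) → V)
    rw [eqs_sum, mul_comm] at h3
    refine h3.trans ?_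
    simp

theorem copyable_tri (x y : V) : Copyable (tri (K := K) (Sum.inl x) (Sum.inl y) (Sum.inr ())) := by
  simp only [Copyable, map_tri]
  exact tri_mul_eqv _ _ _ _

end T
end Substitutions
/-! ### Evaluation of affine variables and scalars -/

section Calculus
open Hom
variable {K : Type u} [Field K] {V W : Type}

namespace T
variable [Finite V]

/-- Exchanging two quantifiers, of which the inner one is over a product. -/
theorem Ex_mul_Ex_comm (F G : T K (V ⊕ Unit)) (H : T K ((V ⊕ Unit) ⊕ Unit)) :
    Ex (Ex (map (Sum.map Sum.inl id) G * H) * F) =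
      Ex (G * Ex (map (Sum.elim (Sum.map Sum.inl id) (Sum.inl ∘ Sum.inr)) H *
        map (Sum.map Sum.inl id) F)) := by
  rw [← Ex_mul_map_inl, Ex_swap, ← Ex_map_inl_mul]
  simp only [map_mul, map_map, mul_assoc]
  congr 3
  all_goals congr 1
  all_goals funext x; rcases x with x | x <;> rfl

theorem Ex_tri_mul {z : K} (hz : z ≠ 0) (x y : V) (F : T K (V ⊕ Unit)) :
    Ex (tri (Sum.inl x) (Sum.inl y) (Sum.inr ()) * F) =
      Ex (edge z (Sum.inr ()) (Sum.inl x) * edge z (Sum.inr ()) (Sum.inl y) *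
        Ex (edge z (Sum.inl (Sum.inr ())) (Sum.inr ()) * map (Sum.map Sum.inl id) F)) := by
  rw [tri_eq_Ex hz, ← mul_assoc]
  have h := Ex_mul_Ex_comm F (edge z (Sum.inr ()) (Sum.inl x) * edge z (Sum.inr ()) (Sum.inl y))
    (edge z (Sum.inr ()) (Sum.inl (Sum.inr ())))
  simp only [map_mul, map_edge] at h
  exact h

theorem Ex_el_comp_mul (h k : Hom K Unit Unit) (x : V) (F : T K (V ⊕ Unit)) :
    Ex (el (h ⨾ k) (Sum.inl x) (Sum.inr ()) * F) =
      Ex (el h (Sum.inl x) (Sum.inr ()) *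
        Ex (el k (Sum.inl (Sum.inr ())) (Sum.inr ()) * map (Sum.map Sum.inl id) F)) := by
  rw [← el_comp]
  have h := Ex_mul_Ex_comm F (el h (Sum.inl x) (Sum.inr ()))
    (el k (Sum.inr ()) (Sum.inl (Sum.inr ())))
  simp only [map_el] at h
  exact h

theorem Ex_one [Finite W] : Ex (1 : T K (V ⊕ W)) = 1 := Ex_eq 1 (map_one _).symm

theorem Ex_ph_edge (b : K) {z : K} (hz : z ≠ 0) (x : V) :
    Ex (ph b 0 (Sum.inr ()) * edge z (Sum.inr ()) (Sum.inl x)) = affine (-(b / z)) x := by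
  rw [affine_eq_Ex _ hz, neg_mul, neg_neg, div_mul_cancel₀ _ hz]

theorem Ex_affine_edge (a : K) {z : K} (hz : z ≠ 0) (x : V) :
    Ex (affine a (Sum.inr ()) * edge z (Sum.inr ()) (Sum.inl x)) = ph (a * z) 0 x := by
  rw [affine_eq_Ex a (neg_ne_zero.2 hz)]
  have h := Ex_mul_Ex_comm (edge z (Sum.inr ()) (Sum.inl x)) (ph (-(a * -z)) 0 (Sum.inr ()))
    (edge (-z) (Sum.inr ()) (Sum.inl (Sum.inr ())))
  simp only [map_ph, map_edge] at h
  have h2 := Ex_edge_mul_edge (-z) z (Sum.inr () : V ⊕ Unit) (Sum.inl x)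
  have h3 := box_comp_neg (neg_ne_zero.2 hz)
  rw [neg_neg] at h3
  rw [h3, el_idh] at h2
  refine h.trans ((congrArg (fun t => Ex (_ * t)) h2).trans ?_)
  rw [mul_comm, Ex_eqv_symm, map_ph, mul_neg, neg_neg]
  rfl

theorem Ex_tri_ph_affine (a : K) (x y : V) :
    Ex (tri (Sum.inl x) (Sum.inl y) (Sum.inr ()) * ph a 0 (Sum.inr ())) =
      ph (-a) 0 x * ph (-a) 0 y := by
  rw [Ex_tri_mul one_ne_zero, map_ph, mul_comm, mul_comm (edge _ _ _) (ph _ _ _), edge_comm]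
  have h := Ex_ph_edge a one_ne_zero (Sum.inr () : V ⊕ Unit)
  have h2 := (copyable_affine (K := K) (V := V) (-(a / 1))).Ex_mul
    (edge 1 (Sum.inr ()) (Sum.inl x)) (edge 1 (Sum.inr ()) (Sum.inl y))
  rw [Ex_affine_edge _ one_ne_zero, Ex_affine_edge _ one_ne_zero, ← h, div_one, mul_one] at h2
  exact h2

theorem Ex_tri (x y : V) : Ex (tri (K := K) (Sum.inl x) (Sum.inl y) (Sum.inr ())) = 1 := by
  have := Ex_tri_ph_affine (0 : K) x y
  rwa [neg_zero, ph_zero, ph_zero, ph_zero, mul_one, mul_one] at this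

/-- The decomposition of a box into spiders. -/
theorem edge_eq_Ex (c : K) (x y : V) : edge c x y = ph 0 c x * ph 0 c y *
    Ex (tri (Sum.inl x) (Sum.inl y) (Sum.inr ()) * ph 0 (-c) (Sum.inr ())) := by
  have h : grey Unit Unit 0 c ⨾ white Unit (Unit ⊕ Unit) 0 0 ⨾
      (grey Unit Unit 0 c ⊠ grey Unit Empty 0 (-c)) ⨾ wire (Equiv.sumEmpty Unit Empty) = box c :=
    mk_eq_mk.2 (Eqv.box_spiders c)
  have h2 := congrArg (fun f => el f x y) h
  simp only [el] at h2
  rw [den_grey_unit_comp, den_comp, den_white_tri_left, den_comp_wire, den_tens,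
    den_grey_unit_right, den_grey_unit_left, eqs_empty (A := Empty), mul_one] at h2
  refine h2.symm.trans ?_
  rw [mul_assoc (ph 0 c x)]
  refine congrArg _ ?_
  have h3 : ∀ a b c d : T K (V ⊕ (Unit ⊕ Unit)), a * (b * c * d) = c * (b * (a * d)) := by
    intro a b c d; ac_rfl
  rw [h3, eqs_comm]
  refine (Ex_eqs_inl (fun _ : Unit => y) _).trans ?_
  simp only [map_mul, map_ph, map_tri]
  rw [Ex_mul_left (ph 0 c y) (by simp)]
  rfl

theorem edge_zero (x y : V) : edge (0 : K) x y = 1 := by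
  rw [edge_eq_Ex, neg_zero, ph_zero, ph_zero, ph_zero, mul_one, mul_one, one_mul, Ex_tri]

/-- The axiom on trivial scalars, with its vertex as a quantified variable. -/
theorem Ex_ph (a : K) {z : K} (hz : z ≠ 0) : Ex (ph a z (Sum.inr () : V ⊕ Unit)) = 1 := by
  have h : grey Empty Empty a z = idh Empty := mk_eq_mk.2 (Eqv.one_phase a z hz)
  have h2 := sp_eq_Ex a z (Empty.elim : Empty → V)
  rw [Finset.univ_eq_empty, Finset.prod_empty, mul_one, sp, h, ← grey_empty] at h2
  rw [← h2]
  have h3 := sp_eq_Ex (0 : K) 0 (Empty.elim : Empty → V)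
  rwa [Finset.univ_eq_empty, Finset.prod_empty, mul_one, ph_zero, Ex_one] at h3

/-- Supplementarity. -/
theorem Ex_ph_neg_edge (a : K) {c : K} (hc : c ≠ 0) (y : V) :
    Ex (ph a (-c) (Sum.inr ()) * edge c (Sum.inr ()) (Sum.inl y)) = ph (-a) c y := by
  have h1 : ∀ (p q r s : T K (V ⊕ Unit)), p * (q * r * s) = r * (p * q * s) := by
    intros; ac_rfl
  rw [edge_eq_Ex, h1, ph_mul_ph, Ex_mul_left (ph 0 c y) (by simp), add_zero, neg_add_cancel,
    mul_comm (ph a 0 _)]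
  have h2 := Ex_mul_Ex_comm (ph a 0 (Sum.inr () : V ⊕ Unit)) (ph 0 (-c) (Sum.inr ()))
    (tri (Sum.inl (Sum.inr ())) (Sum.inl (Sum.inl y)) (Sum.inr ()))
  simp only [map_ph, map_tri] at h2
  have h3 := Ex_tri_ph_affine a (Sum.inl y : V ⊕ Unit) (Sum.inr ())
  have h4 := (congrArg (fun t => Ex (ph 0 (-c) (Sum.inr ()) * t))
    ((congrArg (fun t => Ex (t * ph a 0 (Sum.inr ()))) (tri_rotate _ _ _)).trans h3)).symm
  rw [mul_left_comm, Ex_mul_left (ph (-a) 0 y) (by simp), ph_mul_ph, Ex_ph _ (by simpa),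
    mul_one] at h4
  rw [mul_comm (tri _ _ _)]
  exact (congrArg _ (h2.trans h4.symm)).trans (by rw [ph_mul_ph, zero_add, add_zero])

/-- A phase at a variable whose value is fixed is a trivial scalar. -/
theorem Ex_affine_ph (a e b : K) :
    Ex (affine a (Sum.inr () : V ⊕ Unit) * ph e b (Sum.inr ())) = 1 := by
  have h : ∀ (e : K) {b : K}, b ≠ 0 →
      Ex (affine a (Sum.inr () : V ⊕ Unit) * ph e b (Sum.inr ())) = 1 := by
    intro e b hb
    rw [affine_eq_Ex a (neg_ne_zero.2 hb)]
    have h := Ex_mul_Ex_comm (V := V) (ph e b (Sum.inr ())) (ph (-(a * -b)) 0 (Sum.inr ()))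
      (edge (-b) (Sum.inr ()) (Sum.inl (Sum.inr ())))
    simp only [map_ph, map_edge] at h
    have h2 := Ex_ph_neg_edge e (neg_ne_zero.2 hb) (Sum.inr () : V ⊕ Unit)
    rw [neg_neg, mul_comm, edge_comm] at h2
    refine h.trans ((congrArg (fun t => Ex (_ * t)) h2).trans ?_)
    rw [ph_mul_ph, Ex_ph]
    simpa
  by_cases hb : b = 0
  · have h2 := (copyable_affine (K := K) (V := V) a).Ex_mul
      (ph e 1 (Sum.inr ())) (ph 0 (-1) (Sum.inr ()))
    rwa [ph_mul_ph, h _ one_ne_zero, h _ (neg_ne_zero.2 one_ne_zero), mul_one, add_zero,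
      add_neg_cancel, ← hb] at h2
  · exact h e hb

end T
end Calculus
/-! ### Linear substitutions -/

section LinearSubstitutions
open Hom
variable {K : Type u} [Field K] {V W : Type}

namespace T
variable [Finite V]

theorem subst_apply (Q : T K (V ⊕ Unit)) (h : Copyable Q) (h1 : Ex Q = 1) (F : T K (V ⊕ Unit)) :
    subst Q h h1 F = Ex (Q * F) := rfl

theorem subst_map_inl (Q : T K (V ⊕ Unit)) (h : Copyable Q) (h1 : Ex Q = 1) (f : T K V) :
    subst Q h h1 (map Sum.inl f) = f := by
  rw [subst_apply, Ex_mul_map_inl, h1, one_mul]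

/-- The formula saying that `y` is `d` times `x`. -/
noncomputable def lin (d : K) (x y : V) : T K V := el (box d ⨾ box (-1)) x y

@[simp] theorem map_lin (φ : V → W) [Finite W] (d : K) (x y : V) :
    map φ (lin d x y) = lin d (φ x) (φ y) := map_el _ _ _ _

theorem Ex_edge (z : K) (hz : z ≠ 0) (x : V) :
    Ex (edge z (Sum.inr ()) (Sum.inl x)) = affine 0 x := by
  have := Ex_ph_edge 0 hz x
  rwa [zero_div, neg_zero, ph_zero, one_mul] at this

theorem lin_zero (x y : V) : lin (0 : K) x y = affine 0 y := by
  rw [lin, ← Ex_edge_mul_edge, edge_zero, one_mul, Ex_edge _ (neg_ne_zero.2 one_ne_zero)]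

theorem lin_one (x y : V) : lin (1 : K) x y = eqv x y := by
  rw [lin, box_one_comp_neg_one, el_idh]

theorem Ex_mul_el_comp (G : T K (V ⊕ Unit)) (h k : Hom K Unit Unit) (u : V) :
    Ex (Ex (map (Sum.map Sum.inl id) G * el h (Sum.inr ()) (Sum.inl (Sum.inr ()))) *
      el k (Sum.inr ()) (Sum.inl u)) = Ex (G * el (h ⨾ k) (Sum.inr ()) (Sum.inl u)) := by
  rw [Ex_mul_Ex_comm, ← el_comp]
  simp

/-- Multiplication by a scalar is a function: its value is copied. -/
theorem lin_mul_eqv (d : K) (t u v : V) :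
    lin d t u * eqv u v = lin d t u * lin d t v := by
  by_cases hd : d = 0
  · rw [hd, lin_zero, lin_zero, affine_mul_eqv]
  -- the two expressions of the white spider with three legs in terms of grey ones, with boxes `d`
  -- and with boxes `1`, are compared, once two legs are composed with a box `-1`
  have h1 : ∀ {V : Type} [Finite V] (z : K), z ≠ 0 → ∀ x y v : V,
      Ex (tri (Sum.inl x) (Sum.inl y) (Sum.inr ()) * edge (-1) (Sum.inr ()) (Sum.inl v)) =
        Ex (edge z (Sum.inr ()) (Sum.inl x) * edge z (Sum.inr ()) (Sum.inl y) *
          lin z (Sum.inr ()) (Sum.inl v)) := by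
    intro V _ z hz x y v
    rw [Ex_tri_mul hz, map_edge]
    exact congrArg (fun t => Ex (_ * t)) (el_comp _ _ _ _)
  have h2 : ∀ {V : Type} [Finite V] (x y v : V),
      Ex (edge d (Sum.inr ()) (Sum.inl x) * edge d (Sum.inr ()) (Sum.inl y) *
          lin d (Sum.inr ()) (Sum.inl v)) = edge 1 v x * edge 1 v y := by
    intro V _ x y v
    rw [← h1 d hd, h1 1 one_ne_zero, lin_one, mul_comm, Ex_eqv_symm]
    simp
  have h3 : ∀ {V : Type} [Finite V] (x u v : V),
      Ex (edge d (Sum.inr ()) (Sum.inl x) * lin d (Sum.inr ()) (Sum.inl u) *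
          lin d (Sum.inr ()) (Sum.inl v)) = edge 1 v x * eqv v u := by
    intro V _ x u v
    have h := Ex_mul_el_comp (edge d (Sum.inr ()) (Sum.inl x) * lin d (Sum.inr ()) (Sum.inl v))
      (box d) (box (-1)) u
    simp only [map_mul, map_edge, map_lin] at h
    rw [mul_right_comm]
    refine h.symm.trans ?_
    have h4 := h2 (Sum.inl x) (Sum.inr ()) (Sum.inl v : V ⊕ Unit)
    rw [mul_right_comm] at h4
    refine (congrArg (fun t => Ex (t * _)) h4).trans ?_
    rw [mul_assoc, Ex_mul_left (edge 1 v x) (by simp)]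
    refine congrArg _ ((el_comp _ _ _ _).trans ?_)
    rw [box_one_comp_neg_one, el_idh]
  have h := Ex_mul_el_comp (lin d (Sum.inr ()) (Sum.inl v) * lin d (Sum.inr ()) (Sum.inl u))
    (box d) (box (-d)) t
  rw [box_comp_neg hd, el_idh, mul_comm _ (eqv _ _), Ex_eqv_symm] at h
  simp only [map_mul, map_lin] at h
  rw [mul_comm (lin d t u) (lin d t v)]
  refine Eq.trans ?_ h
  have h4 := h3 (Sum.inr ()) (Sum.inl v) (Sum.inl u : V ⊕ Unit)
  rw [mul_assoc, mul_comm] at h4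
  refine Eq.trans ?_ (congrArg (fun t => Ex (t * _)) h4.symm)
  rw [mul_right_comm, mul_comm (_ * _) (eqv _ _), Ex_mul_left (eqv u v) (by simp),
    mul_comm (lin d t u)]
  refine congrArg _ (Eq.symm ((el_comp _ _ _ _).trans ?_))
  rw [el_box_comp_box, box_neg_comp_one]
  rfl

theorem copyable_lin (d : K) (x : V) : Copyable (lin d (Sum.inl x) (Sum.inr ())) := by
  simp only [Copyable, map_lin]
  exact lin_mul_eqv _ _ _ _

theorem Ex_lin_mul_ph (d a b : K) (x : V) :
    Ex (lin d (Sum.inl x) (Sum.inr ()) * ph a b (Sum.inr ())) = ph (d * a) (d ^ 2 * b) x := by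
  by_cases hd : d = 0
  · rw [hd, lin_zero, Ex_affine_ph, zero_mul, zero_pow two_ne_zero, zero_mul, ph_zero]
  have h1 : ∀ {V : Type} [Finite V] (x : V) (a b : K) {z : K}, z ≠ 0 →
      Ex (edge z (Sum.inl x) (Sum.inr ()) * ph a b (Sum.inr ())) =
        wh (-(a / z)) (b / z ^ 2) (fun _ : Fin 1 => x) := by
    intro V _ x a b z hz
    rw [wh_eq_Ex _ _ _ hz, Fin.prod_univ_one, mul_comm, edge_comm]
  have h2 := h1 (Sum.inr () : V ⊕ Unit) a b (neg_ne_zero.2 one_ne_zero)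
  have h3 := h1 (Sum.inr () : V ⊕ Unit) (d * a) (d ^ 2 * b) (neg_ne_zero.2 hd)
  have e1 : -(a / -1) = -(d * a / -d) := by field_simp
  have e2 : b / (-1) ^ 2 = d ^ 2 * b / (-d) ^ 2 := by field_simp
  rw [e1, e2, ← h3] at h2
  rw [lin, Ex_el_comp_mul, map_ph]
  refine (congrArg (fun t => Ex (_ * t)) h2).trans ?_
  have h4 := Ex_el_comp_mul (box d) (box (-d)) x (ph (d * a) (d ^ 2 * b) (Sum.inr ()))
  rw [box_comp_neg hd, el_idh, Ex_eqv, map_ph, map_ph] at h4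
  exact h4.symm

theorem Ex_lin (d : K) (x : V) : Ex (lin d (Sum.inl x) (Sum.inr ())) = 1 := by
  have := Ex_lin_mul_ph d 0 0 x
  rwa [mul_zero, mul_zero, ph_zero, ph_zero, mul_one] at this

/-- Substituting `d` times the variable `x` for the last variable. -/
noncomputable def scale (d : K) (x : V) : T K (V ⊕ Unit) →* T K V :=
  subst _ (copyable_lin d x) (Ex_lin d x)

theorem scale_map_inl (d : K) (x : V) (f : T K V) : scale d x (map Sum.inl f) = f :=
  subst_map_inl _ _ _ _

theorem scale_ph (d a b : K) (x : V) :
    scale d x (ph a b (Sum.inr ())) = ph (d * a) (d ^ 2 * b) x := Ex_lin_mul_ph _ _ _ _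

theorem scale_edge (d e : K) (x y : V) :
    scale d x (edge e (Sum.inr ()) (Sum.inl y)) = edge (d * e) x y := by
  refine (el_comp _ _ _ _).trans ?_
  rw [comp_assoc, box_mul]
  rfl

theorem tri_self (y u : V) : tri (K := K) y y u = lin (-2) y u := by
  rw [tri_eq_Ex one_ne_zero, ← mul_assoc, edge_add, edge_comm, Ex_edge_mul_edge, lin,
    ← box_neg_comp_one, neg_neg, one_add_one_eq_two]

/-- A box that joins a vertex to itself changes its phase. -/
theorem edge_self (c : K) (x : V) : edge c x x = ph 0 (-(2 * c)) x := by
  rw [edge_eq_Ex, tri_self, Ex_lin_mul_ph, ph_mul_ph, ph_mul_ph]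
  congr 1 <;> ring

/-- Substituting `-(x + y)` for the last variable. -/
noncomputable def negAdd (x y : V) : T K (V ⊕ Unit) →* T K V :=
  subst _ (copyable_tri x y) (Ex_tri x y)

theorem negAdd_ph (x y : V) (a b : K) :
    negAdd x y (ph a b (Sum.inr ())) = ph (-a) b x * ph (-a) b y * edge (-b) x y := by
  have h1 : negAdd x y (ph a 0 (Sum.inr ())) = ph (-a) 0 x * ph (-a) 0 y := Ex_tri_ph_affine a x y
  have h2 : edge (-b) x y = ph 0 (-b) x * ph 0 (-b) y * negAdd x y (ph 0 b (Sum.inr ())) := by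
    rw [edge_eq_Ex, neg_neg]; rfl
  have h3 : ∀ p q r s t : T K V, p * q * (r * s * t) = (p * r) * (q * s) * t := by
    intros; ac_rfl
  have h4 : ph a b (Sum.inr () : V ⊕ Unit) = ph a 0 (Sum.inr ()) * ph 0 b (Sum.inr ()) := by
    rw [ph_mul_ph, add_zero, zero_add]
  rw [h2, h3, ph_mul_ph, ph_mul_ph, h4, _root_.map_mul, h1]
  simp

theorem negAdd_edge (x y k : V) (e : K) :
    negAdd x y (edge e (Sum.inr ()) (Sum.inl k)) = edge (-e) x k * edge (-e) y k := by
  have h := _root_.map_mul (scale (-e) k) (edge 1 (Sum.inr ()) (Sum.inl x))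
    (edge 1 (Sum.inr ()) (Sum.inl y))
  rw [scale_edge, scale_edge, mul_one, edge_comm (-e) k x, edge_comm (-e) k y] at h
  refine Eq.trans ?_ h
  refine (Ex_tri_mul one_ne_zero x y _).trans ?_
  rw [map_edge, mul_comm]
  refine congrArg (fun t => Ex (t * _)) ?_
  refine (el_comp _ _ _ _).trans ?_
  rw [box_one_comp, el_box_comp_box]
  rfl

end T
end LinearSubstitutions
/-! ### Changes of variables -/

section Shears
open Hom
variable {K : Type u} [Field K] {V W : Type}

namespace T
variable [Finite V] [Finite W]

/-- Renaming variables, as a homomorphism of monoids. -/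
noncomputable def mapHom (φ : V → W) : T K V →* T K W where
  toFun := map φ
  map_one' := map_one φ
  map_mul' := map_mul φ

/-- The change of variables that replaces the last variable `x` by `-(x + c * j)`. -/
noncomputable def negShear (j : V) (c : K) : T K (V ⊕ Unit) →* T K (V ⊕ Unit) :=
  (scale c (Sum.inl j)).comp ((negAdd (Sum.inl (Sum.inr ())) (Sum.inr ())).comp
    (mapHom (Sum.map (Sum.inl ∘ Sum.inl) id)))

theorem negShear_apply (j : V) (c : K) (F : T K (V ⊕ Unit)) :
    negShear j c F = scale c (Sum.inl j) (negAdd (Sum.inl (Sum.inr ())) (Sum.inr ())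
      (map (Sum.map (Sum.inl ∘ Sum.inl) id) F)) := rfl

theorem negShear_ph (j : V) (a b c : K) : negShear j c (ph a b (Sum.inr ())) =
    ph (-a) b (Sum.inr ()) * ph (-(c * a)) (c ^ 2 * b) (Sum.inl j) *
      edge (-(c * b)) (Sum.inr ()) (Sum.inl j) := by
  have h1 := scale_map_inl c (Sum.inl j) (ph (-a) b (Sum.inr () : V ⊕ Unit))
  rw [map_ph] at h1
  rw [negShear_apply, map_ph]
  refine (congrArg _ (negAdd_ph _ _ a b)).trans ?_
  rw [_root_.map_mul, _root_.map_mul, h1, scale_ph, edge_comm, scale_edge, edge_comm, mul_neg,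
    mul_neg]

theorem negShear_edge (j k : V) (c e : K) : negShear j c (edge e (Sum.inr ()) (Sum.inl k)) =
    edge (-e) (Sum.inr ()) (Sum.inl k) * edge (-(c * e)) (Sum.inl j) (Sum.inl k) := by
  have h1 := scale_map_inl c (Sum.inl j) (edge (-e) (Sum.inr ()) (Sum.inl k : V ⊕ Unit))
  rw [map_edge] at h1
  rw [negShear_apply, map_edge]
  refine (congrArg _ (negAdd_edge _ _ (Sum.inl (Sum.inl k)) e)).trans ?_
  rw [_root_.map_mul, h1, scale_edge, mul_neg]

/-- The change of variables `negShear` is invertible, so it does not affect a quantified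
variable. -/
theorem Ex_negShear (j : V) (c : K) (F : T K (V ⊕ Unit)) : Ex (negShear j c F) = Ex F := by
  have h : negShear j c F = Ex (lin c (Sum.inl (Sum.inl j)) (Sum.inr ()) *
    Ex (tri (Sum.inl (Sum.inl (Sum.inr ()))) (Sum.inl (Sum.inr ())) (Sum.inr ()) *
      map (Sum.map (Sum.inl ∘ Sum.inl) id) F)) := rfl
  have h1 : ∀ {W : Type} [Finite W] (y : W) (f : T K (W ⊕ Unit)),
      Ex (Ex (tri (Sum.inl (Sum.inr ())) (Sum.inl (Sum.inl y)) (Sum.inr ()) *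
        map (Sum.map Sum.inl id) f)) = Ex f := by
    intro W _ y f
    have h2 := Ex_mul_Ex_comm 1 f
      (tri (Sum.inl (Sum.inr ())) (Sum.inl (Sum.inl y)) (Sum.inr ()))
    rw [mul_one, map_one, mul_one, map_tri, mul_comm] at h2
    have h3 := Ex_tri (K := K) (Sum.inl y) (Sum.inr () : W ⊕ Unit)
    rw [← tri_rotate] at h3
    exact h2.trans ((congrArg (fun t => Ex (f * t)) h3).trans (by rw [mul_one]))
  have h2 := h1 (Sum.inr () : V ⊕ Unit) (map (Sum.map Sum.inl id) F)
  rw [h, Ex_swap, map_mul, map_lin, map_Ex, map_mul, map_tri, map_map]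
  rw [Ex_mul_left (lin c (Sum.inl j) (Sum.inr ())) (by simp)]
  rw [map_map] at h2
  have h3 := congrArg (fun t => Ex (lin c (Sum.inl j) (Sum.inr ()) * t)) h2
  beta_reduce at h3
  rw [← map_Ex, Ex_mul_map_inl, Ex_lin, one_mul] at h3
  refine Eq.trans (congrArg (fun t => Ex (_ * t)) (congrArg
     Ex (congrArg Ex (congrArg (fun t => _ * t) ?_)))) h3
  refine congrFun (congrArg _ ?_) F
  funext x; rcases x with x | x <;> rfl

/-- The change of variables that replaces the last variable `x` by `x + c * j`. -/
noncomputable def shear (j : V) (c : K) : T K (V ⊕ Unit) →* T K (V ⊕ Unit) :=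
  (negShear j c).comp (negShear j 0)

theorem shear_ph (j : V) (a b c : K) : shear j c (ph a b (Sum.inr ())) =
    ph a b (Sum.inr ()) * ph (c * a) (c ^ 2 * b) (Sum.inl j) *
      edge (-(c * b)) (Sum.inr ()) (Sum.inl j) := by
  rw [shear, MonoidHom.comp_apply, negShear_ph, zero_mul, zero_mul, neg_zero, zero_pow two_ne_zero,
    zero_mul, ph_zero, edge_zero, mul_one, mul_one, negShear_ph, neg_neg, mul_neg, neg_neg]

theorem shear_edge (j k : V) (c e : K) : shear j c (edge e (Sum.inr ()) (Sum.inl k)) =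
    edge e (Sum.inr ()) (Sum.inl k) * edge (c * e) (Sum.inl j) (Sum.inl k) := by
  rw [shear, MonoidHom.comp_apply, negShear_edge, zero_mul, neg_zero, edge_zero, mul_one,
    negShear_edge, neg_neg, mul_neg, neg_neg]

theorem Ex_shear (j : V) (c : K) (F : T K (V ⊕ Unit)) : Ex (shear j c F) = Ex F := by
  rw [shear, MonoidHom.comp_apply, Ex_negShear, Ex_negShear]

/-- The constraint on the variable `x` that is imposed by a quantified vertex of phase `(b, 0)`,
joined to `x` by a box `e` and to the variables in `t` by boxes `F u`. It determines the value
of `x`, and the box `c` between `x` and `w` can be evaluated at this value. -/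
theorem edge_mul_Ex_constraint {ι : Type} (b : K) {e : K} (he : e ≠ 0) (φ : ι → V) (F : ι → K)
    (t : Finset ι) (c : K) (x w : V) :
    edge c x w * Ex (ph b 0 (Sum.inr ()) * edge e (Sum.inr ()) (Sum.inl x) *
      ∏ u ∈ t, edge (F u) (Sum.inr ()) (Sum.inl (φ u))) =
    ph (-(c / e) * b) 0 w * (∏ u ∈ t, edge (-(c / e) * F u) w (φ u)) *
      Ex (ph b 0 (Sum.inr ()) * edge e (Sum.inr ()) (Sum.inl x) *
        ∏ u ∈ t, edge (F u) (Sum.inr ()) (Sum.inl (φ u))) := by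
  set G := ph b 0 (Sum.inr () : V ⊕ Unit) * edge e (Sum.inr ()) (Sum.inl x) *
    ∏ u ∈ t, edge (F u) (Sum.inr ()) (Sum.inl (φ u)) with hG
  have h : shear w (-(c / e)) G = map Sum.inl (ph (-(c / e) * b) 0 w *
      (∏ u ∈ t, edge (-(c / e) * F u) w (φ u)) * edge (-c) x w) * G := by
    rw [hG, _root_.map_mul, _root_.map_mul, _root_.map_prod, shear_ph, shear_edge, mul_zero,
      mul_zero, neg_zero, edge_zero, mul_one]
    simp only [shear_edge, Finset.prod_mul_distrib, map_mul, map_prod, map_ph, map_edge]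
    rw [neg_mul _ e, div_mul_cancel₀ _ he, edge_comm (-c)]
    ac_rfl
  conv_lhs => rw [← Ex_shear w (-(c / e)) G, h, Ex_map_inl_mul, ← mul_assoc, mul_left_comm,
    edge_add, add_neg_cancel, edge_zero, mul_one]

end T
end Shears
/-! ### Quadratic formulas -/

section QuadraticFormulas
open Hom Matrix
variable {K : Type u} [Field K] {V W I : Type}

namespace T
variable [Fintype V] [Fintype W] [Fintype I]

/-- The product of phases `(y v, d v)` at all variables `v` and of boxes `B u v` between all pairs
of variables. -/
noncomputable def quad (y d : V → K) (B : Matrix V V K) : T K V :=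
  (∏ v, ph (y v) (d v) v) * ∏ p : V × V, edge (B p.1 p.2) p.1 p.2

theorem quad_mul_quad (y d y' d' : V → K) (B B' : Matrix V V K) :
    quad y d B * quad y' d' B' = quad (y + y') (d + d') (B + B') := by
  simp only [quad, Pi.add_apply, Matrix.add_apply, ← ph_mul_ph, ← edge_add, Finset.prod_mul_distrib]
  ac_rfl

/-- Boxes between distinct variables cancel in pairs, and boxes at a single variable cancel its
phase. -/
theorem quad_eq_one [DecidableEq V] (d : V → K) (B : Matrix V V K)
    (h : diagonal d = B + Bᵀ) : quad 0 d B = 1 := by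
  have h1 : ∏ p ∈ (Finset.univ : Finset V).offDiag, edge (B p.1 p.2) p.1 p.2 = (1 : T K V) := by
    refine Finset.prod_involution (fun p _ => p.swap) ?_ ?_ ?_ ?_
    · intro p hp
      have hne : p.1 ≠ p.2 := (Finset.mem_offDiag.1 hp).2.2
      have h2 := congrFun (congrFun h p.1) p.2
      rw [diagonal_apply_ne _ hne, Matrix.add_apply, transpose_apply] at h2
      rw [Prod.fst_swap, Prod.snd_swap, edge_comm (B p.2 p.1), edge_add, ← h2, edge_zero]
    · intro p hp _ hs
      exact (Finset.mem_offDiag.1 hp).2.2 (congrArg Prod.snd hs)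
    · intro p hp
      simp only [Finset.mem_offDiag, Finset.mem_univ, true_and, Prod.fst_swap,
        Prod.snd_swap] at hp ⊢
      exact hp.symm
    · intro p _; rfl
  have h3 := Finset.prod_union (f := fun p : V × V => edge (K := K) (B p.1 p.2) p.1 p.2)
    (Finset.disjoint_diag_offDiag (Finset.univ : Finset V))
  rw [Finset.diag_union_offDiag, h1, mul_one, Finset.univ_product_univ] at h3
  rw [quad, h3, Finset.prod_diag, ← Finset.prod_mul_distrib]
  refine Finset.prod_eq_one fun v _ => ?_
  have h2 := congrFun (congrFun h v) v
  rw [diagonal_apply_eq, Matrix.add_apply, transpose_apply] at h2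
  rw [edge_self, ph_mul_ph, h2, Pi.zero_apply, add_zero, ← two_mul, add_neg_cancel, ph_zero]

/-- A formula is quadratic of phase `(y, S)` if it is the formula of the graph state of this
phase. The boxes between pairs of variables that make up the off-diagonal entries of `S` are not
unique, as the two orders of a pair contribute to the same entry. -/
def IsQuad [DecidableEq V] (f : T K V) (y : V → K) (S : Matrix V V K) : Prop :=
  ∃ d B, f = quad y d B ∧ S = diagonal d - B - Bᵀ

variable [DecidableEq V] [DecidableEq W] [DecidableEq I]

namespace IsQuad

/-- A quadratic formula is determined by its phase. -/
theorem unique {f g : T K V} {y : V → K} {S : Matrix V V K} (hf : IsQuad f y S)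
    (hg : IsQuad g y S) : f = g := by
  obtain ⟨d, B, rfl, rfl⟩ := hf
  obtain ⟨d', B', rfl, h⟩ := hg
  have h1 : quad 0 (d - d') (B - B') = 1 := by
    refine quad_eq_one _ _ ?_
    rw [Matrix.transpose_sub, show diagonal (d - d') = diagonal d - diagonal d' from
      (diagonal_sub _ _).symm]
    have : diagonal d - diagonal d' = (diagonal d - B - Bᵀ) - (diagonal d' - B' - B'ᵀ) +
      ((B - B') + (Bᵀ - B'ᵀ)) := by abel
    rw [this, h, sub_self, zero_add]
  have h2 := quad_mul_quad y d' 0 (d - d') B' (B - B')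
  rw [h1, mul_one, add_zero, add_sub_cancel, add_sub_cancel] at h2
  exact h2.symm

theorem congr {f : T K V} {y y' : V → K} {S S' : Matrix V V K} (h : IsQuad f y S)
    (hy : y = y') (hS : S = S') : IsQuad f y' S' := hy ▸ hS ▸ h

theorem mul {f g : T K V} {y y' : V → K} {S S' : Matrix V V K} (hf : IsQuad f y S)
    (hg : IsQuad g y' S') : IsQuad (f * g) (y + y') (S + S') := by
  obtain ⟨d, B, rfl, rfl⟩ := hf
  obtain ⟨d', B', rfl, rfl⟩ := hg
  refine ⟨d + d', B + B', quad_mul_quad _ _ _ _ _ _, ?_⟩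
  rw [transpose_add, show diagonal (d + d') = diagonal d + diagonal d' from
    (diagonal_add _ _).symm]
  abel

theorem one : IsQuad (1 : T K V) 0 0 :=
  ⟨0, 0, (quad_eq_one 0 0 (by simp)).symm, by simp⟩

theorem prod {ι : Type*} (s : Finset ι) (f : ι → T K V) (y : ι → V → K) (S : ι → Matrix V V K)
    (h : ∀ i, IsQuad (f i) (y i) (S i)) :
    IsQuad (∏ i ∈ s, f i) (∑ i ∈ s, y i) (∑ i ∈ s, S i) := by
  classical
  induction s using Finset.induction_on with
  | empty => simpa using one
  | insert i s hi ih =>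
    rw [Finset.prod_insert hi, Finset.sum_insert hi, Finset.sum_insert hi]
    exact (h i).mul ih

theorem of_ph (a b : K) (v : V) : IsQuad (ph a b v) (Pi.single v a) (Matrix.single v v b) := by
  refine ⟨Pi.single v b, 0, ?_, ?_⟩
  · simp only [quad, Matrix.zero_apply, edge_zero, Finset.prod_const_one, mul_one]
    rw [Finset.prod_eq_single v]
    · simp
    · intro u _ hu
      rw [Pi.single_eq_of_ne hu, Pi.single_eq_of_ne hu, ph_zero]
    · simp
  · rw [diagonal_single]
    simp

theorem of_edge (c : K) (u v : V) :
    IsQuad (edge c u v) 0 (-Matrix.single u v c - Matrix.single v u c) := by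
  refine ⟨0, Matrix.single u v c, ?_, by simp⟩
  simp only [quad, Pi.zero_apply, ph_zero, Finset.prod_const_one, one_mul]
  rw [Finset.prod_eq_single (u, v)]
  · simp
  · intro p _ hp
    rw [Matrix.single_apply_of_ne, edge_zero]
    rintro ⟨h1, h2⟩
    exact hp (Prod.ext h1.symm h2.symm)
  · simp

theorem map_equiv (e : V ≃ W) {f : T K V} {y : V → K} {S : Matrix V V K} (h : IsQuad f y S) :
    IsQuad (map e f) (y ∘ e.symm) (S.submatrix e.symm e.symm) := by
  obtain ⟨d, B, rfl, rfl⟩ := h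
  refine ⟨d ∘ e.symm, B.submatrix e.symm e.symm, ?_, ?_⟩
  · rw [quad, quad, map_mul, map_prod, map_prod, ← e.prod_comp, ← (e.prodCongr e).prod_comp]
    simp
  · ext u v
    simp [diagonal_apply]

theorem map_inl {f : T K V} {y : V → K} {S : Matrix V V K} (h : IsQuad f y S) :
    IsQuad (map (Sum.inl : V → V ⊕ I) f) (Sum.elim y 0) (fromBlocks S 0 0 0) := by
  obtain ⟨d, B, rfl, rfl⟩ := h
  refine ⟨Sum.elim d 0, fromBlocks B 0 0 0, ?_, ?_⟩
  · simp [quad, map_prod, Fintype.prod_prod_type, ph_zero, edge_zero]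
  · ext u v
    rcases u with u | u <;> rcases v with v | v <;> simp [diagonal_apply]

theorem map_inr {f : T K I} {y : I → K} {S : Matrix I I K} (h : IsQuad f y S) :
    IsQuad (map (Sum.inr : I → V ⊕ I) f) (Sum.elim 0 y) (fromBlocks 0 0 0 S) := by
  have := (h.map_inl (I := V)).map_equiv (Equiv.sumComm I V)
  rw [map_map] at this
  refine this.congr ?_ ?_
  · funext x; rcases x with x | x <;> rfl
  · ext x y; rcases x with x | x <;> rcases y with y | y <;> rfl

theorem prod_edge (P : Matrix I V K) :
    IsQuad (∏ i, ∏ v, edge (P i v) (Sum.inr i) (Sum.inl v) : T K (V ⊕ I)) 0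
      (fromBlocks 0 (-Pᵀ) (-P) 0) := by
  refine ⟨0, fromBlocks 0 0 P 0, ?_, ?_⟩
  · simp [quad, Fintype.prod_prod_type, ph_zero, edge_zero]
  · ext u v
    rcases u with u | u <;> rcases v with v | v <;> simp

/-- A quadratic formula in two sets of variables is a product of a formula in the first ones, of a
formula in the second ones, and of boxes between them. -/
theorem exists_block {f : T K (V ⊕ I)} {y : V → K} {x : I → K} {A : Matrix V V K}
    {P : Matrix I V K} {M : Matrix I I K} (h : IsQuad f (Sum.elim y x) (fromBlocks A Pᵀ P M)) :
    ∃ g k, IsQuad g y A ∧ IsQuad k x M ∧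
      f = map Sum.inl g * map Sum.inr k * ∏ i, ∏ v, edge (-P i v) (Sum.inr i) (Sum.inl v) := by
  obtain ⟨d, B, rfl, hS⟩ := id h
  have h1 : IsQuad (quad y (d ∘ Sum.inl) B.toBlocks₁₁) y A := ⟨_, _, rfl, by
    ext u v
    have := congrFun (congrFun hS (Sum.inl u)) (Sum.inl v)
    simpa [diagonal_apply, toBlocks₁₁] using this⟩
  have h2 : IsQuad (quad x (d ∘ Sum.inr) B.toBlocks₂₂) x M := ⟨_, _, rfl, by
    ext u v
    have := congrFun (congrFun hS (Sum.inr u)) (Sum.inr v)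
    simpa [diagonal_apply, toBlocks₂₂] using this⟩
  refine ⟨_, _, h1, h2, h.unique (((h1.map_inl.mul h2.map_inr).mul (prod_edge (-P))).congr ?_ ?_)⟩
  · funext x; rcases x with x | x <;> simp
  · simp [fromBlocks_add]

end IsQuad
end T
end QuadraticFormulas
/-! ### Elimination of a vertex and of a pair of vertices -/

section Elimination
open Hom Matrix
variable {K : Type u} [Field K] {V W I J : Type}

namespace T
variable [Fintype V] [Fintype W] [Fintype I] [Fintype J]
  [DecidableEq V] [DecidableEq W] [DecidableEq I] [DecidableEq J]

/-- A phase as a matrix is a multiple of a projection. -/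
theorem IsQuad.of_ph_smul (a b : K) (v : V) : IsQuad (ph a b v) (a • Pi.single v 1)
    (b • vecMulVec (Pi.single v 1) (Pi.single v 1)) := by
  refine (IsQuad.of_ph a b v).congr ?_ ?_
  · rw [← Pi.single_smul]; simp
  · rw [← single_eq_single_vecMulVec_single]; simp

/-- The star of boxes from `w` to the variables in `s`, as a symmetrized product of vectors. -/
theorem IsQuad.prod_edge_insert (w : V) (F : V → K) (s : Finset V) :
    IsQuad (∏ u ∈ s, edge (F u) w u) 0
      (-vecMulVec (Pi.single w 1) (fun u => if u ∈ s then F u else 0) -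
        vecMulVec (fun u => if u ∈ s then F u else 0) (Pi.single w 1)) := by
  refine (IsQuad.prod s _ _ (fun u => -Matrix.single w u (F u) - Matrix.single u w (F u))
    fun u => IsQuad.of_edge (F u) w u).congr (by simp) ?_
  ext i j
  simp only [Matrix.sum_apply, Matrix.sub_apply, Matrix.neg_apply, vecMulVec_apply,
    Finset.sum_sub_distrib, Finset.sum_neg_distrib, Matrix.single_apply, Pi.single_apply]
  have h2 : ∀ i j : V, (∑ u ∈ s, if w = i ∧ u = j then F u else 0) =
      (if i = w then 1 else 0) * if j ∈ s then F j else 0 := by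
    intro i j
    by_cases hi : i = w
    · simp [hi]
    · simp [hi, Ne.symm hi]
  simp only [h2, and_comm (b := w = j)]
  ring

theorem mask_insert {V : Type} [DecidableEq V] (E : V → K) {w : V} {s : Finset V} (hw : w ∉ s) :
    (fun u => if u ∈ insert w s then E u else 0) =
      (fun u => if u ∈ s then E u else 0) + E w • Pi.single w 1 := by
  funext u
  by_cases hu : u = w
  · subst hu; simp [hw]
  · simp [hu]

/-- The formula behind local complementation: the square is completed by one change of variables
for each neighbour of the quantified vertex. -/
theorem isQuad_Ex_vertex (a : K) {z : K} (hz : z ≠ 0) (E : V → K) (s : Finset V) :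
    IsQuad (Ex (ph a z (Sum.inr ()) * ∏ u ∈ s, edge (E u) (Sum.inr ()) (Sum.inl u)))
      ((a / z) • fun u => if u ∈ s then E u else 0)
      (-z⁻¹ • vecMulVec (fun u => if u ∈ s then E u else 0)
        (fun u => if u ∈ s then E u else 0)) := by
  induction s using Finset.induction_on with
  | empty =>
    rw [Finset.prod_empty, mul_one, Ex_ph a hz]
    refine IsQuad.one.congr ?_ ?_
    · ext; simp
    · ext; simp [vecMulVec_apply]
  | insert w s hw ih =>
    have h : shear w (E w / z) (ph a z (Sum.inr ()) *
        ∏ u ∈ insert w s, edge (E u) (Sum.inr ()) (Sum.inl u)) =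
        map Sum.inl (ph (E w / z * a) ((E w / z) ^ 2 * z) w * edge (E w / z * E w) w w *
          ∏ u ∈ s, edge (E w / z * E u) w u) *
        (ph a z (Sum.inr ()) * ∏ u ∈ s, edge (E u) (Sum.inr ()) (Sum.inl u)) := by
      have h1 : edge (-(E w / z * z)) (Sum.inr () : V ⊕ Unit) (Sum.inl w) *
          edge (E w) (Sum.inr ()) (Sum.inl w) = 1 := by
        rw [edge_add, div_mul_cancel₀ _ hz, neg_add_cancel, edge_zero]
      rw [Finset.prod_insert hw, _root_.map_mul, _root_.map_mul, _root_.map_prod, shear_ph,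
        shear_edge]
      simp only [shear_edge, Finset.prod_mul_distrib, map_mul, map_prod, map_ph, map_edge]
      have h2 : ∀ p q r r' t u v : T K (V ⊕ Unit), r * r' = 1 →
          p * q * r * (r' * t * (u * v)) = q * t * v * (p * u) := by
        intro p q r r' t u v hr
        calc _ = (r * r') * (q * t * v * (p * u)) := by ac_rfl
          _ = _ := by rw [hr, one_mul]
      exact h2 _ _ _ _ _ _ _ h1
    rw [← Ex_shear w (E w / z), h, Ex_map_inl_mul]
    have h3 := (((IsQuad.of_ph_smul (E w / z * a) ((E w / z) ^ 2 * z) w).mul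
      (IsQuad.of_edge (E w / z * E w) w w)).mul
        (IsQuad.prod_edge_insert w (fun u => E w / z * E u) s)).mul ih
    have h4 : (fun u => if u ∈ s then E w / z * E u else 0) =
        (E w / z) • fun u => if u ∈ s then E u else 0 := by
      funext u; simp
    have h5 : Matrix.single w w (E w / z * E w) =
        (E w / z * E w) • vecMulVec (Pi.single w 1) (Pi.single w 1) := by
      rw [← single_eq_single_vecMulVec_single]; simp
    rw [h4, h5] at h3
    refine h3.congr ?_ ?_
    · rw [mask_insert E hw]
      ext u
      simp only [Pi.add_apply, Pi.smul_apply, Pi.zero_apply, smul_eq_mul]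
      ring
    · rw [mask_insert E hw]
      ext u v
      simp only [Matrix.add_apply, Matrix.sub_apply, Matrix.neg_apply, Matrix.smul_apply,
        vecMulVec_apply, Pi.add_apply, Pi.smul_apply, smul_eq_mul]
      field_simp
      ring

/-- The formula behind pivoting. -/
theorem Ex_pivot (a b : K) {e : K} (he : e ≠ 0) (E F : V → K) (s t : Finset V) :
    Ex (ph a 0 (Sum.inr ()) * (∏ u ∈ s, edge (E u) (Sum.inr ()) (Sum.inl u)) *
      Ex (ph b 0 (Sum.inr ()) * edge e (Sum.inr ()) (Sum.inl (Sum.inr ())) *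
        ∏ u ∈ t, edge (F u) (Sum.inr ()) (Sum.inl (Sum.inl u)))) =
    (∏ w ∈ s, (ph (-(E w / e) * b) 0 w * ∏ u ∈ t, edge (-(E w / e) * F u) w u)) *
      ∏ w ∈ t, ph (-(F w / e) * a) 0 w := by
  have h1 : ∀ {W : Type} [Finite W] (b : K) (φ : V → W) (x : W) (E F : V → K)
      (s t : Finset V) , (∏ u ∈ s, edge (E u) x (φ u)) *
        Ex (ph b 0 (Sum.inr ()) * edge e (Sum.inr ()) (Sum.inl x) *
          ∏ u ∈ t, edge (F u) (Sum.inr ()) (Sum.inl (φ u))) =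
      (∏ w ∈ s, (ph (-(E w / e) * b) 0 (φ w) * ∏ u ∈ t, edge (-(E w / e) * F u) (φ w) (φ u))) *
        Ex (ph b 0 (Sum.inr ()) * edge e (Sum.inr ()) (Sum.inl x) *
          ∏ u ∈ t, edge (F u) (Sum.inr ()) (Sum.inl (φ u))) := by
    intro W _ b φ x E F s t
    induction s using Finset.induction_on with
    | empty => simp
    | insert w s hw ih =>
      rw [Finset.prod_insert hw, Finset.prod_insert hw, mul_assoc, ih, mul_left_comm,
        edge_mul_Ex_constraint b he φ F t]
      ac_rfl
  have h2 := h1 b (Sum.inl : V → V ⊕ Unit) (Sum.inr ()) E F s t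
  rw [mul_assoc, h2, mul_left_comm]
  rw [Ex_mul_left (∏ w ∈ s, (ph (-(E w / e) * b) 0 w * ∏ u ∈ t, edge (-(E w / e) * F u) w u))
    (by simp only [map_mul, map_prod, map_ph, map_edge])]
  refine congrArg _ ?_
  have h3 := Ex_mul_Ex_comm (ph a 0 (Sum.inr ()))
    (ph b 0 (Sum.inr ()) * ∏ u ∈ t, edge (F u) (Sum.inr ()) (Sum.inl u))
    (edge e (Sum.inr ()) (Sum.inl (Sum.inr ())))
  simp only [map_mul, map_prod, map_ph, map_edge] at h3
  have h4 := h1 a (Sum.inl : V → V ⊕ Unit) (Sum.inr ()) F 0 t ∅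
  simp only [Finset.prod_empty, mul_one] at h4
  have h5 := Ex_ph_edge a he (Sum.inr () : V ⊕ Unit)
  rw [mul_comm, mul_right_comm]
  refine h3.trans ?_
  have h6 : Ex (edge e (Sum.inl (Sum.inr ())) (Sum.inr ()) * ph a 0 (Sum.inr ())) =
      affine (-(a / e)) (Sum.inr () : V ⊕ Unit) := by
    rw [← h5, mul_comm, edge_comm]
  rw [h5] at h4
  refine (congrArg (fun t => Ex (_ * t)) h6).trans ?_
  rw [mul_assoc, h4, mul_left_comm, Ex_mul_left (∏ w ∈ t, ph (-(F w / e) * a) 0 w)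
    (by simp only [map_prod, map_ph]), mul_comm (ph b 0 _), Ex_affine_ph, mul_one]

/-- The property that the variables in `I` can be eliminated from a quadratic formula, for the
matrix `M` of the form in these variables: the values of the variables in `I` are given by solutions
of linear equations. -/
def Eliminates (M : Matrix I I K) : Prop :=
  ∀ ⦃V : Type⦄ [Fintype V] [DecidableEq V] ⦃f : T K (V ⊕ I)⦄ ⦃y : V → K⦄ ⦃x t : I → K⦄
    ⦃A : Matrix V V K⦄ ⦃P C : Matrix I V K⦄,
    IsQuad f (Sum.elim y x) (fromBlocks A Pᵀ P M) → M * C = P → M *ᵥ t = x →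
      IsQuad (Ex f) (y - Pᵀ *ᵥ t) (A - Pᵀ * C)

theorem eliminates_unit (M : Matrix Unit Unit K) (hM : M () () ≠ 0) : Eliminates M := by
  intro V _ _ f y x t A P C h hC ht
  obtain ⟨g, k, hg, hk, rfl⟩ := h.exists_block
  have h1 : k = ph (x ()) (M () ()) () := by
    refine hk.unique ((IsQuad.of_ph (x ()) (M () ()) ()).congr ?_ ?_)
    · ext; simp
    · ext; simp
  rw [mul_assoc, Ex_map_inl_mul, h1, map_ph, Fintype.prod_unique]
  refine (hg.mul (isQuad_Ex_vertex (x ()) hM (fun v => -P () v) Finset.univ)).congr ?_ ?_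
  · subst ht
    ext v
    simp [mulVec, dotProduct]
    field_simp
    ring
  · subst hC
    ext u v
    simp [Matrix.mul_apply, vecMulVec_apply]
    field_simp
    ring

theorem eliminates_pair (M : Matrix (Unit ⊕ Unit) (Unit ⊕ Unit) K) {ε : K} (hε : ε ≠ 0)
    (h00 : M (Sum.inl ()) (Sum.inl ()) = 0) (h01 : M (Sum.inl ()) (Sum.inr ()) = ε)
    (h10 : M (Sum.inr ()) (Sum.inl ()) = ε) (h11 : M (Sum.inr ()) (Sum.inr ()) = 0) :
    Eliminates M := by
  intro V _ _ f y x t A P C h hC ht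
  obtain ⟨g, k, hg, hk, rfl⟩ := h.exists_block
  have h1 : k = ph (x (Sum.inl ())) 0 (Sum.inl ()) * ph (x (Sum.inr ())) 0 (Sum.inr ()) *
      edge (-ε) (Sum.inr ()) (Sum.inl ()) := by
    refine hk.unique ((((IsQuad.of_ph _ _ _).mul (IsQuad.of_ph _ _ _)).mul
      (IsQuad.of_edge _ _ _)).congr ?_ ?_)
    · ext i; rcases i with i | i <;> simp
    · ext i j
      rcases i with i | i <;> rcases j with j | j <;> simp [h00, h01, h10, h11]
  have h2 := Ex_pivot (x (Sum.inl ())) (x (Sum.inr ())) (neg_ne_zero.2 hε)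
    (fun v => -P (Sum.inl ()) v) (fun v => -P (Sum.inr ()) v) Finset.univ Finset.univ
  rw [← Ex_map_inl_mul] at h2
  have h3 : Ex (map Sum.inr k * ∏ i, ∏ v, edge (-P i v) (Sum.inr i) (Sum.inl v)) =
      Ex (Ex (map Sum.inl (ph (x (Sum.inl ())) 0 (Sum.inr () : V ⊕ Unit) *
        ∏ u, edge (-P (Sum.inl ()) u) (Sum.inr ()) (Sum.inl u)) *
          (ph (x (Sum.inr ())) 0 (Sum.inr () : (V ⊕ Unit) ⊕ Unit) *
            edge (-ε) (Sum.inr ()) (Sum.inl (Sum.inr ())) *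
            ∏ u, edge (-P (Sum.inr ()) u) (Sum.inr ()) (Sum.inl (Sum.inl u))))) := by
    rw [h1, Ex_sum]
    refine congrArg Ex (congrArg Ex ?_)
    simp only [map_mul, map_prod, map_ph, map_edge, Fintype.prod_sum_type,
      Fintype.prod_unique]
    refine Eq.trans ?_ (mul_mul_mul_comm _ _ _ _)
    exact congrArg (· * _) (mul_assoc _ _ _)
  have h4 := (IsQuad.prod Finset.univ _ _ _ fun w => (IsQuad.of_ph_smul
    (-(-P (Sum.inl ()) w / -ε) * x (Sum.inr ())) 0 w).mul (IsQuad.prod_edge_insert w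
      (fun u => -(-P (Sum.inl ()) w / -ε) * -P (Sum.inr ()) u) Finset.univ)).mul
    (IsQuad.prod Finset.univ _ _ _ fun w => IsQuad.of_ph_smul
      (-(-P (Sum.inr ()) w / -ε) * x (Sum.inl ())) 0 w)
  rw [mul_assoc, Ex_map_inl_mul, h3, h2]
  refine (hg.mul h4).congr ?_ ?_
  · subst ht
    ext v
    simp [mulVec, dotProduct, h00, h01, h10, h11, Finset.sum_apply, Pi.single_apply]
    field_simp
    ring
  · subst hC
    ext u v
    simp [Matrix.mul_apply, vecMulVec_apply, Matrix.sum_apply, h00, h01, h10, h11,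
      Pi.single_apply]
    field_simp
    ring

end T
end Elimination
/-! ### Elimination of a nonsingular block -/

section Elimination
open Hom Matrix
variable {K : Type u} [Field K] {V W I J : Type}

namespace T
variable [Fintype V] [Fintype W] [Fintype I] [Fintype J]
  [DecidableEq V] [DecidableEq W] [DecidableEq I] [DecidableEq J]

theorem Eliminates.of_submatrix {M : Matrix I I K} (e : J ≃ I)
    (h : Eliminates (M.submatrix e e)) : Eliminates M := by
  intro V _ _ f y x t A P C hf hC ht
  have h2 : (t ∘ e) ∘ e.symm = t := by funext i; simp
  have h1 := h (f := map (Sum.map id e.symm) f) (y := y) (x := x ∘ e) (t := t ∘ e) (A := A)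
    (P := P.submatrix e id) (C := C.submatrix e id) ?_ ?_ ?_
  · rw [Ex_relabel] at h1
    refine h1.congr ?_ ?_
    · rw [transpose_submatrix, submatrix_mulVec_equiv, h2]
      rfl
    · rw [transpose_submatrix, submatrix_mul_equiv, submatrix_id_id]
  · refine (hf.map_equiv (Equiv.sumCongr (Equiv.refl V) e.symm)).congr ?_ ?_
    · funext v; rcases v with v | v <;> rfl
    · ext u v; rcases u with u | u <;> rcases v with v | v <;> rfl
  · rw [submatrix_mul_equiv, hC]
  · rw [submatrix_mulVec_equiv, ← ht, h2]

/-- Variables can be eliminated in two steps, where the second one concerns the Schur complement. -/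
theorem Eliminates.of_schur {A : Matrix I I K} (B : Matrix I J K) {D : Matrix J J K}
    (hs : Dᵀ = D) (hu : IsUnit D) (hD : Eliminates D) (hA : Eliminates (A - B * (D⁻¹ * Bᵀ))) :
    Eliminates (fromBlocks A B Bᵀ D) := by
  intro V _ _ f y x t S P C hf hC ht
  obtain ⟨P₁, P₂, rfl⟩ : ∃ P₁ P₂, P = fromRows P₁ P₂ := ⟨_, _, (fromRows_toRows P).symm⟩
  obtain ⟨C₁, C₂, rfl⟩ : ∃ C₁ C₂, C = fromRows C₁ C₂ := ⟨_, _, (fromRows_toRows C).symm⟩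
  obtain ⟨x₁, x₂, rfl⟩ : ∃ x₁ x₂, x = Sum.elim x₁ x₂ := ⟨_, _, (Sum.elim_comp_inl_inr x).symm⟩
  obtain ⟨t₁, t₂, rfl⟩ : ∃ t₁ t₂, t = Sum.elim t₁ t₂ := ⟨_, _, (Sum.elim_comp_inl_inr t).symm⟩
  rw [fromBlocks_mul_fromRows] at hC
  obtain ⟨hC₁, hC₂⟩ := (fromRows_ext_iff _ _ _ _).1 hC
  rw [fromBlocks_mulVec, Sum.elim_comp_inl, Sum.elim_comp_inr] at ht
  have ht₁ : A *ᵥ t₁ + B *ᵥ t₂ = x₁ := congrArg (· ∘ Sum.inl) ht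
  have ht₂ : Bᵀ *ᵥ t₁ + D *ᵥ t₂ = x₂ := congrArg (· ∘ Sum.inr) ht
  have hd : IsUnit D.det := (isUnit_iff_isUnit_det D).1 hu
  have h1 : IsQuad (map (Equiv.sumAssoc V I J).symm f) (Sum.elim (Sum.elim y x₁) x₂)
      (fromBlocks (fromBlocks S P₁ᵀ P₁ A) (fromCols P₂ Bᵀ)ᵀ (fromCols P₂ Bᵀ) D) := by
    refine (hf.map_equiv (Equiv.sumAssoc V I J).symm).congr ?_ ?_
    · funext u; rcases u with (u | u) | u <;> rfl
    · ext u v; rcases u with (u | u) | u <;> rcases v with (v | v) | v <;> rfl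
  have h2 := hD h1 (mul_nonsing_inv_cancel_left _ (fromCols P₂ Bᵀ) hd)
    (t := D⁻¹ *ᵥ x₂) (by rw [mulVec_mulVec, mul_nonsing_inv _ hd, one_mulVec])
  have e1 : D⁻¹ * P₂ = D⁻¹ * Bᵀ * C₁ + C₂ := by
    rw [← hC₂, Matrix.mul_add, nonsing_inv_mul_cancel_left _ _ hd, Matrix.mul_assoc]
  have e2 : D⁻¹ *ᵥ x₂ = (D⁻¹ * Bᵀ) *ᵥ t₁ + t₂ := by
    rw [← ht₂, mulVec_add, mulVec_mulVec, mulVec_mulVec, nonsing_inv_mul _ hd, one_mulVec]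
  have e3 : (P₁ - B * (D⁻¹ * P₂))ᵀ = P₁ᵀ - P₂ᵀ * (D⁻¹ * Bᵀ) := by
    rw [transpose_sub, transpose_mul, transpose_mul, transpose_nonsing_inv, hs, Matrix.mul_assoc]
  have h3 := hA (y := y - P₂ᵀ *ᵥ (D⁻¹ *ᵥ x₂)) (x := x₁ - B *ᵥ (D⁻¹ *ᵥ x₂)) (t := t₁)
    (A := S - P₂ᵀ * (D⁻¹ * P₂)) (P := P₁ - B * (D⁻¹ * P₂)) (C := C₁) (h2.congr ?_ ?_) ?_ ?_
  · rw [Ex_sum]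
    refine h3.congr ?_ ?_
    · rw [e3, e2, transpose_fromRows, fromCols_mulVec, Sum.elim_comp_inl, Sum.elim_comp_inr,
        sub_mulVec, mulVec_add, mulVec_mulVec]
      abel
    · rw [e3, e1, transpose_fromRows, fromCols_mul_fromRows, Matrix.sub_mul, Matrix.mul_add]
      simp only [Matrix.mul_assoc]
      abel
  · rw [transpose_fromCols, transpose_transpose, fromRows_mulVec]
    funext u; rcases u with u | u <;> rfl
  · rw [e3, transpose_fromCols, transpose_transpose, mul_fromCols, fromRows_mul_fromCols,
      sub_eq_add_neg, fromBlocks_neg, fromBlocks_add]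
    simp only [sub_eq_add_neg]
  · rw [e1, ← hC₁, Matrix.sub_mul, Matrix.mul_add, Matrix.mul_assoc]
    abel
  · rw [e2, ← ht₁, sub_mulVec, mulVec_add, mulVec_mulVec]
    abel

theorem eliminates_of_isEmpty [IsEmpty I] (M : Matrix I I K) : Eliminates M := by
  intro V _ _ f y x t A P C h hC ht
  rw [Ex_of_isEmpty]
  refine (h.map_equiv (Equiv.sumEmpty V I)).congr ?_ ?_
  · ext v; simp [mulVec, dotProduct]
  · ext u v; simp [Matrix.mul_apply]

/-- Eliminating the variables of a nonsingular principal submatrix. -/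
theorem Eliminates.of_minor {M : Matrix I I K} (hM : Mᵀ = M) (hu : IsUnit M) {ι : J → I}
    (hι : Function.Injective ι) (hd : IsUnit (M.submatrix ι ι)) (hD : Eliminates (M.submatrix ι ι))
    (ih : ∀ [Fintype ((Set.range ι)ᶜ : Set I)] [DecidableEq ((Set.range ι)ᶜ : Set I)]
      (A : Matrix ((Set.range ι)ᶜ : Set I) ((Set.range ι)ᶜ : Set I) K),
      Aᵀ = A → IsUnit A → Eliminates A) : Eliminates M := by
  classical
  -- the indices in the range of `ι` are put last
  let e : ((Set.range ι)ᶜ : Set I) ⊕ J ≃ I :=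
    (Equiv.sumComm _ _).trans ((Equiv.sumCongr (Equiv.ofInjective ι hι) (Equiv.refl _)).trans
      (Equiv.Set.sumCompl (Set.range ι)))
  refine Eliminates.of_submatrix (I := I) (J := ((Set.range ι)ᶜ : Set I) ⊕ J) e ?_
  have hu' : IsUnit (M.submatrix e e) := (isUnit_submatrix_equiv e e).2 hu
  set N := M.submatrix e e with hN
  have hNt : Nᵀ = N := by rw [hN, transpose_submatrix, hM]
  have h21 : N.toBlocks₁₂ᵀ = N.toBlocks₂₁ := by
    ext u v; exact congrFun (congrFun hNt _) _
  have h22 : N.toBlocks₂₂ᵀ = N.toBlocks₂₂ := by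
    ext u v; exact congrFun (congrFun hNt _) _
  have h11 : N.toBlocks₁₁ᵀ = N.toBlocks₁₁ := by
    ext u v; exact congrFun (congrFun hNt _) _
  have hD' : N.toBlocks₂₂ = M.submatrix ι ι := rfl
  rw [← fromBlocks_toBlocks N] at hu' ⊢
  rw [← h21] at hu' ⊢
  rw [← hD'] at hd hD
  refine Eliminates.of_schur _ h22 hd hD (ih _ ?_ ?_)
  · rw [transpose_sub, h11, transpose_mul, transpose_mul, transpose_transpose,
      transpose_nonsing_inv, h22, Matrix.mul_assoc]
  · have := hd.invertible
    rw [isUnit_fromBlocks_iff_of_invertible₂₂, invOf_eq_nonsing_inv, Matrix.mul_assoc] at hu'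
    exact hu'

/-- The variables of a nonsingular symmetric matrix can be eliminated. If the diagonal of the
matrix vanishes, two variables have to be eliminated at a time. -/
theorem eliminates_of_isUnit {M : Matrix I I K} (hM : Mᵀ = M) (hu : IsUnit M) : Eliminates M := by
  classical
  induction hn : Fintype.card I using Nat.strong_induction_on generalizing I with
  | _ n ih =>
  have ih' : ∀ {J : Type} [Nonempty J] {ι : J → I} [Fintype ((Set.range ι)ᶜ : Set I)]
      [DecidableEq ((Set.range ι)ᶜ : Set I)]
      (A : Matrix ((Set.range ι)ᶜ : Set I) ((Set.range ι)ᶜ : Set I) K),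
      Aᵀ = A → IsUnit A → Eliminates A := by
    intro J _ ι _ _ A h1 h2
    refine ih _ ?_ h1 h2 rfl
    rw [← hn]
    exact Fintype.card_subtype_lt (x := ι (Classical.arbitrary J)) (by simp)
  by_cases h0 : ∃ i, M i i ≠ 0
  · obtain ⟨i, hi⟩ := h0
    refine Eliminates.of_minor (I := I) (J := Unit) hM hu (ι := fun _ => i) (fun _ _ _ => rfl) ?_
      (eliminates_unit _ hi) ih'
    rw [isUnit_iff_isUnit_det, det_unique]
    exact isUnit_iff_ne_zero.2 hi
  push Not at h0
  by_cases h1 : ∃ i j, M i j ≠ 0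
  · obtain ⟨i, j, hij⟩ := h1
    have hji : M j i = M i j := congrFun (congrFun hM i) j
    have hne : i ≠ j := fun h => hij (h ▸ h0 i)
    refine Eliminates.of_minor (I := I) (J := Unit ⊕ Unit) hM hu
      (ι := Sum.elim (fun _ => i) fun _ => j) ?_ ?_
      (eliminates_pair _ hij (h0 i) rfl hji (h0 j)) ih'
    · rintro (u | u) (v | v) h
      · rfl
      · exact absurd h hne
      · exact absurd h hne.symm
      · rfl
    · refine IsUnit.of_mul_eq_one ((M i j)⁻¹ ^ 2 • M.submatrix (Sum.elim (fun _ : Unit => i)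
        fun _ : Unit => j) (Sum.elim (fun _ => i) fun _ => j)) ?_
      ext u v
      rcases u with u | u <;> rcases v with v | v <;>
        simp [Matrix.mul_apply, h0, hji] <;> field_simp
  · push Not at h1
    have : IsEmpty I := by
      by_contra hI
      rw [not_isEmpty_iff] at hI
      have h2 : M = 0 := by ext i j; exact h1 i j
      rw [h2] at hu
      exact not_isUnit_zero hu
    exact eliminates_of_isEmpty M

end T
end Elimination
/-! ### The formula of a thick grey spider -/

section GraphStates
open Hom Matrix
variable {K : Type u} [Field K] {V W A B C L I : Type}

namespace T
variable [Finite V] [Finite W] [Finite A] [Finite B] [Finite C] [Finite L] [Finite I]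

theorem grey_comp_grey (a b : K) : grey A Unit a b ⨾ grey Unit L 0 0 = grey A L a b := by
  have := Fintype.ofFinite A
  have := Fintype.ofFinite L
  refine hom_ext ?_
  rw [den_comp, den_grey_unit_right, den_grey_unit_left, den_grey, sp_eq_Ex,
    Fintype.prod_sum_type, ph_zero, one_mul, mul_assoc, eqs_comm, eqs_eq_prod, eqs_eq_prod]
  rfl

theorem den_grey_comp_idh_tens (a b : K) (h : Hom K C L) (α : A → V) (γ : B ⊕ L → V) :
    den (grey A (B ⊕ C) a b ⨾ (idh B ⊠ h)) α γ =
      Ex (ph a b (Sum.inr () : V ⊕ Unit) * eqs (fun _ => Sum.inr ()) (Sum.inl ∘ α) *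
        eqs (fun _ => Sum.inr ()) (Sum.inl ∘ γ ∘ Sum.inl) *
        den h (fun _ => Sum.inr ()) (Sum.inl ∘ γ ∘ Sum.inr)) := by
  rw [← grey_comp_grey, comp_assoc, den_comp, den_grey_unit_right, den_grey_unit_comp, ph_zero,
    one_mul, den_tens, den_idh, eqs_comm, mul_assoc (ph _ _ _ * _)]
  rfl

/-- The formula of a thick grey spider: the vertices are quantified variables that carry a quadratic
formula and are equal to all their legs. -/
theorem exists_den_thickGrey (k : ℕ) (x : Fin k → K) (X : Matrix (Fin k) (Fin k) K)
    (hX : X.IsSymm) : ∃ g : T K (Fin k), IsQuad g x X ∧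
      ∀ {V A B : Type} [Finite V] [Finite A] [Finite B] (α : Fin k × A → V) (β : Fin k × B → V),
        den (mk (thickGrey k A B x X)) α β = Ex (map Sum.inr g *
          eqs (Sum.inr ∘ Prod.fst) (Sum.inl ∘ α) * eqs (Sum.inr ∘ Prod.fst) (Sum.inl ∘ β)) := by
  induction k with
  | zero =>
    refine ⟨1, IsQuad.one.congr (Subsingleton.elim _ _) (Subsingleton.elim _ _), ?_⟩
    intro V A B _ _ _ α β
    rw [thickGrey, mk_wire, den_wire, eqs_empty, map_one, eqs_empty, eqs_empty, one_mul, one_mul,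
      ← map_one (K := K) (Sum.inl : V → V ⊕ Fin 0), Ex_map_inl]
  | succ k ih =>
    obtain ⟨g, hg, h⟩ := ih (x ∘ Fin.succ) (X.submatrix Fin.succ Fin.succ)
      (hX.submatrix _)
    let e : Fin k ⊕ Unit ≃ Fin (k + 1) :=
      { toFun := Sum.elim Fin.succ fun _ => 0
        invFun := Fin.cases (Sum.inr ()) Sum.inl
        left_inv := by rintro (i | i) <;> rfl
        right_inv := fun i => by refine Fin.cases ?_ (fun i => ?_) i <;> rfl }
    -- the first vertex of the spider becomes the last variable
    let g' : T K (Fin k ⊕ Unit) := map Sum.inl g * map Sum.inr (ph (x 0) (X 0 0) ()) *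
      ∏ i : Unit, ∏ j, edge (-X 0 (Fin.succ j)) (Sum.inr i) (Sum.inl j)
    refine ⟨map e g', ?_, ?_⟩
    · have h1 := (hg.map_inl.mul (IsQuad.of_ph (x 0) (X 0 0) ()).map_inr).mul
        (IsQuad.prod_edge (Matrix.of fun (_ : Unit) (j : Fin k) => -X 0 (Fin.succ j)))
      refine (h1.map_equiv e).congr ?_ ?_
      · rw [Equiv.comp_symm_eq]
        funext i; rcases i with i | i <;> simp [e]
      · have h2 : X = (X.submatrix e e).submatrix e.symm e.symm := by
          rw [submatrix_submatrix, e.self_comp_symm, submatrix_id_id]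
        conv_rhs => rw [h2]
        congr 1
        ext i j; rcases i with i | i <;> rcases j with j | j <;> simp [e, hX.apply]
    · intro V A B _ _ _ α β
      let α₀ : A → V := fun a => α (0, a)
      let β₀ : B → V := fun b => β (0, b)
      let α₁ : Fin k × A → V := fun p => α (p.1.succ, p.2)
      let β₁ : Fin k × B → V := fun p => β (p.1.succ, p.2)
      let t : Fin k × (Unit ⊕ A) → V ⊕ Fin k :=
        fun p => Sum.elim (fun _ => Sum.inr p.1) (fun a => Sum.inl (α₁ (p.1, a))) p.2
      -- the composition in the definition, with the variables of the middle wires quantified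
      have h1 : den (mk (thickGrey (k + 1) A B x X)) α β =
          Ex (den (grey A (B ⊕ Fin k) (x 0) (X 0 0) ⨾
              (idh B ⊠ mk (boxes k fun j => -X 0 (Fin.succ j))))
                (Sum.inl ∘ α₀) (Sum.elim (Sum.inl ∘ β₀) Sum.inr) *
            den (mk (thickGrey k (Unit ⊕ A) B (x ∘ Fin.succ) (X.submatrix Fin.succ Fin.succ)))
              t (Sum.inl ∘ β₁)) := by
        rw [thickGrey]
        simp only [mk_comp, mk_tensor, mk_wire, mk_idn]
        rw [den_wire_comp, den_tens_idh_comp, den_wire_comp, den_comp_wire, den_tens, den_idh,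
          den_wire_comp, mul_left_comm, eqs_comm]
        refine (Ex_eqs_inl β₀ _).trans ?_
        rw [map_mul, map_den, map_den]
        congr 2
        refine congrArg (fun l => den _ l _) (funext ?_)
        rintro ⟨i, j | j⟩ <;> rfl
      -- the first input of each remaining vertex, quantified outside, replaces its variable
      have h2 : den (mk (thickGrey k (Unit ⊕ A) B (x ∘ Fin.succ)
          (X.submatrix Fin.succ Fin.succ))) t (Sum.inl ∘ β₁) = map Sum.inr g *
            eqs (Sum.inr ∘ Prod.fst) (Sum.inl ∘ α₁) * eqs (Sum.inr ∘ Prod.fst) (Sum.inl ∘ β₁) := by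
        have h3 : eqs (K := K) (Sum.inr ∘ Prod.fst : _ → (V ⊕ Fin k) ⊕ Fin k) (Sum.inl ∘ t) =
            eqs Sum.inr (Sum.inl ∘ Sum.inr) *
              eqs (Sum.inr ∘ Prod.fst) (Sum.inl ∘ Sum.inl ∘ α₁) := by
          rw [← eqs_equiv ((Equiv.sumCongr (Equiv.prodPUnit (Fin k)).symm
            (Equiv.refl (Fin k × A))).trans (Equiv.prodSumDistrib (Fin k) Unit A).symm), eqs_sum]
          rfl
        have h4 := Ex_mul_eqs (map (Sum.inr : Fin k → (V ⊕ Fin k) ⊕ Fin k) g *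
          eqs (Sum.inr ∘ Prod.fst) (Sum.inl ∘ Sum.inl ∘ α₁) *
            eqs (Sum.inr ∘ Prod.fst) (Sum.inl ∘ Sum.inl ∘ β₁)) (Sum.inr : Fin k → V ⊕ Fin k)
        rw [map_mul, map_mul, map_map, map_eqs, map_eqs] at h4
        rw [h, h3]
        refine (congrArg Ex ?_).trans h4
        ac_rfl
      rw [h1, h2, den_grey_comp_idh_tens, den_boxes, ← Ex_mul_map_inl, ← Ex_relabel e.symm, Ex_sum,
        ← eqs_equiv (splitFirst k A).symm, ← eqs_equiv (splitFirst k B).symm, eqs_sum, eqs_sum]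
      refine congrArg Ex (congrArg Ex ?_)
      simp only [map_mul, map_map, map_eqs, map_prod, map_ph, map_edge, g', Finset.univ_unique,
        Finset.prod_singleton]
      have h3 : ∀ p q r s t u v : T K ((V ⊕ Fin k) ⊕ Unit),
          p * q * r * s * (t * u * v) = t * p * s * (q * u) * (r * v) := by
        intros; ac_rfl
      exact h3 _ _ _ _ _ _ _

end T
end GraphStates
/-! ### The formulas of graph-like diagrams -/

section Diagrams
open Hom Matrix
variable {K : Type u} [Field K] {V I : Type}

namespace T

/-- Attaching a graph state to a state multiplies the formula of the state by the formula of the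
graph state. -/
theorem exists_comp_thickGrey (k : ℕ) (y : Fin k → K) (Y : Matrix (Fin k) (Fin k) K)
    (hY : Y.IsSymm) : ∃ g : T K (Fin k), IsQuad g y Y ∧
      ∀ {A : Type} [Finite A] (s : Hom K Empty (Fin k × A)),
        s ⨾ mk (thickGrey k A Unit y Y) ⨾ wire (Equiv.prodPUnit (Fin k)) =
          g * map Prod.fst s := by
  obtain ⟨g, hg, h⟩ := exists_den_thickGrey k y Y hY
  refine ⟨g, hg, fun {A} _ s => ?_⟩
  have h1 : ∀ (α : Fin k × A → Fin k ⊕ Fin k × A),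
      den (mk (thickGrey k A Unit y Y) ⨾ wire (Equiv.prodPUnit (Fin k))) α Sum.inl =
        map Sum.inl g * eqs (Sum.inl ∘ Prod.fst) α := by
    intro α
    have h2 : eqs (K := K) (Sum.inr ∘ Prod.fst : _ → (Fin k ⊕ Fin k × A) ⊕ Fin k)
        (Sum.inl ∘ Sum.inl ∘ Equiv.prodPUnit (Fin k)) = eqs Sum.inr (Sum.inl ∘ Sum.inl) :=
      eqs_equiv (Equiv.prodPUnit (Fin k)) Sum.inr (Sum.inl ∘ Sum.inl)
    have h3 := Ex_mul_eqs (map (Sum.inr : Fin k → (Fin k ⊕ Fin k × A) ⊕ Fin k) g *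
      eqs (Sum.inr ∘ Prod.fst) (Sum.inl ∘ α)) (Sum.inl : Fin k → Fin k ⊕ Fin k × A)
    rw [map_mul, map_map, map_eqs] at h3
    rw [den_comp_wire, h, h2]
    exact h3
  have h2 := den_comp s (mk (thickGrey k A Unit y Y) ⨾ wire (Equiv.prodPUnit (Fin k)))
    (Empty.elim : Empty → Fin k) id
  rw [den_state, map_id, den_state, Function.comp_id, h1, mul_left_comm, Ex_map_inl_mul,
    eqs_mul_Ex, map_map] at h2
  exact h2

theorem isQuad_graphState (n : ℕ) (y : Fin n → K) (Y : Matrix (Fin n) (Fin n) K)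
    (hY : Y.IsSymm) : IsQuad (mk (graphState n y Y)) y Y := by
  obtain ⟨g, hg, h⟩ := exists_comp_thickGrey n y Y hY
  have h1 := h (A := Empty) (wire (Equiv.equivOfIsEmpty Empty (Fin n × Empty)))
  rw [← den_state (wire _) (Empty.elim : Empty → Fin n), den_wire, eqs_empty, mul_one] at h1
  rw [show mk (graphState n y Y) = g from h1]
  exact hg

/-- Elimination of internal vertices from the formula of a graph-like diagram whose boundary
vertices carry the formula `g` and whose internal vertices carry the formula `f`. -/
theorem Eliminates.isQuad_mul_Ex [Fintype V] [DecidableEq V] [Fintype I] [DecidableEq I]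
    {M : Matrix I I K} (hM : Eliminates M) {g : T K V} {f : T K I} {y : V → K} {x t : I → K}
    {Y : Matrix V V K} {E C : Matrix I V K} (hg : IsQuad g y Y) (hf : IsQuad f x M)
    (hC : M * C = E) (ht : M *ᵥ t = x) :
    IsQuad (g * Ex (map Sum.inr f * ∏ i, ∏ v, edge (E i v) (Sum.inr i) (Sum.inl v)))
      (y + Eᵀ *ᵥ t) (Y - Eᵀ * C) := by
  have h := hM ((hg.map_inl.mul (hf.map_inr.mul (IsQuad.prod_edge E))).congr (y' := Sum.elim y x)
    (S' := fromBlocks Y (-E)ᵀ (-E) M) ?_ ?_) (C := -C) (by rw [Matrix.mul_neg, hC]) ht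
  · rw [Ex_map_inl_mul] at h
    refine h.congr ?_ ?_
    · rw [transpose_neg, neg_mulVec, sub_neg_eq_add]
    · rw [transpose_neg, Matrix.neg_mul, Matrix.mul_neg, neg_neg]
  · funext u; rcases u with u | u <;> simp
  · simp [fromBlocks_add]

theorem isQuad_blockDiagram {m n : ℕ} {x t : Fin m → K} {X : Matrix (Fin m) (Fin m) K}
    {E C : Matrix (Fin m) (Fin n) K} {y : Fin n → K} {Y : Matrix (Fin n) (Fin n) K}
    (hX : X.IsSymm) (hY : Y.IsSymm) (hM : Eliminates X) (hC : X * C = E) (ht : X *ᵥ t = x) :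
    IsQuad (mk (blockDiagram m n x X E y Y)) (y + Eᵀ *ᵥ t) (Y - Eᵀ * C) := by
  obtain ⟨g, hg, h⟩ := exists_comp_thickGrey n y Y hY
  obtain ⟨f, hf, hf'⟩ := exists_den_thickGrey m x X hX
  have h1 := h (wire (Equiv.equivOfIsEmpty Empty (Fin m × Empty)) ⨾
    mk (thickGrey m Empty (Fin n) x X) ⨾ mk (parallel m fun i => boxes n (E i)) ⨾
      wire (Equiv.prodComm (Fin m) (Fin n)))
  have h2 : mk (blockDiagram m n x X E y Y) = _ := Eq.trans (by
    rw [blockDiagram]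
    simp only [mk_comp, mk_wire, comp_assoc]) h1
  have h3 := hM.isQuad_mul_Ex hg hf hC ht
  rw [h2, ← den_state _ (Empty.elim : Empty → Fin n), den_wire_comp, ← comp_assoc, den_comp_wire,
    den_comp, hf', eqs_empty, mul_one, ← Ex_mul_map_inl, Ex_swap]
  convert h3 using 3
  have h4 := eqs_mul_Ex (map (Sum.inl ∘ Sum.inr : _ → (Fin n ⊕ Fin m) ⊕ Fin m × Fin n) f *
    ∏ i, ∏ j, edge (E i j) (Sum.inr (i, j)) (Sum.inl (Sum.inl j))) (Sum.inr ∘ Prod.fst)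
  rw [map_mul, map_map, map_prod] at h4
  simp only [map_prod, map_edge] at h4
  refine Eq.trans (congrArg Ex ?_) h4
  rw [den_parallel]
  simp only [den_boxes, map_mul, map_map, map_prod, map_edge, map_eqs]
  rw [mul_right_comm]
  rfl

theorem isQuad_vertexDiagram {k : ℕ} {a z : K} (hz : z ≠ 0) {E y : Fin k → K}
    {Y : Matrix (Fin k) (Fin k) K} (hY : Y.IsSymm) :
    IsQuad (mk (vertexDiagram k a z E y Y)) (fun i => y i + E i * a * z⁻¹)
      (Matrix.of fun i j => Y i j - z⁻¹ * E i * E j) := by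
  obtain ⟨g, hg, h⟩ := exists_comp_thickGrey k y Y hY
  have h1 := h (grey Empty (Fin k) a z ⨾ mk (boxes k E) ⨾ wire (Equiv.prodPUnit (Fin k)).symm)
  have h2 : mk (vertexDiagram k a z E y Y) = _ := Eq.trans (by
    rw [vertexDiagram]
    simp only [mk_comp, mk_wire, mk_grey, comp_assoc]) h1
  have h3 := (eliminates_unit (K := K) (Matrix.of fun _ _ => z) hz).isQuad_mul_Ex hg
    ((IsQuad.of_ph a z ()).congr (y' := fun _ => a) (S' := Matrix.of fun _ _ => z)
      (by ext; simp) (by ext; simp))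
    (C := Matrix.of fun _ j => z⁻¹ * E j) (E := Matrix.of fun _ j => E j)
    (t := fun _ => z⁻¹ * a) (by ext; simp [Matrix.mul_apply, hz])
    (by ext; simp [mulVec, dotProduct, hz])
  rw [h2, ← den_state _ (Empty.elim : Empty → Fin k), ← grey_comp_grey, comp_assoc, den_comp,
    den_grey_unit_right, eqs_empty, mul_one, den_grey_unit_comp, ph_zero, one_mul, den_comp_wire,
    den_boxes]
  rw [map_ph, Fintype.prod_unique] at h3
  refine IsQuad.congr h3 ?_ ?_
  · ext i; simp [mulVec, dotProduct]; ring
  · ext i j; simp [Matrix.mul_apply]; ring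

theorem isQuad_edgeDiagram {k : ℕ} {a b ε : K} (hε : ε ≠ 0) {E₁ E₂ y : Fin k → K}
    {Y : Matrix (Fin k) (Fin k) K} (hY : Y.IsSymm) :
    IsQuad (mk (edgeDiagram k a b ε E₁ E₂ y Y))
      (fun i => y i + ε⁻¹ * (a * E₂ i + b * E₁ i))
      (Matrix.of fun i j => Y i j - ε⁻¹ * (E₁ i * E₂ j + E₁ j * E₂ i)) := by
  obtain ⟨g, hg, h⟩ := exists_comp_thickGrey k y Y hY
  let w := (Equiv.sumCongr (Equiv.prodPUnit.{0} (Fin k)).symm (Equiv.prodPUnit (Fin k)).symm).trans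
    (Equiv.prodSumDistrib (Fin k) Unit Unit).symm
  let s : Hom K Unit (Fin k) := box (-ε) ⨾ grey Unit (Fin k) b 0 ⨾ mk (boxes k E₂)
  have h1 := h (grey Empty (Fin k ⊕ Unit) a 0 ⨾ (mk (boxes k E₁) ⊠ s) ⨾ wire w)
  have h2 : mk (edgeDiagram k a b ε E₁ E₂ y Y) = _ := Eq.trans (by
    rw [edgeDiagram]
    simp only [mk_comp, mk_wire, mk_grey, mk_tensor, mk_box, mk_idn, comp_assoc, s]
    rw [← comp_assoc (idh _ ⊠ _), ← comp_tens_comp, id_comp, comp_assoc]) h1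
  let M : Matrix (Unit ⊕ Unit) (Unit ⊕ Unit) K := fromBlocks 0 (of fun _ _ => ε) (of fun _ _ => ε) 0
  have h4 : IsQuad (ph a 0 (Sum.inl ()) * ph b 0 (Sum.inr ()) *
      edge (-ε) (Sum.inl ()) (Sum.inr ())) (Sum.elim (fun _ => a) fun _ => b) M := by
    refine (((IsQuad.of_ph a 0 _).mul (IsQuad.of_ph b 0 _)).mul (IsQuad.of_edge _ _ _)).congr ?_ ?_
    · ext i; rcases i with i | i <;> simp
    · ext i j; rcases i with i | i <;> rcases j with j | j <;> simp [M]
  have h3 := (eliminates_pair M hε rfl rfl rfl rfl).isQuad_mul_Ex hg h4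
    (C := fromRows (of fun _ j => ε⁻¹ * E₂ j) (of fun _ j => ε⁻¹ * E₁ j))
    (E := fromRows (of fun _ j => E₁ j) (of fun _ j => E₂ j))
    (t := Sum.elim (fun _ => ε⁻¹ * b) fun _ => ε⁻¹ * a)
    (by ext i j; rcases i with i | i <;> simp [M, Matrix.mul_apply, hε])
    (by ext i; rcases i with i | i <;> simp [M, mulVec, dotProduct, hε])
  have h5 : ∀ {V : Type} [Finite V] (α : Unit → V) (β : Fin k → V), den s α β =
      Ex (edge (-ε) (Sum.inl (α ())) (Sum.inr ()) * ph b 0 (Sum.inr ()) *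
        ∏ i, edge (E₂ i) (Sum.inr ()) (Sum.inl (β i))) := by
    intro V _ α β
    rw [den_comp, den_grey_unit_comp, den_boxes, ← mul_assoc]
    rfl
  rw [h2, ← den_state _ (Empty.elim : Empty → Fin k), ← grey_comp_grey, comp_assoc, den_comp,
    den_grey_unit_right, eqs_empty, mul_one, den_grey_unit_comp, ph_zero, one_mul, den_comp_wire,
    den_tens, den_boxes, h5,
    ← mul_assoc, ← Ex_map_inl_mul _ (ph a 0 (Sum.inr ()) * _)]
  rw [Ex_sum] at h3
  simp only [map_mul, map_prod, map_ph, map_edge, Fintype.prod_sum_type, Fintype.prod_unique]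
    at h3 ⊢
  have h6 : ∀ p q r s t : T K ((Fin k ⊕ Unit) ⊕ Unit),
      p * q * r * (s * t) = p * s * (r * q * t) := by
    intros; ac_rfl
  refine Eq.subst (motive := fun F => IsQuad (g * Ex (Ex F)) _ _) (h6 _ _ _ _ _)
    (IsQuad.congr h3 ?_ ?_)
  · ext i; simp [mulVec, dotProduct]; ring
  · ext i j; simp [Matrix.mul_apply]; ring

end T
end Diagrams
end ZX

theorem mainTheorem7 {K : Type*} [Field K] :
    -- elimination of an internal block with invertible symplectic phase
    (∀ (m n : ℕ) (x : Fin m → K) (X : Matrix (Fin m) (Fin m) K) (E : Matrix (Fin m) (Fin n) K)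
      (y : Fin n → K) (Y : Matrix (Fin n) (Fin n) K),
      X.IsSymm → IsUnit X → Y.IsSymm →
      ZX.Eqv (ZX.blockDiagram m n x X E y Y)
        (ZX.graphState n (y + (E.transpose * X⁻¹).mulVec x) (Y - E.transpose * X⁻¹ * E))) ∧
    -- local complementation
    (∀ (k : ℕ) (a z : K) (E y : Fin k → K) (Y : Matrix (Fin k) (Fin k) K),
      z ≠ 0 → Y.IsSymm →
      ZX.Eqv (ZX.vertexDiagram k a z E y Y)
        (ZX.graphState k (fun i => y i + E i * a * z⁻¹)
          (Matrix.of fun i j =>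
            if i = j then Y i i - z⁻¹ * E i ^ 2 else Y i j - z⁻¹ * E i * E j))) ∧
    -- pivoting
    (∀ (k : ℕ) (a b ε : K) (E₁ E₂ y : Fin k → K) (Y : Matrix (Fin k) (Fin k) K),
      ε ≠ 0 → Y.IsSymm →
      ZX.Eqv (ZX.edgeDiagram k a b ε E₁ E₂ y Y)
        (ZX.graphState k (fun i => y i + ε⁻¹ * (a * E₂ i + b * E₁ i))
          (Matrix.of fun i j =>
            if i = j then Y i i - 2 * ε⁻¹ * E₁ i * E₂ i
            else Y i j - ε⁻¹ * (E₁ i * E₂ j + E₁ j * E₂ i)))) := by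
  refine ⟨fun m n x X E y Y hX hu hY => ?_, fun k a z E y Y hz hY => ?_,
    fun k a b ε E₁ E₂ y Y hε hY => ?_⟩
  · have hd : IsUnit X.det := (Matrix.isUnit_iff_isUnit_det X).1 hu
    have hs : (Y - E.transpose * X⁻¹ * E).IsSymm := by
      rw [Matrix.IsSymm, Matrix.transpose_sub, Matrix.transpose_mul, Matrix.transpose_mul,
        Matrix.transpose_transpose, Matrix.transpose_nonsing_inv, hX.eq, hY.eq, Matrix.mul_assoc]
    have h := ZX.T.isQuad_blockDiagram (y := y) hX hY (ZX.T.eliminates_of_isUnit hX hu)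
      (X.mul_nonsing_inv_cancel_left E hd) (t := X⁻¹.mulVec x)
      (by rw [Matrix.mulVec_mulVec, X.mul_nonsing_inv hd, Matrix.one_mulVec])
    rw [Matrix.mulVec_mulVec, ← Matrix.mul_assoc] at h
    exact ZX.Hom.mk_eq_mk.1 (h.unique (ZX.T.isQuad_graphState _ _ _ hs))
  · have h : (Matrix.of fun i j =>
        if i = j then Y i i - z⁻¹ * E i ^ 2 else Y i j - z⁻¹ * E i * E j) =
          Matrix.of fun i j => Y i j - z⁻¹ * E i * E j := by
      ext i j
      by_cases hij : i = j
      · subst hij; simp [sq, mul_assoc]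
      · simp [hij]
    have hs : (Matrix.of fun i j => Y i j - z⁻¹ * E i * E j).IsSymm :=
      Matrix.IsSymm.ext fun i j => by simp only [Matrix.of_apply, hY.apply i j]; ring
    rw [h]
    exact ZX.Hom.mk_eq_mk.1
      ((ZX.T.isQuad_vertexDiagram hz hY).unique (ZX.T.isQuad_graphState _ _ _ hs))
  · have h : (Matrix.of fun i j =>
        if i = j then Y i i - 2 * ε⁻¹ * E₁ i * E₂ i
          else Y i j - ε⁻¹ * (E₁ i * E₂ j + E₁ j * E₂ i)) =
          Matrix.of fun i j => Y i j - ε⁻¹ * (E₁ i * E₂ j + E₁ j * E₂ i) := by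
      ext i j
      by_cases hij : i = j
      · subst hij; simp; ring
      · simp [hij]
    have hs : (Matrix.of fun i j => Y i j - ε⁻¹ * (E₁ i * E₂ j + E₁ j * E₂ i)).IsSymm :=
      Matrix.IsSymm.ext fun i j => by simp only [Matrix.of_apply, hY.apply i j]; ring
    rw [h]
    exact ZX.Hom.mk_eq_mk.1
      ((ZX.T.isQuad_edgeDiagram hε hY).unique (ZX.T.isQuad_graphState _ _ _ hs))
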